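/- Let $\Bbbk$ be a field and $n,m\ge 0$. **The algebra $R(n,m)$.** Let $\mathbf i$ range over sequences of $n$ ones (fermionic labels) and $m$ twos (bosonic labels), and let $s_t\mathbf i$ be $\mathbf i$ with its $t$-th and $(t+1)$-st entries exchanged. $R(n,m)$ is the associative unital $\Bbbk$-algebra generated by the diagrams $1_{\mathbf i}$ (vertical lines), $x_a1_{\mathbf i}$ ($1\le a\le m$; vertical lines with a dot on the $a$-th bosonic strand from the left) and $\psi_t1_{\mathbf i}$ ($1\le t<n+m$; crossing of the $t$-th and $(t+1)$-st strands, with lower labels $\mathbf i$ and upper labels $s_t\mathbf i$). The product $xy$ is $x$ placed on top of $y$, and it is $0$ if the labels do not match; $1=\sum_{\mathbf i}1_{\mathbf i}$. Writing $x_a$, $\psi_t$ for the sums over $\mathbf i$, the defining relations are: 1. if $|t-u|>1$, then $\psi_t\psi_u1_{\mathbf i}=-\psi_u\psi_t1_{\mathbf i}$ if both crossings are between two fermionic strands, and $\psi_t\psi_u1_{\mathbf i}=\psi_u\psi_t1_{\mathbf i}$ otherwise; 2. $x_ax_b=x_bx_a$, and $x_a\psi_t1_{\mathbf i}=\psi_tx_a1_{\mathbf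 i}$ unless the crossing is between two bosonic strands one of which is the $a$-th; 3. if the $t$-th and $(t+1)$-st strands of $\mathbf i$ are the $a$-th and $(a+1)$-st bosonic ones, then $(x_a\psi_t-\psi_tx_{a+1})1_{\mathbf i}=1_{\mathbf i}=(\psi_tx_a-x_{a+1}\psi_t)1_{\mathbf i}$; 4. $\psi_t^21_{\mathbf i}=0$ if $i_t=i_{t+1}$, and $\psi_t^21_{\mathbf i}=x_a1_{\mathbf i}$ if exactly one of the two strands is bosonic, and it is the $a$-th one; 5. $\psi_t\psi_{t+1}\psi_t1_{\mathbf i}=\psi_{t+1}\psi_t\psi_{t+1}1_{\mathbf i}$ unless $(i_t,i_{t+1},i_{t+2})=(2,1,2)$, in which case $(\psi_t\psi_{t+1}\psi_t-\psi_{t+1}\psi_t\psi_{t+1})1_{\mathbf i}=1_{\mathbf i}$. **Signs.** Let $LOT_n$ be the $\Bbbk$-algebra with generators $\sigma_1,\dots,\sigma_{n-1}$ and relations $\sigma_a^2=0$, $\sigma_a\sigma_b=-\sigma_b\sigma_a$ for $|a-b|>1$, $\sigma_a\sigma_{a+1}\sigma_a=\sigma_{a+1}\sigma_a\sigma_{a+1}$.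 For $w\in S_n$ with a reduced presentation $w'=(a_1,\dots,a_r)$, $w=s_{a_1}\cdots s_{a_r}$, put $\sigma_w=\epsilon(w')\sigma_{a_1}\cdots\sigma_{a_r}$. Here $\epsilon(w')$ is the product, over all pairs of inversions $(j_1,j_2)$, $(k_1,k_2)$ of $w$ with $j_1,j_2,k_1,k_2$ distinct and $j_1<k_1$, of $1$ if the term of $w'$ that creates the inversion $(j_1,j_2)$ is to the right of the term that creates $(k_1,k_2)$, and of $-1$ otherwise; $\sigma_w$ does not depend on $w'$. Let $\ell$ be the length function. There are signs $\epsilon_w^a\in\{1,-1\}$ with $\sigma_{s_aw}=\epsilon_w^a\sigma_a\sigma_w$ whenever $\ell(s_aw)=\ell(w)+1$. **The action.** Let $Pol=\bigoplus_{\mathbf i,\,w\in S_n}Pol(\mathbf i,w)$, $Pol(\mathbf i,w)=\Bbbk[x_1(\mathbf i,w),\dots,x_m(\mathbf i,w)]$. The following rules define an action of $R(n,m)$ on $Pol$. Each of $1_{\mathbf i}$, $x_a1_{\mathbf i}$, $\psi_t1_{\mathbf i}$ is zero on $Pol(\mathbf j,w)$ for $\mathbf j\ne\mathbf i$, and for $f\in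 Pol(\mathbf i,w)$ (identifying the variables of the different summands): * $1_{\mathbf i}f=f\in Pol(\mathbf i,w)$ and $(x_a1_{\mathbf i})f=x_af\in Pol(\mathbf i,w)$; * if strands $t,t+1$ are the $a$-th and $(a+1)$-st bosonic ones, $(\psi_t1_{\mathbf i})f=\frac{f-s_af}{x_a-x_{a+1}}\in Pol(\mathbf i,w)$, where $s_a$ exchanges $x_a$ and $x_{a+1}$; * if $(i_t,i_{t+1})=(1,2)$, $(\psi_t1_{\mathbf i})f=f\in Pol(s_t\mathbf i,w)$; * if $(i_t,i_{t+1})=(2,1)$ and strand $t$ is the $a$-th bosonic one, $(\psi_t1_{\mathbf i})f=x_af\in Pol(s_t\mathbf i,w)$; * if strands $t,t+1$ are the $a$-th and $(a+1)$-st fermionic ones, $(\psi_t1_{\mathbf i})f=\epsilon_w^af\in Pol(\mathbf i,s_aw)$ if $\ell(s_aw)=\ell(w)+1$, and $(\psi_t1_{\mathbf i})f=0$ if $\ell(s_aw)=\ell(w)-1$. This action is faithful. **Basis.** Fix a reduced presentation $w=s_{t_1}\cdots s_{t_r}$ of each $w\in S_{n+m}$. Then the diagrams $x_1^{e_1}\cdots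 x_m^{e_m}\psi_{t_1}\cdots\psi_{t_r}1_{\mathbf i}$ (dots only at the tops of the bosonic strands), over all $\mathbf i$, all $w\in S_{n+m}$ and all $e\in\mathbb Z_{\ge0}^m$, form a basis of $R(n,m)$ as a $\Bbbk$-vector space. **Consequences.** The homomorphism $\Bbbk[x_1,\dots,x_m]\to R(n,m)$ that takes $x_a$ to $\sum_{\mathbf i}x_a1_{\mathbf i}$ is injective. The image $\mathrm{Sym}(n,m)$ of the symmetric polynomials lies in the center of $R(n,m)$, $R(n,m)$ is a free $\mathrm{Sym}(n,m)$-module of finite rank, and $R(n,m)$ is both left and right Noetherian. -/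

import Mathlib

open MvPolynomial

noncomputable section

namespace GL12

/-! ### Words in the simple transpositions of a symmetric group -/

/-- The left one of the two adjacent positions indexed by `t` (`t`-th and `(t+1)`-st). -/
def lo {N : ℕ} (t : Fin (N - 1)) : Fin N := ⟨t, by omega⟩

/-- The right one of the two adjacent positions indexed by `t`. -/
def hi {N : ℕ} (t : Fin (N - 1)) : Fin N := ⟨t + 1, by omega⟩

/-- The simple transposition `s_t`. -/
def simple {N : ℕ} (t : Fin (N - 1)) : Equiv.Perm (Fin N) := Equiv.swap (lo t) (hi t)

/-- The permutation `s_{t₁} ⋯ s_{t_r}` presented by the word `(t₁, …, t_r)`. -/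
def wordPerm {N : ℕ} (l : List (Fin (N - 1))) : Equiv.Perm (Fin N) := (l.map simple).prod

theorem exists_word {N : ℕ} (w : Equiv.Perm (Fin N)) : ∃ l, wordPerm l = w := by
  obtain _ | N := N
  · exact ⟨[], Subsingleton.elim _ _⟩
  have h : w ∈ Submonoid.closure
      (Set.range fun i : Fin N => Equiv.swap i.castSucc i.succ) := by
    rw [Equiv.Perm.mclosure_swap_castSucc_succ]; trivial
  induction h using Submonoid.closure_induction with
  | mem x hx =>
    obtain ⟨i, rfl⟩ := hx
    refine ⟨[i], ?_⟩
    simp only [wordPerm, List.map_cons, List.map_nil, List.prod_cons, List.prod_nil, mul_one]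
    rfl
  | one => exact ⟨[], rfl⟩
  | mul x y _ _ hx hy =>
    obtain ⟨a, rfl⟩ := hx
    obtain ⟨b, rfl⟩ := hy
    exact ⟨a ++ b, by simp [wordPerm]⟩

/-- The length of a permutation: the least length of a word that presents it. -/
def len {N : ℕ} (w : Equiv.Perm (Fin N)) : ℕ :=
  sInf {r | ∃ l : List (Fin (N - 1)), wordPerm l = w ∧ l.length = r}

/-- `l` is a reduced (minimal length) presentation of `w`. -/
def IsReducedWord {N : ℕ} (l : List (Fin (N - 1))) (w : Equiv.Perm (Fin N)) : Prop :=
  wordPerm l = w ∧ l.length = len w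

theorem exists_reducedWord {N : ℕ} (w : Equiv.Perm (Fin N)) : ∃ l, IsReducedWord l w :=
  Nat.sInf_mem (s := {r | ∃ l : List (Fin (N - 1)), wordPerm l = w ∧ l.length = r})
    (let ⟨l, hl⟩ := exists_word w; ⟨_, l, hl, rfl⟩)

/-! ### The algebra of fermionic strands and the signed elements `σ_w` -/

/-- Defining relations for the generators `σ_1, …, σ_{n-1}`. -/
inductive LOTRel (k : Type*) [Field k] (n : ℕ) :
    FreeAlgebra k (Fin (n - 1)) → FreeAlgebra k (Fin (n - 1)) → Prop
  | sq (a : Fin (n - 1)) : LOTRel k n (FreeAlgebra.ι k a * FreeAlgebra.ι k a) 0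
  | far (a b : Fin (n - 1)) (h : (a : ℕ) + 1 < b ∨ (b : ℕ) + 1 < a) :
      LOTRel k n
        (FreeAlgebra.ι k a * FreeAlgebra.ι k b + FreeAlgebra.ι k b * FreeAlgebra.ι k a) 0
  | braid (a b : Fin (n - 1)) (h : (a : ℕ) + 1 = b) :
      LOTRel k n (FreeAlgebra.ι k a * FreeAlgebra.ι k b * FreeAlgebra.ι k a)
        (FreeAlgebra.ι k b * FreeAlgebra.ι k a * FreeAlgebra.ι k b)

/-- The algebra of `n` fermionic strands (its differential plays no role here). -/
abbrev LOT (k : Type*) [Field k] (n : ℕ) : Type _ := RingQuot (LOTRel k n)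

/-- The generator `σ_a`. -/
def sigmaGen (k : Type*) [Field k] {n : ℕ} (a : Fin (n - 1)) : LOT k n :=
  RingQuot.mkAlgHom k (LOTRel k n) (FreeAlgebra.ι k a)

/-- The pairs of strands, named by their lower endpoints, that cross at the successive terms of
a word. The first term of the word is the top crossing of the diagram. -/
def crossings {n : ℕ} : List (Fin (n - 1)) → List (Fin n × Fin n)
  | [] => []
  | t :: l => ((wordPerm l)⁻¹ (lo t), (wordPerm l)⁻¹ (hi t)) :: crossings l

/-- `(p.1, p.2)` is an inversion of `w`. -/
def IsInversion {n : ℕ} (w : Equiv.Perm (Fin n)) (p : Fin n × Fin n) : Prop :=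
  p.1 < p.2 ∧ w p.2 < w p.1

open Classical in
/-- Pairs of disjoint inversions `((j₁, j₂), (k₁, k₂))` of `w`, ordered by `j₁ < k₁`. -/
def disjointInversions {n : ℕ} (w : Equiv.Perm (Fin n)) :
    Finset ((Fin n × Fin n) × (Fin n × Fin n)) :=
  Finset.univ.filter fun x => IsInversion w x.1 ∧ IsInversion w x.2 ∧ x.1.1 < x.2.1 ∧
    x.1.1 ≠ x.2.2 ∧ x.1.2 ≠ x.2.1 ∧ x.1.2 ≠ x.2.2

/-- The sign of a reduced word: the product over the pairs of disjoint inversions of `1` if the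
`(j₁, j₂)`-crossing appears in the word to the right of the `(k₁, k₂)`-crossing, and of `-1`
if it appears to the left. -/
def wordSign {n : ℕ} (l : List (Fin (n - 1))) : ℤ :=
  ∏ x ∈ disjointInversions (wordPerm l),
    if (crossings l).idxOf x.2 < (crossings l).idxOf x.1 then 1 else -1

/-- The element `σ_w`: the product of the generators along a reduced word of `w`, multiplied by
the sign of that word. -/
def sigma (k : Type*) [Field k] {n : ℕ} (w : Equiv.Perm (Fin n)) : LOT k n :=
  wordSign (exists_reducedWord w).choose •
    ((exists_reducedWord w).choose.map (sigmaGen k)).prod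

open Classical in
/-- The sign `ε_w^a`, for which `σ_{s_a w} = ε_w^a σ_a σ_w` if `s_a w` is longer than `w`. -/
def eps (k : Type*) [Field k] {n : ℕ} (w : Equiv.Perm (Fin n)) (a : Fin (n - 1)) : k :=
  if sigma k (simple a * w) = sigmaGen k a * sigma k w then 1 else -1

/-! ### The algebra `R(n,m)` -/

/-- Sequences of `n` fermionic labels (`false`) and `m` bosonic labels (`true`). -/
abbrev Labels (n m : ℕ) : Type :=
  {c : Fin (n + m) → Bool // (Finset.univ.filter fun p => c p = true).card = m}

variable {n m : ℕ}

theorem card_fermionic (i : Labels n m) :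
    (Finset.univ.filter fun p => i.1 p = false).card = n := by
  have h := Finset.card_filter_add_card_filter_not (s := (Finset.univ : Finset (Fin (n + m))))
    (fun p => i.1 p = true)
  simp only [Bool.not_eq_true, Finset.card_univ, Fintype.card_fin] at h
  have := i.2
  omega

/-- The position of the `k`-th bosonic strand, counting from the left. -/
def bos (i : Labels n m) (k : Fin m) : Fin (n + m) :=
  (Finset.univ.filter fun p => i.1 p = true).orderEmbOfFin i.2 k

/-- The position of the `a`-th fermionic strand, counting from the left. -/
def ferm (i : Labels n m) (a : Fin n) : Fin (n + m) :=
  (Finset.univ.filter fun p => i.1 p = false).orderEmbOfFin (card_fermionic i) a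

/-- The sequence `s_t i`, with the `t`-th and `(t+1)`-st labels exchanged. -/
def Labels.sw (i : Labels n m) (t : Fin (n + m - 1)) : Labels n m :=
  ⟨fun p => i.1 (simple t p), by
    refine Eq.trans (Finset.card_bij (fun p _ => simple t p) ?_ ?_ ?_) i.2
    · intro p hp
      simpa using hp
    · intro p _ q _ h
      exact (simple t).injective h
    · intro q hq
      exact ⟨(simple t).symm q, by simpa using hq, by simp⟩⟩

/-- The generating diagrams of `R(n,m)`. -/
inductive Gen (n m : ℕ) : Type
  /-- the vertical lines diagram `1_i` -/
  | idem (i : Labels n m)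
  /-- vertical lines with one dot, on the `k`-th bosonic strand from the left -/
  | dot (i : Labels n m) (k : Fin m)
  /-- the crossing of the `t`-th and `(t+1)`-st strands, with lower labels `i` -/
  | cross (i : Labels n m) (t : Fin (n + m - 1))

section Relations

variable (k : Type*) [Field k]

/-- `idem` in the free algebra. -/
abbrev fI (i : Labels n m) : FreeAlgebra k (Gen n m) := FreeAlgebra.ι k (Gen.idem i)
/-- `dot` in the free algebra. -/
abbrev fD (i : Labels n m) (a : Fin m) : FreeAlgebra k (Gen n m) := FreeAlgebra.ι k (Gen.dot i a)
/-- `cross` in the free algebra. -/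
abbrev fC (i : Labels n m) (t : Fin (n + m - 1)) : FreeAlgebra k (Gen n m) :=
  FreeAlgebra.ι k (Gen.cross i t)

/-- The defining relations. A product `x * y` is the diagram `x` placed on top of `y`. -/
inductive Rel (n m : ℕ) : FreeAlgebra k (Gen n m) → FreeAlgebra k (Gen n m) → Prop
  -- concatenation: diagrams with different labels at the common ends multiply to zero
  | idem_mul_self (i : Labels n m) : Rel n m (fI k i * fI k i) (fI k i)
  | idem_mul_ne (i j : Labels n m) (h : i ≠ j) : Rel n m (fI k i * fI k j) 0
  | sum_idem : Rel n m (∑ i : Labels n m, fI k i) 1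
  | idem_dot (i : Labels n m) (a : Fin m) : Rel n m (fI k i * fD k i a) (fD k i a)
  | dot_idem (i : Labels n m) (a : Fin m) : Rel n m (fD k i a * fI k i) (fD k i a)
  | idem_cross (i : Labels n m) (t : Fin (n + m - 1)) :
      Rel n m (fI k (i.sw t) * fC k i t) (fC k i t)
  | cross_idem (i : Labels n m) (t : Fin (n + m - 1)) : Rel n m (fC k i t * fI k i) (fC k i t)
  -- far away crossings anticommute if both are fermionic, and commute otherwise
  | far_odd (i : Labels n m) (t u : Fin (n + m - 1)) (h : (t : ℕ) + 1 < u)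
      (ht : i.1 (lo t) = false ∧ i.1 (hi t) = false)
      (hu : i.1 (lo u) = false ∧ i.1 (hi u) = false) :
      Rel n m (fC k (i.sw t) u * fC k i t) (-(fC k (i.sw u) t * fC k i u))
  | far_even (i : Labels n m) (t u : Fin (n + m - 1)) (h : (t : ℕ) + 1 < u)
      (hb : ¬ ((i.1 (lo t) = false ∧ i.1 (hi t) = false) ∧
        (i.1 (lo u) = false ∧ i.1 (hi u) = false))) :
      Rel n m (fC k (i.sw t) u * fC k i t) (fC k (i.sw u) t * fC k i u)
  -- a dot commutes with far away crossings, and two dots commute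
  | dot_far (i : Labels n m) (t : Fin (n + m - 1)) (a : Fin m)
      (h₁ : bos i a ≠ lo t) (h₂ : bos i a ≠ hi t) :
      Rel n m (fD k (i.sw t) a * fC k i t) (fC k i t * fD k i a)
  | dot_dot (i : Labels n m) (a b : Fin m) :
      Rel n m (fD k i a * fD k i b) (fD k i b * fD k i a)
  -- a dot moves freely through a crossing of a bosonic and a fermionic strand
  -- (such a crossing does not change the order of the bosonic strands)
  | dot_mixed (i : Labels n m) (t : Fin (n + m - 1)) (a : Fin m)
      (hm : i.1 (lo t) ≠ i.1 (hi t)) (ha : bos i a = lo t ∨ bos i a = hi t) :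
      Rel n m (fD k (i.sw t) a * fC k i t) (fC k i t * fD k i a)
  -- a dot moves through a crossing of two bosonic strands as in the nilHecke algebra
  | nil_top (i : Labels n m) (t : Fin (n + m - 1)) (a b : Fin m)
      (ha : bos i a = lo t) (hb : bos i b = hi t) :
      Rel n m (fD k i a * fC k i t - fC k i t * fD k i b) (fI k i)
  | nil_bot (i : Labels n m) (t : Fin (n + m - 1)) (a b : Fin m)
      (ha : bos i a = lo t) (hb : bos i b = hi t) :
      Rel n m (fC k i t * fD k i a - fD k i b * fC k i t) (fI k i)
  -- double crossings
  | double_same (i : Labels n m) (t : Fin (n + m - 1)) (h : i.1 (lo t) = i.1 (hi t)) :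
      Rel n m (fC k (i.sw t) t * fC k i t) 0
  | double_mixed (i : Labels n m) (t : Fin (n + m - 1)) (a : Fin m)
      (hm : i.1 (lo t) ≠ i.1 (hi t)) (ha : bos i a = lo t ∨ bos i a = hi t) :
      Rel n m (fC k (i.sw t) t * fC k i t) (fD k i a)
  -- triple intersections, with an additional term for labels even, odd, even
  | triple (i : Labels n m) (t u : Fin (n + m - 1)) (h : (t : ℕ) + 1 = u)
      (hb : ¬ (i.1 (lo t) = true ∧ i.1 (hi t) = false ∧ i.1 (hi u) = true)) :
      Rel n m (fC k ((i.sw t).sw u) t * fC k (i.sw t) u * fC k i t)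
        (fC k ((i.sw u).sw t) u * fC k (i.sw u) t * fC k i u)
  | triple_even_odd_even (i : Labels n m) (t u : Fin (n + m - 1)) (h : (t : ℕ) + 1 = u)
      (hb : i.1 (lo t) = true ∧ i.1 (hi t) = false ∧ i.1 (hi u) = true) :
      Rel n m (fC k ((i.sw t).sw u) t * fC k (i.sw t) u * fC k i t)
        (fC k ((i.sw u).sw t) u * fC k (i.sw u) t * fC k i u + fI k i)

end Relations

/-- The algebra `R(n,m)`. -/
abbrev RAlg (k : Type*) [Field k] (n m : ℕ) : Type _ := RingQuot (Rel k n m)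

section Elements

variable (k : Type*) [Field k]

/-- The idempotent `1_i`. -/
def idem (i : Labels n m) : RAlg k n m := RingQuot.mkAlgHom k (Rel k n m) (fI k i)

/-- The dot on the `a`-th bosonic strand of `1_i`. -/
def dot (i : Labels n m) (a : Fin m) : RAlg k n m := RingQuot.mkAlgHom k (Rel k n m) (fD k i a)

/-- The crossing of the `t`-th and `(t+1)`-st strands, with lower labels `i`. -/
def cross (i : Labels n m) (t : Fin (n + m - 1)) : RAlg k n m :=
  RingQuot.mkAlgHom k (Rel k n m) (fC k i t)

/-- The labels at the top of the diagram of a word with lower labels `i`. -/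
def topLabels (i : Labels n m) : List (Fin (n + m - 1)) → Labels n m
  | [] => i
  | t :: l => (topLabels i l).sw t

/-- The (undotted) diagram of a word with lower labels `i`. -/
def wordDiagram (i : Labels n m) : List (Fin (n + m - 1)) → RAlg k n m
  | [] => idem k i
  | t :: l => cross k (topLabels i l) t * wordDiagram i l

/-- The diagram of a word with lower labels `i` and with `e a` dots at the top of the bosonic
strand whose upper endpoint is the `a`-th bosonic one from the left. -/
def dottedDiagram (i : Labels n m) (l : List (Fin (n + m - 1))) (e : Fin m → ℕ) : RAlg k n m :=
  (List.ofFn fun a => dot k (topLabels i l) a ^ e a).prod * wordDiagram k i l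

/-! ### Symmetric polynomials in dots -/

theorem dot_mul_dot_comm (i j : Labels n m) (a b : Fin m) :
    dot k i a * dot k j b = dot k j b * dot k i a := by
  have key : ∀ (i j : Labels n m) (a b : Fin m), i ≠ j → dot k i a * dot k j b = 0 := by
    intro i j a b h
    have h1 : dot k i a = dot k i a * idem k i := by
      simpa [dot, idem] using (RingQuot.mkAlgHom_rel k (Rel.dot_idem (k := k) i a)).symm
    have h2 : dot k j b = idem k j * dot k j b := by
      simpa [dot, idem] using (RingQuot.mkAlgHom_rel k (Rel.idem_dot (k := k) j b)).symm
    have h3 : idem k i * idem k j = 0 := by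
      simpa [idem] using RingQuot.mkAlgHom_rel k (Rel.idem_mul_ne (k := k) i j h)
    rw [h1, h2, mul_assoc, ← mul_assoc (idem k i), h3, zero_mul, mul_zero]
  by_cases h : i = j
  · subst h
    simpa [dot] using RingQuot.mkAlgHom_rel k (Rel.dot_dot (k := k) i a b)
  · rw [key i j a b h, key j i b a (Ne.symm h)]

/-- The dot on the `a`-th bosonic strand, summed over all sequences of labels. -/
def dotSum (n : ℕ) {m : ℕ} (a : Fin m) : RAlg k n m := ∑ i : Labels n m, dot k i a

theorem dotSum_comm (n m : ℕ) : ∀ x ∈ Set.range (dotSum k n (m := m)),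
    ∀ y ∈ Set.range (dotSum k n (m := m)), x * y = y * x := by
  rintro _ ⟨a, rfl⟩ _ ⟨b, rfl⟩
  simp only [dotSum, Finset.sum_mul_sum]
  rw [Finset.sum_comm]
  exact Finset.sum_congr rfl fun i _ => Finset.sum_congr rfl fun j _ =>
    dot_mul_dot_comm k j i a b

/-- Polynomials in dots: the algebra homomorphism `k[x_1, …, x_m] → R(n,m)` that sends `x_a` to
the dot on the `a`-th bosonic strand. -/
def polyDots (n m : ℕ) : MvPolynomial (Fin m) k →ₐ[k] RAlg k n m :=
  haveI := Algebra.isMulCommutative_adjoin k (dotSum_comm k n m)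
  letI : CommRing (Algebra.adjoin k (Set.range (dotSum k n (m := m)))) :=
    { (inferInstance : Ring (Algebra.adjoin k (Set.range (dotSum k n (m := m))))) with
      mul_comm := fun x y => IsMulCommutative.is_comm.comm x y }
  (Algebra.adjoin k (Set.range (dotSum k n (m := m)))).val.comp
    (aeval fun a => ⟨dotSum k n a, Algebra.subset_adjoin ⟨a, rfl⟩⟩)

theorem polyDots_X (n : ℕ) {m : ℕ} (a : Fin m) : polyDots k n m (X a) = dotSum k n a := by
  simp [polyDots]

/-- `Sym(n,m)`, the symmetric polynomials in dots on the bosonic strands. -/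
def symDots (n m : ℕ) : Subalgebra k (RAlg k n m) := (symmetricSubalgebra (Fin m) k).map (polyDots k n m)

/-! ### The representation `Pol` -/

theorem sub_dvd_sub_swap {m : ℕ} (a b : Fin m) (f : MvPolynomial (Fin m) k) :
    (X a - X b : MvPolynomial (Fin m) k) ∣ f - rename (Equiv.swap a b) f := by
  induction f using MvPolynomial.induction_on with
  | C c => simp
  | add p q hp hq =>
    have : p + q - rename (Equiv.swap a b) (p + q) =
        (p - rename (Equiv.swap a b) p) + (q - rename (Equiv.swap a b) q) := by
      rw [map_add]; ring
    rw [this]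
    exact dvd_add hp hq
  | mul_X p c hp =>
    have : p * X c - rename (Equiv.swap a b) (p * X c) =
        (p - rename (Equiv.swap a b) p) * X c +
          rename (Equiv.swap a b) p * (X c - X (Equiv.swap a b c)) := by
      rw [map_mul, rename_X]; ring
    rw [this]
    refine dvd_add (dvd_mul_of_dvd_left hp _) (dvd_mul_of_dvd_right ?_ _)
    by_cases hca : c = a
    · subst hca; rw [Equiv.swap_apply_left]
    · by_cases hcb : c = b
      · subst hcb; rw [Equiv.swap_apply_right, ← neg_sub (X a) (X c)]
        exact (dvd_refl _).neg_right
      · rw [Equiv.swap_apply_of_ne_of_ne hca hcb, sub_self]; exact dvd_zero _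

/-- The divided difference `(f - s f) / (x_a - x_b)`, where `s` exchanges `x_a` and `x_b`
(used only for `a ≠ b`). -/
def divDiff {m : ℕ} (a b : Fin m) (f : MvPolynomial (Fin m) k) : MvPolynomial (Fin m) k :=
  (sub_dvd_sub_swap k a b f).choose

theorem divDiff_spec {m : ℕ} (a b : Fin m) (f : MvPolynomial (Fin m) k) :
    f - rename (Equiv.swap a b) f = (X a - X b) * divDiff k a b f :=
  (sub_dvd_sub_swap k a b f).choose_spec

/-- `Pol`: the direct sum over pairs `(i, w)` of polynomial algebras in `m` variables. The
element `f` of the summand `Pol(i,w)` is `Finsupp.single (i, w) f`. -/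
abbrev Pol (n m : ℕ) : Type _ := (Labels n m × Equiv.Perm (Fin n)) →₀ MvPolynomial (Fin m) k

variable {k}

/-- The linear representation `ρ` of `R(n,m)` on `Pol` is given by the stated rules on the
generators. -/
structure IsPolAction (ρ : RAlg k n m →ₐ[k] Module.End k (Pol k n m)) : Prop where
  idem_self : ∀ (i : Labels n m) (w : Equiv.Perm (Fin n)) (f : MvPolynomial (Fin m) k),
    ρ (idem k i) (Finsupp.single (i, w) f) = Finsupp.single (i, w) f
  idem_ne : ∀ (i j : Labels n m) (w : Equiv.Perm (Fin n)) (f : MvPolynomial (Fin m) k), j ≠ i →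
    ρ (idem k i) (Finsupp.single (j, w) f) = 0
  dot_self : ∀ (i : Labels n m) (a : Fin m) (w : Equiv.Perm (Fin n))
    (f : MvPolynomial (Fin m) k),
    ρ (dot k i a) (Finsupp.single (i, w) f) = Finsupp.single (i, w) (X a * f)
  dot_ne : ∀ (i j : Labels n m) (a : Fin m) (w : Equiv.Perm (Fin n))
    (f : MvPolynomial (Fin m) k), j ≠ i → ρ (dot k i a) (Finsupp.single (j, w) f) = 0
  cross_ne : ∀ (i j : Labels n m) (t : Fin (n + m - 1)) (w : Equiv.Perm (Fin n))
    (f : MvPolynomial (Fin m) k), j ≠ i → ρ (cross k i t) (Finsupp.single (j, w) f) = 0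
  /-- two bosonic strands -/
  cross_bos_bos : ∀ (i : Labels n m) (t : Fin (n + m - 1)) (a b : Fin m)
    (w : Equiv.Perm (Fin n)) (f : MvPolynomial (Fin m) k), bos i a = lo t → bos i b = hi t →
    ρ (cross k i t) (Finsupp.single (i, w) f) = Finsupp.single (i, w) (divDiff k a b f)
  /-- lower labels `…12…`, upper labels `…21…` -/
  cross_ferm_bos : ∀ (i : Labels n m) (t : Fin (n + m - 1)) (w : Equiv.Perm (Fin n))
    (f : MvPolynomial (Fin m) k), i.1 (lo t) = false → i.1 (hi t) = true →
    ρ (cross k i t) (Finsupp.single (i, w) f) = Finsupp.single (i.sw t, w) f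
  /-- lower labels `…21…`, upper labels `…12…`, where the `2` is the `a`-th one -/
  cross_bos_ferm : ∀ (i : Labels n m) (t : Fin (n + m - 1)) (a : Fin m)
    (w : Equiv.Perm (Fin n)) (f : MvPolynomial (Fin m) k), bos i a = lo t →
    i.1 (hi t) = false →
    ρ (cross k i t) (Finsupp.single (i, w) f) = Finsupp.single (i.sw t, w) (X a * f)
  /-- the `a`-th and `(a+1)`-st fermionic strands -/
  cross_ferm_ferm_up : ∀ (i : Labels n m) (t : Fin (n + m - 1)) (a : Fin (n - 1))
    (w : Equiv.Perm (Fin n)) (f : MvPolynomial (Fin m) k),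
    ferm i (lo a) = lo t → ferm i (hi a) = hi t → len (simple a * w) = len w + 1 →
    ρ (cross k i t) (Finsupp.single (i, w) f) = Finsupp.single (i, simple a * w) (eps k w a • f)
  cross_ferm_ferm_down : ∀ (i : Labels n m) (t : Fin (n + m - 1)) (a : Fin (n - 1))
    (w : Equiv.Perm (Fin n)) (f : MvPolynomial (Fin m) k),
    ferm i (lo a) = lo t → ferm i (hi a) = hi t → len (simple a * w) + 1 = len w →
    ρ (cross k i t) (Finsupp.single (i, w) f) = 0

end Elements

end GL12

end

open GL12

/-!
Two reduced words of a permutation are connected by braid moves and commutations of distant letters,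
and the signed product of the `σ_a` does not change under either, so `σ_w` is well defined.

Modulo diagrams with fewer crossings, the relations of `R(n,m)` move all dots to the top, make the
diagram of a reduced word depend only on its permutation, and kill the diagram of a word that is not
reduced. Hence the diagrams of fixed reduced words span `R(n,m)` over the polynomials in dots.

For their independence, expand the operators on `Pol(i, 1)` in permutations of the variables, with
rational functions as coefficients. The diagram of `w` permutes the fermionic strands by `u`, the
bosonic ones by `v`, and takes `Pol(i, 1)` to a summand that determines the upper labels and `u`;
the longest permutation in its expansion is `v`. By independence of characters a vanishing
combination over the polynomials therefore has vanishing coefficients. The same argument, applied to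
an element that acts by zero, gives the faithfulness of the action.

A dotted polynomial commutes with a crossing up to a divided difference, which vanishes on symmetric
polynomials. Polynomials are free of rank `m!` over the symmetric ones: the staircase monomials span
because `X j` is a root of a monic polynomial of degree `j + 1` over the algebra generated by the
symmetric polynomials and the later variables, and `m!` elements that span are independent, again by
independence of characters.
-/

noncomputable section

namespace GL12

/-! ### Inversions, length and reduced words -/

section Inversions

variable {N : ℕ}

theorem lo_lt_hi (t : Fin (N - 1)) : lo t < hi t := by
  simp [lo, hi, Fin.lt_def]

theorem lo_ne_hi (t : Fin (N - 1)) : lo t ≠ hi t := (lo_lt_hi t).ne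

theorem hi_eq_lo {a b : Fin (N - 1)} (h : (a : ℕ) + 1 = b) : hi a = lo b := Fin.ext h

theorem simple_apply_lo (t : Fin (N - 1)) : simple t (lo t) = hi t := Equiv.swap_apply_left _ _

theorem simple_apply_hi (t : Fin (N - 1)) : simple t (hi t) = lo t := Equiv.swap_apply_right _ _

theorem simple_apply_of_ne {t : Fin (N - 1)} {p : Fin N} (h₁ : p ≠ lo t) (h₂ : p ≠ hi t) :
    simple t p = p := Equiv.swap_apply_of_ne_of_ne h₁ h₂

theorem simple_apply_simple (t : Fin (N - 1)) (p : Fin N) : simple t (simple t p) = p :=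
  Equiv.swap_apply_self _ _ _

theorem simple_mul_simple_mul (t : Fin (N - 1)) (w : Equiv.Perm (Fin N)) :
    simple t * (simple t * w) = w :=
  Equiv.swap_mul_self_mul _ _ _

theorem simple_mul_inv_apply (t : Fin (N - 1)) (w : Equiv.Perm (Fin N)) (p : Fin N) :
    (simple t * w)⁻¹ p = w⁻¹ (simple t p) := by
  rw [mul_inv_rev, simple, Equiv.swap_inv, Equiv.Perm.mul_apply]

theorem val_simple_apply (t : Fin (N - 1)) (p : Fin N) :
    (simple t p : ℕ) = if (p : ℕ) = t then (t : ℕ) + 1 else if (p : ℕ) = t + 1 then t else p := by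
  simp only [simple, Equiv.swap_apply_def, Fin.ext_iff, lo, hi]
  split_ifs <;> rfl

theorem simple_apply_hi_of_adj {a b : Fin (N - 1)} (h : (a : ℕ) + 1 = b) :
    simple a (hi b) = hi b := by
  apply simple_apply_of_ne <;> simp only [lo, hi, ne_eq, Fin.ext_iff] <;> omega

theorem simple_apply_lo_of_adj {a b : Fin (N - 1)} (h : (a : ℕ) + 1 = b) :
    simple b (lo a) = lo a := by
  apply simple_apply_of_ne <;> simp only [lo, hi, ne_eq, Fin.ext_iff] <;> omega

theorem simple_mul_comm {a b : Fin (N - 1)} (h : (a : ℕ) + 1 < b) (w : Equiv.Perm (Fin N)) :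
    simple a * (simple b * w) = simple b * (simple a * w) := by
  ext p
  simp only [Equiv.Perm.mul_apply, val_simple_apply]
  grind

theorem simple_mul_braid {a b : Fin (N - 1)} (h : (a : ℕ) + 1 = b) (w : Equiv.Perm (Fin N)) :
    simple a * (simple b * (simple a * w)) = simple b * (simple a * (simple b * w)) := by
  ext p
  simp only [Equiv.Perm.mul_apply, val_simple_apply]
  grind

theorem simple_apply_lt_simple_apply_iff (a : Fin (N - 1)) (p q : Fin N) :
    simple a q < simple a p ↔ (p = lo a ∧ q = hi a) ∨ (q < p ∧ ¬ (q = lo a ∧ p = hi a)) := by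
  simp only [Fin.lt_def, Fin.ext_iff, val_simple_apply, lo, hi]
  grind

open Classical in
/-- The set of inversions of a permutation. -/
def inversions (w : Equiv.Perm (Fin N)) : Finset (Fin N × Fin N) :=
  Finset.univ.filter (IsInversion w)

@[simp]
theorem mem_inversions {w : Equiv.Perm (Fin N)} {p : Fin N × Fin N} :
    p ∈ inversions w ↔ p.1 < p.2 ∧ w p.2 < w p.1 := by
  simp [inversions, IsInversion]

theorem inversions_one : inversions (1 : Equiv.Perm (Fin N)) = ∅ :=
  Finset.eq_empty_of_forall_notMem fun _ hp => (mem_inversions.1 hp).1.asymm (mem_inversions.1 hp).2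

/-- The strands, named by their lower endpoints, that the crossing `s_a` exchanges when it is
placed on top of a diagram of `w`. -/
def topCrossing (a : Fin (N - 1)) (w : Equiv.Perm (Fin N)) : Fin N × Fin N :=
  (w⁻¹ (lo a), w⁻¹ (hi a))

/-- `a` is a left ascent of `w`: the crossing `s_a` on top of `w` creates an inversion. -/
def IsAscent (a : Fin (N - 1)) (w : Equiv.Perm (Fin N)) : Prop :=
  (topCrossing a w).1 < (topCrossing a w).2

theorem isAscent_simple_mul {a : Fin (N - 1)} {w : Equiv.Perm (Fin N)} :
    IsAscent a (simple a * w) ↔ ¬ IsAscent a w := by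
  simp only [IsAscent, topCrossing, simple_mul_inv_apply, simple_apply_lo, simple_apply_hi, not_lt]
  exact (w⁻¹.injective.ne (lo_ne_hi a)).symm.le_iff_lt.symm

theorem topCrossing_notMem_inversions (a : Fin (N - 1)) (w : Equiv.Perm (Fin N)) :
    topCrossing a w ∉ inversions w := by
  simpa [topCrossing] using fun _ => (lo_lt_hi a).le

theorem inversions_simple_mul {a : Fin (N - 1)} {w : Equiv.Perm (Fin N)} (h : IsAscent a w) :
    inversions (simple a * w) = insert (topCrossing a w) (inversions w) := by
  ext ⟨p, q⟩
  have hp (c : Fin N) : w p = c ↔ p = w⁻¹ c := Equiv.Perm.eq_inv_iff_eq.symm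
  have hq (c : Fin N) : w q = c ↔ q = w⁻¹ c := Equiv.Perm.eq_inv_iff_eq.symm
  simp only [mem_inversions, Finset.mem_insert, Equiv.Perm.mul_apply,
    simple_apply_lt_simple_apply_iff, hp, hq]
  simp only [IsAscent, topCrossing, Prod.mk.injEq] at h ⊢
  constructor
  · rintro ⟨hpq, hc | hc⟩
    exacts [.inl hc, .inr ⟨hpq, hc.1⟩]
  · rintro (⟨rfl, rfl⟩ | ⟨hpq, hinv⟩)
    · exact ⟨h, .inl ⟨rfl, rfl⟩⟩
    · exact ⟨hpq, .inr ⟨hinv, fun ⟨hq, hp⟩ => h.asymm (hp ▸ hq ▸ hpq)⟩⟩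

theorem card_inversions_simple_mul {a : Fin (N - 1)} {w : Equiv.Perm (Fin N)}
    (h : IsAscent a w) : (inversions (simple a * w)).card = (inversions w).card + 1 := by
  rw [inversions_simple_mul h, Finset.card_insert_of_notMem (topCrossing_notMem_inversions a w)]

theorem card_inversions_simple_mul_of_not {a : Fin (N - 1)} {w : Equiv.Perm (Fin N)}
    (h : ¬ IsAscent a w) : (inversions (simple a * w)).card + 1 = (inversions w).card := by
  rw [← card_inversions_simple_mul (isAscent_simple_mul.2 h), simple_mul_simple_mul]

theorem wordPerm_nil : wordPerm ([] : List (Fin (N - 1))) = 1 := rfl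

theorem wordPerm_cons (a : Fin (N - 1)) (l : List (Fin (N - 1))) :
    wordPerm (a :: l) = simple a * wordPerm l := by simp [wordPerm]

theorem card_inversions_wordPerm_le (l : List (Fin (N - 1))) :
    (inversions (wordPerm l)).card ≤ l.length := by
  induction l with
  | nil => simp [wordPerm_nil, inversions_one]
  | cons a l ih =>
    rw [wordPerm_cons, List.length_cons]
    by_cases h : IsAscent a (wordPerm l)
    · have := card_inversions_simple_mul h
      omega
    · have := card_inversions_simple_mul_of_not h
      omega

theorem eq_one_of_forall_isAscent {w : Equiv.Perm (Fin N)} (h : ∀ a, IsAscent a w) : w = 1 := by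
  obtain _ | N := N
  · exact Subsingleton.elim _ _
  have hm : StrictMono (w⁻¹ : Equiv.Perm (Fin (N + 1))) :=
    Fin.strictMono_iff_lt_succ.2 fun i => h i
  have hid : StrictMono.orderIsoOfSurjective _ hm w⁻¹.surjective = OrderIso.refl _ :=
    Subsingleton.elim _ _
  exact inv_eq_one.1 (Equiv.ext fun p => DFunLike.congr_fun hid p)

theorem exists_word_length_eq_card_inversions (w : Equiv.Perm (Fin N)) :
    ∃ l, wordPerm l = w ∧ l.length = (inversions w).card := by
  induction hc : (inversions w).card using Nat.strong_induction_on generalizing w with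
  | _ c ih =>
    subst hc
    by_cases h : ∀ a, IsAscent a w
    · rw [eq_one_of_forall_isAscent h, inversions_one]
      exact ⟨[], rfl, rfl⟩
    · push Not at h
      obtain ⟨a, ha⟩ := h
      have hd := card_inversions_simple_mul_of_not ha
      obtain ⟨l, hl, hlen⟩ := ih _ (by omega) (simple a * w) rfl
      exact ⟨a :: l, by rw [wordPerm_cons, hl, simple_mul_simple_mul],
        by rw [List.length_cons, hlen, hd]⟩

theorem len_eq_card_inversions (w : Equiv.Perm (Fin N)) : len w = (inversions w).card := by
  apply le_antisymm
  · exact Nat.sInf_le (exists_word_length_eq_card_inversions w)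
  · obtain ⟨l, hl, hlen⟩ := exists_reducedWord w
    rw [← hlen, ← hl]
    exact card_inversions_wordPerm_le l

theorem len_simple_mul {a : Fin (N - 1)} {w : Equiv.Perm (Fin N)} (h : IsAscent a w) :
    len (simple a * w) = len w + 1 := by
  rw [len_eq_card_inversions, len_eq_card_inversions, card_inversions_simple_mul h]

theorem len_simple_mul_of_not {a : Fin (N - 1)} {w : Equiv.Perm (Fin N)} (h : ¬ IsAscent a w) :
    len (simple a * w) + 1 = len w := by
  rw [len_eq_card_inversions, len_eq_card_inversions, card_inversions_simple_mul_of_not h]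

theorem isAscent_iff_len {a : Fin (N - 1)} {w : Equiv.Perm (Fin N)} :
    IsAscent a w ↔ len (simple a * w) = len w + 1 := by
  refine ⟨len_simple_mul, fun h => ?_⟩
  by_contra hd
  have := len_simple_mul_of_not hd
  omega

theorem len_wordPerm_le (l : List (Fin (N - 1))) : len (wordPerm l) ≤ l.length :=
  Nat.sInf_le ⟨l, rfl, rfl⟩

theorem isReducedWord_nil : IsReducedWord ([] : List (Fin (N - 1))) 1 :=
  ⟨rfl, (Nat.le_zero.1 (len_wordPerm_le [])).symm⟩

theorem isReducedWord_cons {a : Fin (N - 1)} {l : List (Fin (N - 1))} {w : Equiv.Perm (Fin N)} :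
    IsReducedWord (a :: l) w ↔ ¬ IsAscent a w ∧ IsReducedWord l (simple a * w) := by
  have hperm : wordPerm (a :: l) = w ↔ wordPerm l = simple a * w := by
    rw [wordPerm_cons]
    exact ⟨fun h => by rw [← h, simple_mul_simple_mul],
      fun h => by rw [h, simple_mul_simple_mul]⟩
  rw [IsReducedWord, IsReducedWord, hperm, List.length_cons]
  constructor
  · rintro ⟨hl, hlen⟩
    have hle := hl ▸ len_wordPerm_le l
    have hdesc : ¬ IsAscent a w := fun hasc => by
      have := len_simple_mul hasc
      omega
    have := len_simple_mul_of_not hdesc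
    exact ⟨hdesc, hl, by omega⟩
  · rintro ⟨hdesc, hl, hlen⟩
    exact ⟨hl, by rw [hlen, len_simple_mul_of_not hdesc]⟩

theorem isReducedWord_cons_wordPerm {a : Fin (N - 1)} {l : List (Fin (N - 1))} :
    IsReducedWord (a :: l) (wordPerm (a :: l)) ↔
      IsAscent a (wordPerm l) ∧ IsReducedWord l (wordPerm l) := by
  rw [isReducedWord_cons, wordPerm_cons, isAscent_simple_mul, not_not, simple_mul_simple_mul]

theorem topCrossing_simple_mul_of_far {a b : Fin (N - 1)}
    (h : (a : ℕ) + 1 < b ∨ (b : ℕ) + 1 < a) (w : Equiv.Perm (Fin N)) :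
    topCrossing a (simple b * w) = topCrossing a w := by
  simp only [topCrossing, simple_mul_inv_apply]
  rw [simple_apply_of_ne, simple_apply_of_ne] <;>
    simp only [lo, hi, ne_eq, Fin.ext_iff] <;> omega

theorem isAscent_simple_mul_of_far {a b : Fin (N - 1)}
    (h : (a : ℕ) + 1 < b ∨ (b : ℕ) + 1 < a) (w : Equiv.Perm (Fin N)) :
    IsAscent a (simple b * w) ↔ IsAscent a w := by
  rw [IsAscent, topCrossing_simple_mul_of_far h, IsAscent]

theorem topCrossing_right_simple_left_mul {a b : Fin (N - 1)} (h : (a : ℕ) + 1 = b)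
    (w : Equiv.Perm (Fin N)) : topCrossing b (simple a * w) = (w⁻¹ (lo a), w⁻¹ (hi b)) := by
  simp only [topCrossing, simple_mul_inv_apply, ← hi_eq_lo h, simple_apply_hi,
    simple_apply_hi_of_adj h]

theorem topCrossing_left_simple_right_mul {a b : Fin (N - 1)} (h : (a : ℕ) + 1 = b)
    (w : Equiv.Perm (Fin N)) : topCrossing a (simple b * w) = (w⁻¹ (lo a), w⁻¹ (hi b)) := by
  simp only [topCrossing, simple_mul_inv_apply, hi_eq_lo h, simple_apply_lo,
    simple_apply_lo_of_adj h]

theorem topCrossing_left_simple_right_simple_left_mul {a b : Fin (N - 1)} (h : (a : ℕ) + 1 = b)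
    (w : Equiv.Perm (Fin N)) :
    topCrossing a (simple b * (simple a * w)) = topCrossing b w := by
  rw [topCrossing_left_simple_right_mul h, simple_mul_inv_apply, simple_mul_inv_apply,
    simple_apply_lo, simple_apply_hi_of_adj h, hi_eq_lo h, topCrossing]

theorem topCrossing_right_simple_left_simple_right_mul {a b : Fin (N - 1)}
    (h : (a : ℕ) + 1 = b) (w : Equiv.Perm (Fin N)) :
    topCrossing b (simple a * (simple b * w)) = topCrossing a w := by
  rw [topCrossing_right_simple_left_mul h, simple_mul_inv_apply, simple_mul_inv_apply,
    simple_apply_hi, simple_apply_lo_of_adj h, ← hi_eq_lo h, topCrossing]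

/-- The equivalence relation on words generated by the commutation and braid moves. The moves act
at the beginning of a word, and `cons` carries them to every other place. -/
inductive BraidEquiv : List (Fin (N - 1)) → List (Fin (N - 1)) → Prop
  | refl (l : List (Fin (N - 1))) : BraidEquiv l l
  | symm {l l' : List (Fin (N - 1))} : BraidEquiv l l' → BraidEquiv l' l
  | trans {l l' l'' : List (Fin (N - 1))} : BraidEquiv l l' → BraidEquiv l' l'' → BraidEquiv l l''
  | cons (a : Fin (N - 1)) {l l' : List (Fin (N - 1))} :
      BraidEquiv l l' → BraidEquiv (a :: l) (a :: l')
  | comm {a b : Fin (N - 1)} (h : (a : ℕ) + 1 < b) (l : List (Fin (N - 1))) :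
      BraidEquiv (a :: b :: l) (b :: a :: l)
  | braid {a b : Fin (N - 1)} (h : (a : ℕ) + 1 = b) (l : List (Fin (N - 1))) :
      BraidEquiv (a :: b :: a :: l) (b :: a :: b :: l)

theorem BraidEquiv.length_eq {l l' : List (Fin (N - 1))} (h : BraidEquiv l l') :
    l.length = l'.length := by
  induction h <;> simp_all

theorem BraidEquiv.wordPerm_eq {l l' : List (Fin (N - 1))} (h : BraidEquiv l l') :
    wordPerm l = wordPerm l' := by
  induction h with
  | refl => rfl
  | symm _ ih => exact ih.symm
  | trans _ _ ih ih' => exact ih.trans ih'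
  | cons a _ ih => rw [wordPerm_cons, wordPerm_cons, ih]
  | comm h l => simp only [wordPerm_cons, simple_mul_comm h]
  | braid h l => simp only [wordPerm_cons, simple_mul_braid h]

theorem BraidEquiv.isReducedWord_iff {l l' : List (Fin (N - 1))} (h : BraidEquiv l l')
    {w : Equiv.Perm (Fin N)} : IsReducedWord l w ↔ IsReducedWord l' w := by
  rw [IsReducedWord, IsReducedWord, h.wordPerm_eq, h.length_eq]

theorem exists_braidEquiv_cons_of_far {a b : Fin (N - 1)} (hab : (a : ℕ) + 1 < b)
    {w : Equiv.Perm (Fin N)} (ha : ¬ IsAscent a w) (hb : ¬ IsAscent b w) :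
    ∃ u u', IsReducedWord (a :: u) w ∧ IsReducedWord (b :: u') w ∧
      BraidEquiv (a :: u) (b :: u') := by
  obtain ⟨u, hu⟩ := exists_reducedWord (simple b * (simple a * w))
  have hb' : ¬ IsAscent b (simple a * w) := by rwa [isAscent_simple_mul_of_far (.inr hab)]
  have hred : IsReducedWord (a :: b :: u) w := by
    simp only [isReducedWord_cons]
    exact ⟨ha, hb', hu⟩
  have hequiv := BraidEquiv.comm hab u
  exact ⟨b :: u, a :: u, hred, hequiv.isReducedWord_iff.1 hred, hequiv⟩

theorem exists_braidEquiv_cons_of_adj {a b : Fin (N - 1)} (hab : (a : ℕ) + 1 = b)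
    {w : Equiv.Perm (Fin N)} (ha : ¬ IsAscent a w) (hb : ¬ IsAscent b w) :
    ∃ u u', IsReducedWord (a :: u) w ∧ IsReducedWord (b :: u') w ∧
      BraidEquiv (a :: u) (b :: u') := by
  obtain ⟨u, hu⟩ := exists_reducedWord (simple a * (simple b * (simple a * w)))
  have hb' : ¬ IsAscent b (simple a * w) := by
    rw [IsAscent, topCrossing_right_simple_left_mul hab, not_lt]
    simp only [IsAscent, topCrossing, not_lt, ← hi_eq_lo hab] at ha hb
    exact hb.trans ha
  have ha' : ¬ IsAscent a (simple b * (simple a * w)) := by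
    rwa [IsAscent, topCrossing_left_simple_right_simple_left_mul hab]
  have hred : IsReducedWord (a :: b :: a :: u) w := by
    simp only [isReducedWord_cons]
    exact ⟨ha, hb', ha', hu⟩
  have hequiv := BraidEquiv.braid hab u
  exact ⟨b :: a :: u, a :: b :: u, hred, hequiv.isReducedWord_iff.1 hred, hequiv⟩

theorem exists_braidEquiv_cons {a b : Fin (N - 1)} {w : Equiv.Perm (Fin N)}
    (ha : ¬ IsAscent a w) (hb : ¬ IsAscent b w) :
    ∃ u u', IsReducedWord (a :: u) w ∧ IsReducedWord (b :: u') w ∧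
      BraidEquiv (a :: u) (b :: u') := by
  wlog hab : (a : ℕ) ≤ b generalizing a b
  · obtain ⟨u, u', hu, hu', h⟩ := this hb ha (by omega)
    exact ⟨u', u, hu', hu, h.symm⟩
  rcases lt_trichotomy ((a : ℕ) + 1) b with hfar | hadj | hclose
  · exact exists_braidEquiv_cons_of_far hfar ha hb
  · exact exists_braidEquiv_cons_of_adj hadj ha hb
  · obtain rfl : a = b := Fin.ext (by omega)
    obtain ⟨u, hu⟩ := exists_reducedWord (simple a * w)
    have hred := isReducedWord_cons.2 ⟨ha, hu⟩
    exact ⟨u, u, hred, hred, .refl _⟩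

/-- Matsumoto's theorem for symmetric groups. -/
theorem IsReducedWord.braidEquiv {l l' : List (Fin (N - 1))} {w : Equiv.Perm (Fin N)}
    (hl : IsReducedWord l w) (hl' : IsReducedWord l' w) : BraidEquiv l l' := by
  induction hd : l.length generalizing l l' w with
  | zero =>
    obtain rfl := List.length_eq_zero_iff.1 hd
    obtain rfl := List.length_eq_zero_iff.1 (hl'.2.trans (hl.2.symm.trans hd))
    exact .refl _
  | succ d ih =>
    have hd' : l'.length = d + 1 := by rw [hl'.2, ← hl.2, hd]
    obtain ⟨a, l, rfl⟩ := List.exists_cons_of_length_eq_add_one hd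
    obtain ⟨b, l', rfl⟩ := List.exists_cons_of_length_eq_add_one hd'
    have ⟨ha, hla⟩ := isReducedWord_cons.1 hl
    have ⟨hb, hlb⟩ := isReducedWord_cons.1 hl'
    obtain ⟨u, u', hu, hu', huu'⟩ := exists_braidEquiv_cons ha hb
    have hlu : BraidEquiv l u := ih hla (isReducedWord_cons.1 hu).2 (by simpa using hd)
    have hlu' : BraidEquiv l' u' := ih hlb (isReducedWord_cons.1 hu').2 (by simpa using hd')
    exact (hlu.cons a).trans (huu'.trans (hlu'.cons b).symm)

end Inversions

/-! ### Signs -/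

section Signs

variable {n : ℕ}

/-- The sign of a pair of crossings `p`, `q` with `p` above `q`, named by the lower endpoints of
the strands that cross. -/
def pairSign (p q : Fin n × Fin n) : ℤ :=
  if p.1 < q.1 ∧ p.1 ≠ q.2 ∧ p.2 ≠ q.1 ∧ p.2 ≠ q.2 then -1 else 1

/-- The sign of a crossing `p` above all the inversions of `w`. -/
def topSign (w : Equiv.Perm (Fin n)) (p : Fin n × Fin n) : ℤ := ∏ q ∈ inversions w, pairSign p q

open Classical in
/-- The coefficient of `σ_{s_a w}` in the product `σ_a σ_w`: the sign `ε_w^a` at an ascent, and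
zero at a descent. -/
def fermCoef (w : Equiv.Perm (Fin n)) (a : Fin (n - 1)) : ℤ :=
  if IsAscent a w then topSign w (topCrossing a w) else 0

theorem fermCoef_of_isAscent {w : Equiv.Perm (Fin n)} {a : Fin (n - 1)} (h : IsAscent a w) :
    fermCoef w a = topSign w (topCrossing a w) := if_pos h

theorem fermCoef_of_not_isAscent {w : Equiv.Perm (Fin n)} {a : Fin (n - 1)}
    (h : ¬ IsAscent a w) : fermCoef w a = 0 := if_neg h

theorem pairSign_mul_self (p q : Fin n × Fin n) : pairSign p q * pairSign p q = 1 := by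
  unfold pairSign
  split_ifs <;> norm_num

theorem pairSign_antisymm {p q : Fin n × Fin n} (h₀ : p.1 ≠ q.1) (h₁ : p.1 ≠ q.2)
    (h₂ : p.2 ≠ q.1) (h₃ : p.2 ≠ q.2) : pairSign p q = -pairSign q p := by
  unfold pairSign
  rcases lt_or_gt_of_ne h₀ with h | h
  · rw [if_pos ⟨h, h₁, h₂, h₃⟩, if_neg fun h' => h.asymm h'.1]
  · rw [if_neg fun h' => h.asymm h'.1, if_pos ⟨h, h₂.symm, h₁.symm, h₃.symm⟩, neg_neg]

theorem topSign_mul_self (w : Equiv.Perm (Fin n)) (p : Fin n × Fin n) :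
    topSign w p * topSign w p = 1 := by
  simp [topSign, ← Finset.prod_mul_distrib, pairSign_mul_self]

theorem topSign_simple_mul {w : Equiv.Perm (Fin n)} {a : Fin (n - 1)} (h : IsAscent a w)
    (p : Fin n × Fin n) :
    topSign (simple a * w) p = pairSign p (topCrossing a w) * topSign w p := by
  rw [topSign, inversions_simple_mul h, Finset.prod_insert (topCrossing_notMem_inversions a w),
    topSign]

theorem fermCoef_simple_mul_mul_self (w : Equiv.Perm (Fin n)) (a : Fin (n - 1)) :
    fermCoef (simple a * w) a * fermCoef w a = 0 := by
  by_cases h : IsAscent a w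
  · rw [fermCoef_of_not_isAscent (isAscent_simple_mul.not.2 (not_not.2 h)), zero_mul]
  · rw [fermCoef_of_not_isAscent h, mul_zero]

theorem fermCoef_far (w : Equiv.Perm (Fin n)) {a b : Fin (n - 1)} (h : (a : ℕ) + 1 < b) :
    fermCoef (simple b * w) a * fermCoef w b = -(fermCoef (simple a * w) b * fermCoef w a) := by
  have hasc := isAscent_simple_mul_of_far (.inl h) w
  have hasc' := isAscent_simple_mul_of_far (.inr h) w
  by_cases ha : IsAscent a w
  swap
  · rw [fermCoef_of_not_isAscent ha, fermCoef_of_not_isAscent (hasc.not.2 ha)]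
    simp
  by_cases hb : IsAscent b w
  swap
  · rw [fermCoef_of_not_isAscent hb, fermCoef_of_not_isAscent (hasc'.not.2 hb)]
    simp
  have hanti : pairSign (topCrossing a w) (topCrossing b w) =
      -pairSign (topCrossing b w) (topCrossing a w) := by
    apply pairSign_antisymm <;>
      simp only [topCrossing, ne_eq, EmbeddingLike.apply_eq_iff_eq, lo, hi, Fin.ext_iff] <;> omega
  rw [fermCoef_of_isAscent ha, fermCoef_of_isAscent hb, fermCoef_of_isAscent (hasc.2 ha),
    fermCoef_of_isAscent (hasc'.2 hb), topSign_simple_mul ha, topSign_simple_mul hb,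
    topCrossing_simple_mul_of_far (.inl h), topCrossing_simple_mul_of_far (.inr h), hanti]
  ring

theorem topSign_braid {w : Equiv.Perm (Fin n)} {a b : Fin (n - 1)} (h : (a : ℕ) + 1 = b)
    (ha : IsAscent a w) (hb : IsAscent b w) :
    topSign (simple b * (simple a * w)) (topCrossing b w) *
        topSign (simple a * w) (w⁻¹ (lo a), w⁻¹ (hi b)) * topSign w (topCrossing a w) =
      topSign (simple a * (simple b * w)) (topCrossing a w) *
        topSign (simple b * w) (w⁻¹ (lo a), w⁻¹ (hi b)) * topSign w (topCrossing b w) := by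
  have hab : IsAscent b (simple a * w) := by
    simp only [IsAscent, topCrossing_right_simple_left_mul h]
    simp only [IsAscent, topCrossing, ← hi_eq_lo h] at ha hb
    exact ha.trans hb
  have hba : IsAscent a (simple b * w) := by
    rwa [IsAscent, topCrossing_left_simple_right_mul h, ← topCrossing_right_simple_left_mul h]
  rw [topSign_simple_mul hab, topSign_simple_mul hba]
  simp only [topSign_simple_mul ha, topSign_simple_mul hb, topCrossing_right_simple_left_mul h,
    topCrossing_left_simple_right_mul h]
  -- All pairs of crossings share a strand, so that their signs are trivial.
  simp only [pairSign, topCrossing, hi_eq_lo h, ne_eq, not_true_eq_false, lt_irrefl, false_and,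
    and_false, if_false, one_mul]
  ring

theorem fermCoef_braid (w : Equiv.Perm (Fin n)) {a b : Fin (n - 1)} (h : (a : ℕ) + 1 = b) :
    fermCoef (simple b * (simple a * w)) a * fermCoef (simple a * w) b * fermCoef w a =
      fermCoef (simple a * (simple b * w)) b * fermCoef (simple b * w) a * fermCoef w b := by
  have hasc : IsAscent a (simple b * (simple a * w)) ↔ IsAscent b w := by
    rw [IsAscent, IsAscent, topCrossing_left_simple_right_simple_left_mul h]
  have hasc' : IsAscent b (simple a * (simple b * w)) ↔ IsAscent a w := by
    rw [IsAscent, IsAscent, topCrossing_right_simple_left_simple_right_mul h]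
  have hmid : IsAscent a (simple b * w) ↔ IsAscent b (simple a * w) := by
    rw [IsAscent, IsAscent, topCrossing_right_simple_left_mul h,
      topCrossing_left_simple_right_mul h]
  by_cases ha : IsAscent a w
  swap
  · rw [fermCoef_of_not_isAscent ha, fermCoef_of_not_isAscent (hasc'.not.2 ha)]
    simp
  by_cases hb : IsAscent b w
  swap
  · rw [fermCoef_of_not_isAscent hb, fermCoef_of_not_isAscent (hasc.not.2 hb)]
    simp
  by_cases hab : IsAscent b (simple a * w)
  swap
  · rw [fermCoef_of_not_isAscent hab, fermCoef_of_not_isAscent (hmid.not.2 hab)]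
    simp
  rw [fermCoef_of_isAscent ha, fermCoef_of_isAscent hb, fermCoef_of_isAscent hab,
    fermCoef_of_isAscent (hmid.2 hab), fermCoef_of_isAscent (hasc.2 hb),
    fermCoef_of_isAscent (hasc'.2 ha), topCrossing_left_simple_right_simple_left_mul h,
    topCrossing_right_simple_left_simple_right_mul h, topCrossing_right_simple_left_mul h,
    topCrossing_left_simple_right_mul h, topSign_braid h ha hb]

theorem crossings_cons (a : Fin (n - 1)) (l : List (Fin (n - 1))) :
    crossings (a :: l) = topCrossing a (wordPerm l) :: crossings l := rfl

theorem wordSign_eq_prod (l : List (Fin (n - 1))) :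
    wordSign l = ∏ p ∈ inversions (wordPerm l), ∏ q ∈ inversions (wordPerm l),
      if (crossings l).idxOf q < (crossings l).idxOf p then 1 else pairSign p q := by
  classical
  have hprod : (inversions (wordPerm l) ×ˢ inversions (wordPerm l)) =
      Finset.univ.filter fun x : (Fin n × Fin n) × (Fin n × Fin n) =>
        IsInversion (wordPerm l) x.1 ∧ IsInversion (wordPerm l) x.2 := by
    ext x
    simp only [Finset.mem_product, mem_inversions, Finset.mem_filter, Finset.mem_univ, true_and]
    rfl
  rw [← Finset.prod_product', wordSign, disjointInversions, hprod, Finset.prod_filter,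
    Finset.prod_filter]
  refine Finset.prod_congr rfl fun x _ => ?_
  unfold pairSign
  split_ifs <;> first | rfl | (exfalso; tauto)

theorem wordSign_nil : wordSign ([] : List (Fin (n - 1))) = 1 := by
  rw [wordSign_eq_prod, wordPerm_nil, inversions_one, Finset.prod_empty]

theorem wordSign_cons {a : Fin (n - 1)} {l : List (Fin (n - 1))} (h : IsAscent a (wordPerm l)) :
    wordSign (a :: l) = topSign (wordPerm l) (topCrossing a (wordPerm l)) * wordSign l := by
  have hnotMem := topCrossing_notMem_inversions a (wordPerm l)
  have hidx {q} (hq : q ∈ inversions (wordPerm l)) :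
      (topCrossing a (wordPerm l) :: crossings l).idxOf q = (crossings l).idxOf q + 1 :=
    List.idxOf_cons_ne _ fun heq => hnotMem (heq ▸ hq)
  have hself : pairSign (topCrossing a (wordPerm l)) (topCrossing a (wordPerm l)) = 1 :=
    if_neg (by simp)
  rw [wordSign_eq_prod, wordSign_eq_prod, wordPerm_cons, inversions_simple_mul h, crossings_cons]
  simp only [Finset.prod_insert hnotMem, List.idxOf_cons_self, Nat.not_lt_zero, if_false, hself,
    one_mul]
  congr 1
  refine Finset.prod_congr rfl fun p hp => ?_
  rw [hidx hp, if_pos (Nat.succ_pos _), one_mul]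
  refine Finset.prod_congr rfl fun q hq => ?_
  simp only [hidx hq, Nat.add_lt_add_iff_right]

end Signs

/-! ### The algebra of fermionic strands -/

section LOT

variable (k : Type*) [Field k] {n : ℕ}

theorem sigmaGen_far {a b : Fin (n - 1)} (h : (a : ℕ) + 1 < b) :
    sigmaGen k a * sigmaGen k b = (-1 : ℤ) • (sigmaGen k b * sigmaGen k a) := by
  rw [neg_one_smul, ← add_eq_zero_iff_eq_neg]
  simpa [sigmaGen] using RingQuot.mkAlgHom_rel k (LOTRel.far (k := k) a b (.inl h))

theorem sigmaGen_braid {a b : Fin (n - 1)} (h : (a : ℕ) + 1 = b) :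
    sigmaGen k a * sigmaGen k b * sigmaGen k a = sigmaGen k b * sigmaGen k a * sigmaGen k b := by
  simpa [sigmaGen] using RingQuot.mkAlgHom_rel k (LOTRel.braid (k := k) a b h)

/-- The product `ε(l) σ_{a_1} ⋯ σ_{a_r}` along a word `l = (a_1, …, a_r)`. -/
def signedProd (l : List (Fin (n - 1))) : LOT k n := wordSign l • (l.map (sigmaGen k)).prod

theorem signedProd_cons {a : Fin (n - 1)} {l : List (Fin (n - 1))}
    (h : IsAscent a (wordPerm l)) :
    signedProd k (a :: l) = fermCoef (wordPerm l) a • (sigmaGen k a * signedProd k l) := by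
  rw [signedProd, signedProd, wordSign_cons h, fermCoef_of_isAscent h, List.map_cons,
    List.prod_cons, mul_smul_comm, smul_smul]

theorem signedProd_comm {a b : Fin (n - 1)} (h : (a : ℕ) + 1 < b) {l : List (Fin (n - 1))}
    (hl : IsReducedWord (a :: b :: l) (wordPerm (a :: b :: l))) :
    signedProd k (a :: b :: l) = signedProd k (b :: a :: l) := by
  have hl' := (BraidEquiv.comm h l).isReducedWord_iff.1 hl
  rw [(BraidEquiv.comm h l).wordPerm_eq] at hl'
  simp only [isReducedWord_cons_wordPerm] at hl hl'
  obtain ⟨ha, hb, -⟩ := hl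
  obtain ⟨hb', ha', -⟩ := hl'
  rw [signedProd_cons k ha, signedProd_cons k hb, signedProd_cons k hb', signedProd_cons k ha']
  simp only [wordPerm_cons, mul_smul_comm, smul_smul]
  rw [fermCoef_far _ h, ← mul_assoc, ← mul_assoc, sigmaGen_far k h, smul_mul_assoc, smul_smul,
    mul_neg_one, neg_neg]

theorem signedProd_braid {a b : Fin (n - 1)} (h : (a : ℕ) + 1 = b) {l : List (Fin (n - 1))}
    (hl : IsReducedWord (a :: b :: a :: l) (wordPerm (a :: b :: a :: l))) :
    signedProd k (a :: b :: a :: l) = signedProd k (b :: a :: b :: l) := by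
  have hl' := (BraidEquiv.braid h l).isReducedWord_iff.1 hl
  rw [(BraidEquiv.braid h l).wordPerm_eq] at hl'
  simp only [isReducedWord_cons_wordPerm] at hl hl'
  obtain ⟨ha₁, hb, ha₂, -⟩ := hl
  obtain ⟨hb₁, ha, hb₂, -⟩ := hl'
  have hbraid : sigmaGen k a * (sigmaGen k b * (sigmaGen k a * signedProd k l)) =
      sigmaGen k b * (sigmaGen k a * (sigmaGen k b * signedProd k l)) := by
    simp only [← mul_assoc, sigmaGen_braid k h]
  rw [signedProd_cons k ha₁, signedProd_cons k hb, signedProd_cons k ha₂, signedProd_cons k hb₁,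
    signedProd_cons k ha, signedProd_cons k hb₂]
  simp only [wordPerm_cons, mul_smul_comm, smul_smul]
  rw [← mul_assoc (fermCoef _ _), ← mul_assoc (fermCoef _ _), fermCoef_braid _ h, hbraid]

theorem BraidEquiv.signedProd_eq {l l' : List (Fin (n - 1))} (h : BraidEquiv l l')
    (hl : IsReducedWord l (wordPerm l)) : signedProd k l = signedProd k l' := by
  induction h with
  | refl => rfl
  | symm h ih => exact (ih (h.wordPerm_eq ▸ h.isReducedWord_iff.2 hl)).symm
  | trans h _ ih ih' => exact (ih hl).trans (ih' (h.wordPerm_eq ▸ h.isReducedWord_iff.1 hl))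
  | cons a h ih =>
    obtain ⟨ha, hl⟩ := isReducedWord_cons_wordPerm.1 hl
    rw [signedProd_cons k ha, signedProd_cons k (h.wordPerm_eq ▸ ha), h.wordPerm_eq, ih hl]
  | comm h l => exact signedProd_comm k h hl
  | braid h l => exact signedProd_braid k h hl

theorem IsReducedWord.sigma_eq {l : List (Fin (n - 1))} {w : Equiv.Perm (Fin n)}
    (hl : IsReducedWord l w) : sigma k w = signedProd k l := by
  have hchoose := (exists_reducedWord w).choose_spec
  exact (hchoose.braidEquiv hl).signedProd_eq k (hchoose.1.symm ▸ hchoose)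

theorem sigma_simple_mul {w : Equiv.Perm (Fin n)} {a : Fin (n - 1)} (h : IsAscent a w) :
    sigma k (simple a * w) = fermCoef w a • (sigmaGen k a * sigma k w) := by
  obtain ⟨l, hl⟩ := exists_reducedWord w
  obtain rfl := hl.1
  have hal : IsReducedWord (a :: l) (simple a * wordPerm l) := by
    rw [← wordPerm_cons]
    exact isReducedWord_cons_wordPerm.2 ⟨h, hl⟩
  rw [hal.sigma_eq k, hl.sigma_eq k, signedProd_cons k h]

section SigmaOp

variable (M : Type*) [AddCommGroup M] [Module k M]

/-- The operator by which `σ_a` acts on the elements `σ_w`, extended to formal combinations of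
permutations with coefficients in a module. -/
def sigmaOp (a : Fin (n - 1)) : Module.End k (Equiv.Perm (Fin n) →₀ M) :=
  Finsupp.lsum k fun w => fermCoef w a • Finsupp.lsingle (simple a * w)

theorem sigmaOp_single (a : Fin (n - 1)) (w : Equiv.Perm (Fin n)) (x : M) :
    sigmaOp k M a (Finsupp.single w x) = fermCoef w a • Finsupp.single (simple a * w) x := by
  simp [sigmaOp]

theorem sigmaOp_mul_self (a : Fin (n - 1)) : sigmaOp k M a * sigmaOp k M a = 0 := by
  refine Finsupp.lhom_ext fun w x => ?_
  rw [Module.End.mul_apply, sigmaOp_single, map_zsmul, sigmaOp_single, smul_smul, mul_comm,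
    fermCoef_simple_mul_mul_self, zero_smul, LinearMap.zero_apply]

theorem sigmaOp_far {a b : Fin (n - 1)} (h : (a : ℕ) + 1 < b) :
    sigmaOp k M b * sigmaOp k M a = -(sigmaOp k M a * sigmaOp k M b) := by
  refine Finsupp.lhom_ext fun w x => ?_
  have hcoef := fermCoef_far w h
  simp only [LinearMap.neg_apply, Module.End.mul_apply, sigmaOp_single,
    map_zsmul, smul_smul, simple_mul_comm h, ← neg_smul]
  congr 1
  linear_combination hcoef

theorem sigmaOp_braid {a b : Fin (n - 1)} (h : (a : ℕ) + 1 = b) :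
    sigmaOp k M a * sigmaOp k M b * sigmaOp k M a =
      sigmaOp k M b * sigmaOp k M a * sigmaOp k M b := by
  refine Finsupp.lhom_ext fun w x => ?_
  have hcoef := fermCoef_braid w h
  simp only [Module.End.mul_apply, sigmaOp_single, map_zsmul, smul_smul, simple_mul_braid h]
  congr 1
  linear_combination hcoef

end SigmaOp

/-- The regular representation of `LOT`, written in the basis of the elements `σ_w`. -/
def reg (n : ℕ) : LOT k n →ₐ[k] Module.End k (Equiv.Perm (Fin n) →₀ k) :=
  RingQuot.liftAlgHom k ⟨FreeAlgebra.lift k (sigmaOp k k), fun _ _ h => by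
    cases h with
    | sq a => simpa using sigmaOp_mul_self k k a
    | far a b h =>
      rcases h with h | h
      · simpa [add_comm, eq_neg_iff_add_eq_zero] using sigmaOp_far k k h
      · simpa [eq_neg_iff_add_eq_zero] using sigmaOp_far k k h
    | braid a b h => simpa using sigmaOp_braid k k h⟩

theorem reg_sigmaGen (a : Fin (n - 1)) : reg k n (sigmaGen k a) = sigmaOp k k a := by
  rw [reg, sigmaGen, RingQuot.liftAlgHom_mkAlgHom_apply, FreeAlgebra.lift_ι_apply]

theorem reg_signedProd {l : List (Fin (n - 1))} (hl : IsReducedWord l (wordPerm l)) :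
    reg k n (signedProd k l) (Finsupp.single 1 1) = Finsupp.single (wordPerm l) 1 := by
  induction l with
  | nil => simp [signedProd, wordSign_nil, wordPerm_nil]
  | cons a l ih =>
    obtain ⟨ha, hl⟩ := isReducedWord_cons_wordPerm.1 hl
    rw [signedProd_cons k ha, map_zsmul, map_mul, reg_sigmaGen, LinearMap.smul_apply,
      Module.End.mul_apply, ih hl, sigmaOp_single, smul_smul, fermCoef_of_isAscent ha,
      topSign_mul_self, one_smul, wordPerm_cons]

theorem sigma_ne_zero (w : Equiv.Perm (Fin n)) : sigma k w ≠ 0 := by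
  obtain ⟨l, hl⟩ := exists_reducedWord w
  obtain rfl := hl.1
  intro h
  have hreg := reg_signedProd k hl
  rw [← hl.sigma_eq k, h, map_zero, LinearMap.zero_apply, eq_comm, Finsupp.single_eq_zero] at hreg
  exact one_ne_zero hreg

theorem eps_eq_fermCoef {w : Equiv.Perm (Fin n)} {a : Fin (n - 1)} (h : IsAscent a w) :
    eps k w a = fermCoef w a := by
  have hmul := sigma_simple_mul k h
  rw [fermCoef_of_isAscent h] at hmul ⊢
  rw [eps]
  rcases mul_self_eq_one_iff.1 (topSign_mul_self w (topCrossing a w)) with hsign | hsign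
  · rw [hsign, one_smul] at hmul
    rw [if_pos hmul, hsign, Int.cast_one]
  · split_ifs with heq
    · rw [← heq, ← Int.cast_smul_eq_zsmul k] at hmul
      exact smul_left_injective k (sigma_ne_zero k (simple a * w)) (by simpa using hmul)
    · simp [hsign]

theorem sigma_simple_mul_eps {w : Equiv.Perm (Fin n)} {a : Fin (n - 1)} (h : IsAscent a w) :
    sigma k (simple a * w) = eps k w a • (sigmaGen k a * sigma k w) := by
  rw [eps_eq_fermCoef k h, sigma_simple_mul k h]
  exact (Int.cast_smul_eq_zsmul k _ _).symm

end LOT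

/-! ### Labels and strands -/

section Labels

variable {n m : ℕ}

theorem card_filter_lt_orderEmbOfFin {α : Type*} [LinearOrder α] (s : Finset α) {r : ℕ}
    (h : s.card = r) (a : Fin r) : (s.filter (· < s.orderEmbOfFin h a)).card = a := by
  rw [← Fin.card_Iio a, ← Finset.card_map (s.orderEmbOfFin h).toEmbedding]
  congr 1
  ext q
  simp only [Finset.mem_filter, Finset.mem_map, Finset.mem_Iio]
  constructor
  · rintro ⟨hq, hlt⟩
    rw [← Finset.mem_coe, ← Finset.range_orderEmbOfFin s h] at hq
    obtain ⟨c, rfl⟩ := hq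
    exact ⟨c, (s.orderEmbOfFin h).lt_iff_lt.1 hlt, rfl⟩
  · rintro ⟨c, hc, rfl⟩
    exact ⟨s.orderEmbOfFin_mem h c, (s.orderEmbOfFin h).lt_iff_lt.2 hc⟩

theorem orderEmbOfFin_eq_iff {α : Type*} [LinearOrder α] (s : Finset α) {r : ℕ} (h : s.card = r)
    (a : Fin r) (p : α) : s.orderEmbOfFin h a = p ↔ p ∈ s ∧ (s.filter (· < p)).card = a := by
  constructor
  · rintro rfl
    exact ⟨s.orderEmbOfFin_mem h a, card_filter_lt_orderEmbOfFin s h a⟩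
  · rintro ⟨hp, hcard⟩
    rw [← Finset.mem_coe, ← Finset.range_orderEmbOfFin s h] at hp
    obtain ⟨b, rfl⟩ := hp
    rw [card_filter_lt_orderEmbOfFin] at hcard
    rw [Fin.ext hcard]

/-- The number of strands with label `c` among the first `t` strands. -/
def labelCount (i : Labels n m) (c : Bool) (t : ℕ) : ℕ :=
  (Finset.univ.filter fun p : Fin (n + m) => i.1 p = c ∧ (p : ℕ) < t).card

theorem bos_eq_iff {i : Labels n m} {a : Fin m} {p : Fin (n + m)} :
    bos i a = p ↔ i.1 p = true ∧ labelCount i true p = a := by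
  rw [bos, orderEmbOfFin_eq_iff, Finset.filter_filter]
  simp only [Finset.mem_filter, Finset.mem_univ, true_and]
  rfl

theorem ferm_eq_iff {i : Labels n m} {a : Fin n} {p : Fin (n + m)} :
    ferm i a = p ↔ i.1 p = false ∧ labelCount i false p = a := by
  rw [ferm, orderEmbOfFin_eq_iff, Finset.filter_filter]
  simp only [Finset.mem_filter, Finset.mem_univ, true_and]
  rfl

theorem label_bos (i : Labels n m) (a : Fin m) : i.1 (bos i a) = true := (bos_eq_iff.1 rfl).1

theorem label_ferm (i : Labels n m) (a : Fin n) : i.1 (ferm i a) = false := (ferm_eq_iff.1 rfl).1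

theorem bos_strictMono (i : Labels n m) : StrictMono (bos i) :=
  (Finset.orderEmbOfFin _ _).strictMono

theorem ferm_strictMono (i : Labels n m) : StrictMono (ferm i) :=
  (Finset.orderEmbOfFin _ _).strictMono

theorem exists_bos {i : Labels n m} {p : Fin (n + m)} (h : i.1 p = true) : ∃ a, bos i a = p := by
  change p ∈ Set.range (Finset.orderEmbOfFin _ i.2)
  simpa only [Finset.range_orderEmbOfFin, Finset.coe_filter, Finset.mem_univ, true_and]

theorem exists_ferm {i : Labels n m} {p : Fin (n + m)} (h : i.1 p = false) :
    ∃ a, ferm i a = p := by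
  change p ∈ Set.range (Finset.orderEmbOfFin _ (card_fermionic i))
  simpa only [Finset.range_orderEmbOfFin, Finset.coe_filter, Finset.mem_univ, true_and]

theorem labelCount_succ (i : Labels n m) (c : Bool) (p : Fin (n + m)) :
    labelCount i c (p + 1) = labelCount i c p + if i.1 p = c then 1 else 0 := by
  have hsplit (q : Fin (n + m)) : i.1 q = c ∧ (q : ℕ) < p + 1 ↔
      (i.1 q = c ∧ (q : ℕ) < p) ∨ (q = p ∧ i.1 p = c) := by
    rw [Nat.lt_succ_iff_lt_or_eq, ← Fin.ext_iff]
    grind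
  have hdisj : Disjoint (Finset.univ.filter fun q : Fin (n + m) => i.1 q = c ∧ (q : ℕ) < p)
      (Finset.univ.filter fun q : Fin (n + m) => q = p ∧ i.1 p = c) := by
    rw [Finset.disjoint_filter]
    rintro _ _ ⟨_, hlt⟩ ⟨rfl, _⟩
    exact lt_irrefl _ hlt
  simp only [labelCount, hsplit, Finset.filter_or, Finset.card_union_of_disjoint hdisj]
  split_ifs with h <;> simp [h, Finset.filter_eq']

theorem labelCount_lo_add_one (i : Labels n m) (c : Bool) (t : Fin (n + m - 1)) :
    labelCount i c (t + 1) = labelCount i c t + if i.1 (lo t) = c then 1 else 0 :=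
  labelCount_succ i c (lo t)

theorem labelCount_add_two (i : Labels n m) (c : Bool) (t : Fin (n + m - 1)) :
    labelCount i c (t + 2) = labelCount i c t + (if i.1 (lo t) = c then 1 else 0) +
      if i.1 (hi t) = c then 1 else 0 := by
  rw [← labelCount_lo_add_one]
  exact labelCount_succ i c (hi t)

theorem labelCount_mono (i : Labels n m) (c : Bool) : Monotone (labelCount i c) := fun _ _ h =>
  Finset.card_le_card (Finset.monotone_filter_right _ fun _ _ hp => ⟨hp.1, hp.2.trans_le h⟩)

theorem Labels.sw_apply (i : Labels n m) (t : Fin (n + m - 1)) (p : Fin (n + m)) :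
    (i.sw t).1 p = i.1 (simple t p) := rfl

theorem Labels.sw_lo (i : Labels n m) (t : Fin (n + m - 1)) :
    (i.sw t).1 (lo t) = i.1 (hi t) := by
  rw [Labels.sw_apply, simple_apply_lo]

theorem Labels.sw_hi (i : Labels n m) (t : Fin (n + m - 1)) :
    (i.sw t).1 (hi t) = i.1 (lo t) := by
  rw [Labels.sw_apply, simple_apply_hi]

theorem Labels.sw_sw (i : Labels n m) (t : Fin (n + m - 1)) : (i.sw t).sw t = i := by
  refine Subtype.ext (funext fun p => ?_)
  rw [Labels.sw_apply, Labels.sw_apply, simple_apply_simple]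

theorem Labels.sw_eq_self {i : Labels n m} {t : Fin (n + m - 1)}
    (h : i.1 (lo t) = i.1 (hi t)) : i.sw t = i := by
  refine Subtype.ext (funext fun p => ?_)
  rw [Labels.sw_apply]
  by_cases hlo : p = lo t
  · rw [hlo, simple_apply_lo, h]
  by_cases hhi : p = hi t
  · rw [hhi, simple_apply_hi, h]
  rw [simple_apply_of_ne hlo hhi]

theorem sw_eq_self_of_bos {i : Labels n m} {t : Fin (n + m - 1)} {a b : Fin m}
    (ha : bos i a = lo t) (hb : bos i b = hi t) : i.sw t = i :=
  Labels.sw_eq_self ((bos_eq_iff.1 ha).1.trans (bos_eq_iff.1 hb).1.symm)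

theorem sw_eq_self_of_ferm {i : Labels n m} {t : Fin (n + m - 1)} {a b : Fin n}
    (ha : ferm i a = lo t) (hb : ferm i b = hi t) : i.sw t = i :=
  Labels.sw_eq_self ((ferm_eq_iff.1 ha).1.trans (ferm_eq_iff.1 hb).1.symm)

theorem topLabels_apply (i : Labels n m) (l : List (Fin (n + m - 1))) (p : Fin (n + m)) :
    (topLabels i l).1 p = i.1 ((wordPerm l)⁻¹ p) := by
  induction l generalizing p with
  | nil => simp [topLabels, wordPerm]
  | cons t l ih => rw [topLabels, Labels.sw_apply, ih, wordPerm_cons, simple_mul_inv_apply]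

theorem topLabels_congr (i : Labels n m) {l l' : List (Fin (n + m - 1))}
    (h : wordPerm l = wordPerm l') : topLabels i l = topLabels i l' := by
  refine Subtype.ext (funext fun p => ?_)
  rw [topLabels_apply, topLabels_apply, h]

theorem Labels.sw_comm (i : Labels n m) {t u : Fin (n + m - 1)} (h : (t : ℕ) + 1 < u) :
    (i.sw t).sw u = (i.sw u).sw t :=
  topLabels_congr i (BraidEquiv.comm h []).symm.wordPerm_eq

theorem Labels.sw_braid (i : Labels n m) {t u : Fin (n + m - 1)} (h : (t : ℕ) + 1 = u) :
    ((i.sw t).sw u).sw t = ((i.sw u).sw t).sw u :=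
  topLabels_congr i (BraidEquiv.braid h []).wordPerm_eq

theorem Labels.sw_sw_sw_eq_self (i : Labels n m) {t u : Fin (n + m - 1)} (h : (t : ℕ) + 1 = u)
    (hlabel : i.1 (lo t) = i.1 (hi u)) : ((i.sw u).sw t).sw u = i := by
  have hsw : (i.sw u).sw t = i.sw u := Labels.sw_eq_self <| by
    rw [hi_eq_lo h, Labels.sw_lo, Labels.sw_apply, simple_apply_lo_of_adj h, hlabel]
  rw [hsw, Labels.sw_sw]

theorem labelCount_sw (i : Labels n m) (c : Bool) {t : Fin (n + m - 1)} {u : ℕ}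
    (h : u ≠ t + 1) : labelCount (i.sw t) c u = labelCount i c u := by
  refine Finset.card_equiv (simple t) fun p => ?_
  rw [Finset.mem_filter_univ, Finset.mem_filter_univ, Labels.sw_apply, val_simple_apply]
  refine and_congr_right fun _ => ?_
  split_ifs <;> omega

theorem simple_bos_of_not {i : Labels n m} {t : Fin (n + m - 1)}
    (h : ¬ (i.1 (lo t) = true ∧ i.1 (hi t) = true)) (a : Fin m) :
    simple t (bos i a) = bos (i.sw t) a := by
  refine congrFun (Finset.orderEmbOfFin_unique (f := fun b => simple t (bos i b)) (i.sw t).2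
    (fun b => ?_) fun b c hbc => ?_) a
  · rw [Finset.mem_filter_univ, Labels.sw_apply, simple_apply_simple, label_bos]
  · refine (simple_apply_lt_simple_apply_iff t _ _).2 (.inr ⟨bos_strictMono i hbc, ?_⟩)
    rintro ⟨hb, hc⟩
    exact h ⟨hb ▸ label_bos i b, hc ▸ label_bos i c⟩

theorem simple_ferm_of_not {i : Labels n m} {t : Fin (n + m - 1)}
    (h : ¬ (i.1 (lo t) = false ∧ i.1 (hi t) = false)) (a : Fin n) :
    simple t (ferm i a) = ferm (i.sw t) a := by
  refine congrFun (Finset.orderEmbOfFin_unique (f := fun b => simple t (ferm i b))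
    (card_fermionic (i.sw t)) (fun b => ?_) fun b c hbc => ?_) a
  · rw [Finset.mem_filter_univ, Labels.sw_apply, simple_apply_simple, label_ferm]
  · refine (simple_apply_lt_simple_apply_iff t _ _).2 (.inr ⟨ferm_strictMono i hbc, ?_⟩)
    rintro ⟨hb, hc⟩
    exact h ⟨hb ▸ label_ferm i b, hc ▸ label_ferm i c⟩

theorem exists_bos_bos {i : Labels n m} {t : Fin (n + m - 1)}
    (hlo : i.1 (lo t) = true) (hhi : i.1 (hi t) = true) :
    ∃ a : Fin (m - 1), bos i (lo a) = lo t ∧ bos i (hi a) = hi t := by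
  obtain ⟨b, hb⟩ := exists_bos hhi
  have hcount := (bos_eq_iff.1 hb).2
  have hsucc : labelCount i true (hi t) = labelCount i true t + 1 :=
    (labelCount_lo_add_one i true t).trans (by rw [if_pos hlo])
  exact ⟨⟨labelCount i true t, by omega⟩, bos_eq_iff.2 ⟨hlo, rfl⟩, bos_eq_iff.2 ⟨hhi, hsucc⟩⟩

theorem exists_ferm_ferm {i : Labels n m} {t : Fin (n + m - 1)}
    (hlo : i.1 (lo t) = false) (hhi : i.1 (hi t) = false) :
    ∃ a : Fin (n - 1), ferm i (lo a) = lo t ∧ ferm i (hi a) = hi t := by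
  obtain ⟨b, hb⟩ := exists_ferm hhi
  have hcount := (ferm_eq_iff.1 hb).2
  have hsucc : labelCount i false (hi t) = labelCount i false t + 1 :=
    (labelCount_lo_add_one i false t).trans (by rw [if_pos hlo])
  exact ⟨⟨labelCount i false t, by omega⟩, ferm_eq_iff.2 ⟨hlo, rfl⟩,
    ferm_eq_iff.2 ⟨hhi, hsucc⟩⟩

theorem simple_bos {i : Labels n m} {t : Fin (n + m - 1)} {a : Fin (m - 1)}
    (hlo : bos i (lo a) = lo t) (hhi : bos i (hi a) = hi t) (x : Fin m) :
    simple t (bos i x) = bos i (simple a x) := by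
  rw [simple, simple, ← hlo, ← hhi, (bos_strictMono i).injective.map_swap]

theorem simple_ferm {i : Labels n m} {t : Fin (n + m - 1)} {a : Fin (n - 1)}
    (hlo : ferm i (lo a) = lo t) (hhi : ferm i (hi a) = hi t) (x : Fin n) :
    simple t (ferm i x) = ferm i (simple a x) := by
  rw [simple, simple, ← hlo, ← hhi, (ferm_strictMono i).injective.map_swap]

end Labels

/-! ### Divided differences -/

section DividedDifferences

variable {k : Type*} [Field k] {m : ℕ}

theorem X_sub_X_ne_zero {a b : Fin m} (h : a ≠ b) :
    (X a - X b : MvPolynomial (Fin m) k) ≠ 0 :=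
  sub_ne_zero.2 fun e => h (X_injective e)

theorem divDiff_eq_of_mul_eq {a b : Fin m} (h : a ≠ b) {f g : MvPolynomial (Fin m) k}
    (e : (X a - X b) * g = f - rename (Equiv.swap a b) f) : divDiff k a b f = g :=
  mul_left_cancel₀ (X_sub_X_ne_zero h) (by rw [e, divDiff_spec])

/-- The divided difference as a linear map. -/
def divDiffₗ (k : Type*) [Field k] {m : ℕ} (a b : Fin m) (h : a ≠ b) :
    MvPolynomial (Fin m) k →ₗ[k] MvPolynomial (Fin m) k where
  toFun := divDiff k a b
  map_add' f g := divDiff_eq_of_mul_eq h (by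
    rw [mul_add, ← divDiff_spec, ← divDiff_spec, map_add]
    ring)
  map_smul' c f := divDiff_eq_of_mul_eq h (by
    rw [RingHom.id_apply, mul_smul_comm, ← divDiff_spec, map_smul, smul_sub])

theorem divDiffₗ_apply {a b : Fin m} (h : a ≠ b) (f : MvPolynomial (Fin m) k) :
    divDiffₗ k a b h f = divDiff k a b f := rfl

theorem divDiff_mul {a b : Fin m} (h : a ≠ b) (f g : MvPolynomial (Fin m) k) :
    divDiff k a b (f * g) =
      divDiff k a b f * g + rename (Equiv.swap a b) f * divDiff k a b g :=
  divDiff_eq_of_mul_eq h (by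
    rw [map_mul]
    linear_combination -g * divDiff_spec k a b f -
      rename (Equiv.swap a b) f * divDiff_spec k a b g)

theorem divDiff_of_symm {a b : Fin m} (h : a ≠ b) {f : MvPolynomial (Fin m) k}
    (hf : rename (Equiv.swap a b) f = f) : divDiff k a b f = 0 :=
  divDiff_eq_of_mul_eq h (by rw [hf, mul_zero, sub_self])

theorem divDiff_X_left {a b : Fin m} (h : a ≠ b) :
    divDiff k a b (X a) = 1 :=
  divDiff_eq_of_mul_eq h (by rw [rename_X, Equiv.swap_apply_left, mul_one])

theorem divDiff_X_right {a b : Fin m} (h : a ≠ b) :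
    divDiff k a b (X b) = -1 :=
  divDiff_eq_of_mul_eq h (by
    rw [rename_X, Equiv.swap_apply_right]
    ring)

theorem divDiff_X_mul_left {a b : Fin m} (h : a ≠ b) (f : MvPolynomial (Fin m) k) :
    divDiff k a b (X a * f) = f + X b * divDiff k a b f := by
  rw [divDiff_mul h, divDiff_X_left h, rename_X, Equiv.swap_apply_left, one_mul]

theorem divDiff_X_mul_right {a b : Fin m} (h : a ≠ b) (f : MvPolynomial (Fin m) k) :
    divDiff k a b (X b * f) = X a * divDiff k a b f - f := by
  rw [divDiff_mul h, divDiff_X_right h, rename_X, Equiv.swap_apply_right]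
  ring

theorem divDiff_X_mul_of_ne {a b c : Fin m} (h : a ≠ b) (hca : c ≠ a) (hcb : c ≠ b)
    (f : MvPolynomial (Fin m) k) : divDiff k a b (X c * f) = X c * divDiff k a b f := by
  have e : rename (Equiv.swap a b) (X c : MvPolynomial (Fin m) k) = X c := by
    rw [rename_X, Equiv.swap_apply_of_ne_of_ne hca hcb]
  rw [divDiff_mul h, divDiff_of_symm h e, e, zero_mul, zero_add]

theorem rename_swap_rename_swap (a b : Fin m) (f : MvPolynomial (Fin m) k) :
    rename (Equiv.swap a b) (rename (Equiv.swap a b) f) = f := by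
  rw [rename_rename, ← Equiv.Perm.coe_mul, Equiv.swap_mul_self, Equiv.Perm.coe_one,
    rename_id_apply]

theorem rename_swap_divDiff {a b : Fin m} (h : a ≠ b) (f : MvPolynomial (Fin m) k) :
    rename (Equiv.swap a b) (divDiff k a b f) = divDiff k a b f := by
  have hspec := congrArg (rename (Equiv.swap a b)) (divDiff_spec k a b f)
  rw [map_sub, map_mul, rename_swap_rename_swap, map_sub, rename_X, rename_X,
    Equiv.swap_apply_left, Equiv.swap_apply_right] at hspec
  refine mul_left_cancel₀ (X_sub_X_ne_zero h) ?_
  linear_combination hspec + divDiff_spec k a b f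

theorem divDiff_divDiff_self {a b : Fin m} (h : a ≠ b) (f : MvPolynomial (Fin m) k) :
    divDiff k a b (divDiff k a b f) = 0 :=
  divDiff_of_symm h (rename_swap_divDiff h f)

theorem rename_divDiff (e : Equiv.Perm (Fin m)) {a b : Fin m} (h : a ≠ b)
    (f : MvPolynomial (Fin m) k) :
    rename e (divDiff k a b f) = divDiff k (e a) (e b) (rename e f) := by
  have hconj : (e : Fin m → Fin m) ∘ Equiv.swap a b = Equiv.swap (e a) (e b) ∘ e :=
    funext fun x => e.injective.map_swap a b x
  refine (divDiff_eq_of_mul_eq (e.injective.ne h) ?_).symm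
  rw [rename_rename, ← hconj, ← rename_rename, ← map_sub, divDiff_spec, map_mul, map_sub,
    rename_X, rename_X]

theorem divDiff_comm {a b c d : Fin m} (hab : a ≠ b) (hcd : c ≠ d) (hac : a ≠ c) (had : a ≠ d)
    (hbc : b ≠ c) (hbd : b ≠ d) (f : MvPolynomial (Fin m) k) :
    divDiff k a b (divDiff k c d f) = divDiff k c d (divDiff k a b f) := by
  have hrename : rename (Equiv.swap a b) (divDiff k c d f) =
      divDiff k c d (rename (Equiv.swap a b) f) := by
    rw [rename_divDiff _ hcd, Equiv.swap_apply_of_ne_of_ne hac.symm hbc.symm,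
      Equiv.swap_apply_of_ne_of_ne had.symm hbd.symm]
  refine divDiff_eq_of_mul_eq hab ?_
  calc (X a - X b) * divDiff k c d (divDiff k a b f)
      = divDiff k c d (X a * divDiff k a b f) - divDiff k c d (X b * divDiff k a b f) := by
        rw [divDiff_X_mul_of_ne hcd hac had, divDiff_X_mul_of_ne hcd hbc hbd, sub_mul]
    _ = divDiff k c d (f - rename (Equiv.swap a b) f) := by
        rw [divDiff_spec, sub_mul]
        exact (map_sub (divDiffₗ k c d hcd) _ _).symm
    _ = divDiff k c d f - rename (Equiv.swap a b) (divDiff k c d f) := by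
        rw [hrename]
        exact map_sub (divDiffₗ k c d hcd) _ _

theorem divDiff_swap {a b : Fin m} (h : a ≠ b) (f : MvPolynomial (Fin m) k) :
    divDiff k b a f = -divDiff k a b f :=
  divDiff_eq_of_mul_eq h.symm (by
    rw [Equiv.swap_comm]
    linear_combination -divDiff_spec k a b f)

/-- The denominators of the three divided differences multiply to the Vandermonde product, and the
numerators to the antisymmetrization over the permutations of `a`, `b`, `c`. -/
theorem vandermonde_mul_divDiff_divDiff_divDiff {a b c : Fin m} (hab : a ≠ b) (hbc : b ≠ c)
    (hac : a ≠ c) (f : MvPolynomial (Fin m) k) :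
    (X a - X b) * (X a - X c) * (X b - X c) *
        divDiff k a b (divDiff k b c (divDiff k a b f)) =
      f - rename (Equiv.swap a b) f - rename (Equiv.swap b c) f
        + rename (Equiv.swap b c) (rename (Equiv.swap a b) f)
        + rename (Equiv.swap a b) (rename (Equiv.swap b c) f)
        - rename (Equiv.swap a b) (rename (Equiv.swap b c) (rename (Equiv.swap a b) f)) := by
  set s := rename (R := k) (Equiv.swap a b) with hs
  set t := rename (R := k) (Equiv.swap b c) with ht
  have hsa : s (X a) = X b := by rw [hs, rename_X, Equiv.swap_apply_left]
  have hsb : s (X b) = X a := by rw [hs, rename_X, Equiv.swap_apply_right]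
  have hsc : s (X c) = X c := by
    rw [hs, rename_X, Equiv.swap_apply_of_ne_of_ne hac.symm hbc.symm]
  have hta : t (X a) = X a := by rw [ht, rename_X, Equiv.swap_apply_of_ne_of_ne hab hac]
  have htb : t (X b) = X c := by rw [ht, rename_X, Equiv.swap_apply_left]
  have hss (g : MvPolynomial (Fin m) k) : s (s g) = g := rename_swap_rename_swap a b g
  have h₁ := divDiff_spec k a b f
  have h₂ := divDiff_spec k b c (divDiff k a b f)
  have h₃ := divDiff_spec k a b (divDiff k b c (divDiff k a b f))
  have hsh₁ := congrArg s h₁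
  have hth₁ := congrArg t h₁
  have hsth₁ := congrArg s hth₁
  have hsh₂ := congrArg s h₂
  simp only [map_sub, map_mul, ← hs, ← ht, hsa, hsb, hsc, hta, htb, hss]
    at h₁ h₂ h₃ hsh₁ hth₁ hsth₁ hsh₂
  refine mul_left_cancel₀ (X_sub_X_ne_zero hab) ?_
  linear_combination (-(X a - X b) * (X a - X c) * (X b - X c)) * h₃
    - (X a - X b) * (X a - X c) * h₂ + (X a - X b) * (X b - X c) * hsh₂
    - (X a - X c) * h₁ + (X a - X b) * hth₁ - (X b - X c) * hsh₁ - (X a - X b) * hsth₁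

theorem rename_swap_braid {a b c : Fin m} (hab : a ≠ b) (hbc : b ≠ c) (hac : a ≠ c)
    (f : MvPolynomial (Fin m) k) :
    rename (Equiv.swap a b) (rename (Equiv.swap b c) (rename (Equiv.swap a b) f)) =
      rename (Equiv.swap b c) (rename (Equiv.swap a b) (rename (Equiv.swap b c) f)) := by
  have hbraid : Equiv.swap a b * Equiv.swap b c * Equiv.swap a b =
      Equiv.swap b c * Equiv.swap a b * Equiv.swap b c := by
    rw [Equiv.swap_mul_swap_mul_swap hab hac, Equiv.swap_comm a b, Equiv.swap_comm b c,
      Equiv.swap_mul_swap_mul_swap hbc.symm hac.symm, Equiv.swap_comm]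
  simp only [rename_rename, ← Equiv.Perm.coe_mul, ← mul_assoc, hbraid]

theorem divDiff_braid {a b c : Fin m} (hab : a ≠ b) (hbc : b ≠ c) (hac : a ≠ c)
    (f : MvPolynomial (Fin m) k) :
    divDiff k a b (divDiff k b c (divDiff k a b f)) =
      divDiff k b c (divDiff k a b (divDiff k b c f)) := by
  have hneg (g : MvPolynomial (Fin m) k) : divDiff k a b (-g) = -divDiff k a b g :=
    map_neg (divDiffₗ k a b hab) g
  have hleft := vandermonde_mul_divDiff_divDiff_divDiff hab hbc hac f
  have hright := vandermonde_mul_divDiff_divDiff_divDiff hbc.symm hab.symm hac.symm f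
  simp only [divDiff_swap hbc, divDiff_swap hab, hneg, neg_neg, Equiv.swap_comm c b,
    Equiv.swap_comm b a] at hright
  refine mul_left_cancel₀ (mul_ne_zero (mul_ne_zero (X_sub_X_ne_zero hab)
    (X_sub_X_ne_zero hac)) (X_sub_X_ne_zero hbc)) ?_
  linear_combination hleft - hright - rename_swap_braid hab hbc hac f

end DividedDifferences

/-! ### The operators of the crossings on polynomials and on permutations -/

section Operators

variable (k : Type*) [Field k] {n m : ℕ}

/-- The `a`-th divided difference, counting from zero; it is `0` if there is no `(a + 1)`-st
variable. -/
def ddOp (m a : ℕ) : Module.End k (MvPolynomial (Fin m) k) :=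
  if h : a + 1 < m then divDiffₗ k ⟨a, by omega⟩ ⟨a + 1, h⟩ (by simp) else 0

/-- Multiplication by the `a`-th variable, counting from zero; it is `0` if there is no such
variable. -/
def xOp (m a : ℕ) : Module.End k (MvPolynomial (Fin m) k) :=
  if h : a < m then LinearMap.mulLeft k (X ⟨a, h⟩) else 0

variable {k}

theorem ddOp_apply {a b : Fin m} (h : (a : ℕ) + 1 = b) (f : MvPolynomial (Fin m) k) :
    ddOp k m a f = divDiff k a b f := by
  have hb : (a : ℕ) + 1 < m := by omega
  rw [ddOp, dif_pos hb, divDiffₗ_apply]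
  congr 1
  exact Fin.ext h

theorem xOp_apply (a : Fin m) (f : MvPolynomial (Fin m) k) : xOp k m a f = X a * f := by
  rw [xOp, dif_pos a.2]
  rfl

theorem xOp_comm (a b : ℕ) : xOp k m a * xOp k m b = xOp k m b * xOp k m a := by
  unfold xOp
  split_ifs <;> try simp
  refine LinearMap.ext fun f => ?_
  simp only [Module.End.mul_apply, LinearMap.mulLeft_apply]
  ring

theorem ddOp_xOp_comm {a b : ℕ} (h₁ : b ≠ a) (h₂ : b ≠ a + 1) :
    ddOp k m a * xOp k m b = xOp k m b * ddOp k m a := by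
  unfold ddOp xOp
  split_ifs <;> try simp
  refine LinearMap.ext fun f => ?_
  exact divDiff_X_mul_of_ne (by simp) (by simpa using h₁) (by simpa using h₂) f

theorem ddOp_mul_self (a : ℕ) : ddOp k m a * ddOp k m a = 0 := by
  unfold ddOp
  split_ifs
  · exact LinearMap.ext (divDiff_divDiff_self (by simp))
  · exact mul_zero _

theorem ddOp_comm {a b : ℕ} (h : a + 1 < b) :
    ddOp k m a * ddOp k m b = ddOp k m b * ddOp k m a := by
  unfold ddOp
  split_ifs <;> try simp
  refine LinearMap.ext fun f => ?_
  refine divDiff_comm ?_ ?_ ?_ ?_ ?_ ?_ f <;> simp only [ne_eq, Fin.mk.injEq] <;> omega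

theorem ddOp_braid (a : ℕ) : ddOp k m a * ddOp k m (a + 1) * ddOp k m a =
    ddOp k m (a + 1) * ddOp k m a * ddOp k m (a + 1) := by
  unfold ddOp
  split_ifs <;> try simp
  refine LinearMap.ext fun f => ?_
  refine divDiff_braid ?_ ?_ ?_ f <;> simp only [ne_eq, Fin.mk.injEq] <;> omega

theorem ddOp_mul_xOp {a : ℕ} (h : a + 1 < m) :
    ddOp k m a * xOp k m a = xOp k m (a + 1) * ddOp k m a + 1 := by
  rw [ddOp, xOp, xOp, dif_pos h, dif_pos h, dif_pos (by omega)]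
  refine LinearMap.ext fun f => ?_
  exact (divDiff_X_mul_left (by simp) f).trans (add_comm _ _)

theorem xOp_mul_ddOp {a : ℕ} (h : a + 1 < m) :
    xOp k m a * ddOp k m a = ddOp k m a * xOp k m (a + 1) + 1 := by
  rw [ddOp, xOp, xOp, dif_pos h, dif_pos h, dif_pos (by omega)]
  refine LinearMap.ext fun f => ?_
  exact sub_eq_iff_eq_add.1 (divDiff_X_mul_right (by simp) f).symm

theorem ddOp_mul_xOp_mul_xOp (a : ℕ) :
    ddOp k m a * xOp k m a * xOp k m (a + 1) = xOp k m a * xOp k m (a + 1) * ddOp k m a := by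
  by_cases h : a + 1 < m
  · rw [ddOp, xOp, xOp, dif_pos h, dif_pos h, dif_pos (by omega)]
    refine LinearMap.ext fun f => ?_
    simp only [Module.End.mul_apply, LinearMap.mulLeft_apply, divDiffₗ_apply]
    rw [divDiff_X_mul_left (by simp), divDiff_X_mul_right (by simp)]
    ring
  · rw [ddOp, dif_neg h]; simp

/-- The action of a crossing with labels `c`, `d` on polynomials, where `a` is the number of
bosonic strands to the left. -/
def polyOp (k : Type*) [Field k] (m : ℕ) :
    Bool → Bool → ℕ → Module.End k (MvPolynomial (Fin m) k)
  | true, true, a => ddOp k m a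
  | true, false, a => xOp k m a
  | false, _, _ => 1

theorem polyOp_comm {c d c' d' : Bool} {a b : ℕ}
    (h : a + (if c = true then 1 else 0) + (if d = true then 1 else 0) ≤ b) :
    polyOp k m c' d' b * polyOp k m c d a = polyOp k m c d a * polyOp k m c' d' b := by
  cases c <;> cases d <;> cases c' <;> cases d' <;>
    simp only [polyOp, if_true, Bool.false_eq_true, if_false, mul_one, one_mul] at h ⊢
  · exact xOp_comm _ _
  · exact ddOp_xOp_comm (by omega) (by omega)
  · exact (ddOp_xOp_comm (by omega) (by omega)).symm
  · exact (ddOp_comm (by omega)).symm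

theorem xOp_mul_polyOp {c d : Bool} {a b : ℕ}
    (h : c = true → d = true → b ≠ a ∧ b ≠ a + 1) :
    xOp k m b * polyOp k m c d a = polyOp k m c d a * xOp k m b := by
  cases c <;> cases d
  · exact (mul_one _).trans (one_mul _).symm
  · exact (mul_one _).trans (one_mul _).symm
  · exact xOp_comm b a
  · exact (ddOp_xOp_comm (h rfl rfl).1 (h rfl rfl).2).symm

theorem polyOp_braid {c d e : Bool} {a : ℕ} (h : ¬ (c = true ∧ d = false ∧ e = true)) :
    polyOp k m d e a * polyOp k m c e (a + if d = true then 1 else 0) * polyOp k m c d a =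
      polyOp k m c d (a + if e = true then 1 else 0) * polyOp k m c e a *
        polyOp k m d e (a + if c = true then 1 else 0) := by
  cases c <;> cases d <;> cases e <;>
    simp only [polyOp, if_true, Bool.false_eq_true, if_false, mul_one, one_mul, add_zero,
      not_true_eq_false, and_self] at h ⊢
  · exact (ddOp_mul_xOp_mul_xOp a).symm
  · exact ddOp_braid a

theorem polyOp_braid_even_odd_even {a : ℕ} (h : a + 1 < m) :
    polyOp k m false true a * polyOp k m true true a * polyOp k m true false a =
      polyOp k m true false (a + 1) * polyOp k m true true a * polyOp k m false true (a + 1)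
        + 1 := by
  simp only [polyOp, one_mul, mul_one]
  exact ddOp_mul_xOp h

/-- The action of a crossing with labels `c`, `d` on combinations of permutations of the fermionic
strands, where `b` is the number of fermionic strands to the left; it is `0` if `c` and `d` are
fermionic but there are no such strands. -/
def fermOp (k M : Type*) [Field k] [AddCommGroup M] [Module k M] (n : ℕ) :
    Bool → Bool → ℕ → Module.End k (Equiv.Perm (Fin n) →₀ M)
  | false, false, b => if h : b < n - 1 then sigmaOp k M ⟨b, h⟩ else 0
  | true, _, _ => 1
  | false, true, _ => 1

section FermOp

variable {M : Type*} [AddCommGroup M] [Module k M]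

theorem fermOp_false_false (b : Fin (n - 1)) :
    fermOp k M n false false b = sigmaOp k M b := dif_pos b.2

theorem fermOp_far_odd {b b' : ℕ} (h : b + 1 < b') :
    fermOp k M n false false b' * fermOp k M n false false b =
      -(fermOp k M n false false b * fermOp k M n false false b') := by
  simp only [fermOp]
  by_cases hb' : b' < n - 1
  · rw [dif_pos hb', dif_pos (by omega)]
    exact sigmaOp_far k M h
  · rw [dif_neg hb', zero_mul, mul_zero, neg_zero]

theorem fermOp_far_even {c d c' d' : Bool} {b b' : ℕ}
    (h : ¬ ((c = false ∧ d = false) ∧ (c' = false ∧ d' = false))) :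
    fermOp k M n c' d' b' * fermOp k M n c d b = fermOp k M n c d b * fermOp k M n c' d' b' := by
  cases c <;> cases d <;> cases c' <;> cases d' <;> simp [fermOp] at h ⊢

theorem fermOp_mul_self (b : ℕ) : fermOp k M n false false b * fermOp k M n false false b = 0 := by
  simp only [fermOp]
  split_ifs
  · exact sigmaOp_mul_self k M _
  · exact mul_zero _

theorem fermOp_braid (c d e : Bool) (b : ℕ) :
    fermOp k M n d e b * fermOp k M n c e (b + if d = false then 1 else 0) * fermOp k M n c d b =
      fermOp k M n c d (b + if e = false then 1 else 0) * fermOp k M n c e b *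
        fermOp k M n d e (b + if c = false then 1 else 0) := by
  cases c <;> cases d <;> cases e <;>
    simp only [fermOp, if_true, Bool.true_eq_false, if_false, add_zero, mul_one, one_mul]
  by_cases hb : b + 1 < n - 1
  · rw [dif_pos hb, dif_pos (by omega)]
    exact sigmaOp_braid k M (by rfl)
  · rw [dif_neg hb, mul_zero, zero_mul, mul_zero]

end FermOp

end Operators

/-! ### The representation `Pol` -/

section CoeffOp

variable {k : Type*} [Field k] {M : Type*} [AddCommGroup M] [Module k M]

/-- The coefficientwise action of an operator on formal combinations with coefficients in a
module. -/
def coeffOp (α : Type*) : Module.End k M →+* Module.End k (α →₀ M) where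
  toFun A := Finsupp.mapRange.linearMap A
  map_one' := Finsupp.mapRange.linearMap_id
  map_mul' A B := Finsupp.mapRange.linearMap_comp A B
  map_zero' := Finsupp.lhom_ext fun _ _ => by simp
  map_add' A B := Finsupp.lhom_ext fun _ _ => by simp

theorem coeffOp_single {α : Type*} (A : Module.End k M) (w : α) (x : M) :
    coeffOp α A (Finsupp.single w x) = Finsupp.single w (A x) :=
  Finsupp.mapRange_single (hf := map_zero A)

theorem commute_coeffOp_fermOp {n : ℕ} (A : Module.End k M) (c d : Bool) (b : ℕ) :
    Commute (coeffOp _ A) (fermOp k M n c d b) := by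
  cases c <;> cases d <;> try exact Commute.one_right _
  rw [fermOp]
  split_ifs
  · refine Finsupp.lhom_ext fun w x => ?_
    simp only [Module.End.mul_apply, coeffOp_single, sigmaOp_single, map_zsmul]
  · exact Commute.zero_right _

theorem coeffOp_mul_fermOp_mul {n : ℕ} (A A' : Module.End k M) (c d c' d' : Bool) (b b' : ℕ) :
    coeffOp _ A' * fermOp k M n c' d' b' * (coeffOp _ A * fermOp k M n c d b) =
      coeffOp _ (A' * A) * (fermOp k M n c' d' b' * fermOp k M n c d b) := by
  rw [map_mul, (commute_coeffOp_fermOp A c' d' b').symm.mul_mul_mul_comm]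

theorem coeffOp_mul_fermOp_mul_mul {n : ℕ} (A A' A'' : Module.End k M)
    (c d c' d' c'' d'' : Bool) (b b' b'' : ℕ) :
    coeffOp _ A'' * fermOp k M n c'' d'' b'' * (coeffOp _ A' * fermOp k M n c' d' b') *
        (coeffOp _ A * fermOp k M n c d b) =
      coeffOp _ (A'' * A' * A) *
        (fermOp k M n c'' d'' b'' * fermOp k M n c' d' b' * fermOp k M n c d b) := by
  have hcomm : Commute (coeffOp _ A) (fermOp k M n c'' d'' b'' * fermOp k M n c' d' b') :=
    (commute_coeffOp_fermOp A c'' d'' b'').mul_right (commute_coeffOp_fermOp A c' d' b')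
  rw [coeffOp_mul_fermOp_mul, hcomm.symm.mul_mul_mul_comm, ← map_mul]

end CoeffOp

section StrandOp

variable (k : Type*) [Field k] (n m : ℕ)

/-- The action of a crossing with labels `c`, `d` on `⨁_w Pol(i,w)`, where `a` and `b` are the
numbers of bosonic and of fermionic strands to the left. -/
def strandOp (c d : Bool) (a b : ℕ) :
    Module.End k (Equiv.Perm (Fin n) →₀ MvPolynomial (Fin m) k) :=
  coeffOp _ (polyOp k m c d a) * fermOp k _ n c d b

variable {k n m}

theorem strandOp_mul_strandOp (c d c' d' : Bool) (a b a' b' : ℕ) :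
    strandOp k n m c' d' a' b' * strandOp k n m c d a b =
      coeffOp _ (polyOp k m c' d' a' * polyOp k m c d a) *
        (fermOp k _ n c' d' b' * fermOp k _ n c d b) :=
  coeffOp_mul_fermOp_mul _ _ c d c' d' b b'

theorem strandOp_mul_strandOp_mul_strandOp (c d c' d' c'' d'' : Bool) (a b a' b' a'' b'' : ℕ) :
    strandOp k n m c'' d'' a'' b'' * strandOp k n m c' d' a' b' * strandOp k n m c d a b =
      coeffOp _ (polyOp k m c'' d'' a'' * polyOp k m c' d' a' * polyOp k m c d a) *
        (fermOp k _ n c'' d'' b'' * fermOp k _ n c' d' b' * fermOp k _ n c d b) :=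
  coeffOp_mul_fermOp_mul_mul _ _ _ c d c' d' c'' d'' b b' b''

theorem strandOp_far_odd {a b a' b' : ℕ} (h : b + 1 < b') :
    strandOp k n m false false a' b' * strandOp k n m false false a b =
      -(strandOp k n m false false a b * strandOp k n m false false a' b') := by
  rw [strandOp_mul_strandOp, strandOp_mul_strandOp, fermOp_far_odd h]
  exact LinearMap.comp_neg _ _

theorem strandOp_far_even {c d c' d' : Bool} {a b a' b' : ℕ}
    (ha : a + (if c = true then 1 else 0) + (if d = true then 1 else 0) ≤ a')
    (h : ¬ ((c = false ∧ d = false) ∧ (c' = false ∧ d' = false))) :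
    strandOp k n m c' d' a' b' * strandOp k n m c d a b =
      strandOp k n m c d a b * strandOp k n m c' d' a' b' := by
  rw [strandOp_mul_strandOp, strandOp_mul_strandOp, polyOp_comm ha, fermOp_far_even h]

theorem strandOp_mul_self (c : Bool) (a b : ℕ) :
    strandOp k n m c c a b * strandOp k n m c c a b = 0 := by
  rw [strandOp_mul_strandOp]
  cases c
  · rw [fermOp_mul_self, mul_zero]
  · rw [polyOp, ddOp_mul_self, map_zero, zero_mul]

theorem strandOp_mixed {c d : Bool} (h : c ≠ d) (a b : ℕ) :
    strandOp k n m d c a b * strandOp k n m c d a b = coeffOp _ (xOp k m a) := by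
  rw [strandOp_mul_strandOp]
  cases c <;> cases d <;> simp [polyOp, fermOp] at h ⊢

theorem strandOp_braid {c d e : Bool} (h : ¬ (c = true ∧ d = false ∧ e = true)) (a b : ℕ) :
    strandOp k n m d e a b *
        strandOp k n m c e (a + if d = true then 1 else 0) (b + if d = false then 1 else 0) *
        strandOp k n m c d a b =
      strandOp k n m c d (a + if e = true then 1 else 0) (b + if e = false then 1 else 0) *
        strandOp k n m c e a b *
        strandOp k n m d e (a + if c = true then 1 else 0) (b + if c = false then 1 else 0) := by
  simp only [strandOp_mul_strandOp_mul_strandOp, polyOp_braid h, fermOp_braid]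

theorem strandOp_braid_even_odd_even {a : ℕ} (h : a + 1 < m) (b : ℕ) :
    strandOp k n m false true a b * strandOp k n m true true a (b + 1) *
        strandOp k n m true false a b =
      strandOp k n m true false (a + 1) b * strandOp k n m true true a b *
        strandOp k n m false true (a + 1) b + 1 := by
  simp only [strandOp_mul_strandOp_mul_strandOp, polyOp_braid_even_odd_even h, fermOp, mul_one,
    map_add, map_one]

end StrandOp

section LocalOp

variable (k : Type*) [Field k] {n m : ℕ}

/-- The action `⨁_w Pol(i,w) → ⨁_w Pol(s_t i,w)` of the `t`-th crossing. -/
def localOp (i : Labels n m) (t : Fin (n + m - 1)) :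
    Module.End k (Equiv.Perm (Fin n) →₀ MvPolynomial (Fin m) k) :=
  strandOp k n m (i.1 (lo t)) (i.1 (hi t)) (labelCount i true t) (labelCount i false t)

theorem localOp_sw_self (i : Labels n m) (t : Fin (n + m - 1)) :
    localOp k (i.sw t) t =
      strandOp k n m (i.1 (hi t)) (i.1 (lo t)) (labelCount i true t) (labelCount i false t) := by
  rw [localOp, Labels.sw_lo, Labels.sw_hi, labelCount_sw i true (by omega),
    labelCount_sw i false (by omega)]

theorem localOp_sw_of_far (i : Labels n m) {t u : Fin (n + m - 1)}
    (h : (t : ℕ) + 1 < u ∨ (u : ℕ) + 1 < t) : localOp k (i.sw t) u = localOp k i u := by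
  have hlo : simple t (lo u) = lo u := by
    refine simple_apply_of_ne ?_ ?_ <;> simp only [lo, hi, ne_eq, Fin.ext_iff] <;> omega
  have hhi : simple t (hi u) = hi u := by
    refine simple_apply_of_ne ?_ ?_ <;> simp only [lo, hi, ne_eq, Fin.ext_iff] <;> omega
  rw [localOp, localOp, Labels.sw_apply, Labels.sw_apply, hlo, hhi,
    labelCount_sw i true (by omega), labelCount_sw i false (by omega)]

section Adjacent

variable (i : Labels n m) {t u : Fin (n + m - 1)} (h : (t : ℕ) + 1 = u)
include h

theorem localOp_right :
    localOp k i u = strandOp k n m (i.1 (hi t)) (i.1 (hi u))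
      (labelCount i true t + if i.1 (lo t) = true then 1 else 0)
      (labelCount i false t + if i.1 (lo t) = false then 1 else 0) := by
  rw [localOp, ← h, labelCount_lo_add_one, labelCount_lo_add_one, hi_eq_lo h]

theorem localOp_sw_left :
    localOp k (i.sw t) u = strandOp k n m (i.1 (lo t)) (i.1 (hi u))
      (labelCount i true t + if i.1 (hi t) = true then 1 else 0)
      (labelCount i false t + if i.1 (hi t) = false then 1 else 0) := by
  rw [localOp_right k _ h, Labels.sw_hi, Labels.sw_lo, Labels.sw_apply, simple_apply_hi_of_adj h,
    labelCount_sw i true (by omega), labelCount_sw i false (by omega)]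

theorem localOp_sw_right :
    localOp k (i.sw u) t = strandOp k n m (i.1 (lo t)) (i.1 (hi u))
      (labelCount i true t) (labelCount i false t) := by
  rw [localOp, Labels.sw_apply, simple_apply_lo_of_adj h, hi_eq_lo h, Labels.sw_lo,
    labelCount_sw i true (by omega), labelCount_sw i false (by omega)]

theorem localOp_sw_sw_left :
    localOp k ((i.sw t).sw u) t = strandOp k n m (i.1 (hi t)) (i.1 (hi u))
      (labelCount i true t) (labelCount i false t) := by
  rw [localOp_sw_right k _ h, Labels.sw_lo, Labels.sw_apply, simple_apply_hi_of_adj h,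
    labelCount_sw i true (by omega), labelCount_sw i false (by omega)]

theorem localOp_sw_sw_right :
    localOp k ((i.sw u).sw t) u = strandOp k n m (i.1 (lo t)) (i.1 (hi t))
      (labelCount i true t + if i.1 (hi u) = true then 1 else 0)
      (labelCount i false t + if i.1 (hi u) = false then 1 else 0) := by
  rw [localOp_sw_left k _ h, Labels.sw_hi, hi_eq_lo h, Labels.sw_lo, Labels.sw_apply,
    simple_apply_lo_of_adj h, labelCount_sw i true (by omega), labelCount_sw i false (by omega)]

end Adjacent

theorem localOp_bos_bos {i : Labels n m} {t : Fin (n + m - 1)} {a b : Fin m}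
    (ha : bos i a = lo t) (hb : bos i b = hi t) :
    localOp k i t = coeffOp _ (ddOp k m a) := by
  obtain ⟨hlo, hcount⟩ := bos_eq_iff.1 ha
  rw [localOp, hlo, (bos_eq_iff.1 hb).1, ← hcount]
  exact mul_one _

theorem localOp_bos_ferm {i : Labels n m} {t : Fin (n + m - 1)} {a : Fin m}
    (ha : bos i a = lo t) (hhi : i.1 (hi t) = false) :
    localOp k i t = coeffOp _ (xOp k m a) := by
  obtain ⟨hlo, hcount⟩ := bos_eq_iff.1 ha
  rw [localOp, hlo, hhi, ← hcount]
  exact mul_one _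

theorem localOp_ferm_bos {i : Labels n m} {t : Fin (n + m - 1)}
    (hlo : i.1 (lo t) = false) (hhi : i.1 (hi t) = true) : localOp k i t = 1 := by
  rw [localOp, hlo, hhi]
  exact (mul_one _).trans (map_one _)

theorem localOp_ferm_ferm {i : Labels n m} {t : Fin (n + m - 1)} {a : Fin (n - 1)}
    (hlo : ferm i (lo a) = lo t) (hhi : ferm i (hi a) = hi t) :
    localOp k i t = sigmaOp k _ a := by
  obtain ⟨hlabel, hcount⟩ := ferm_eq_iff.1 hlo
  have hcount : labelCount i false t = a := hcount
  rw [localOp, hlabel, (ferm_eq_iff.1 hhi).1, hcount, strandOp, fermOp_false_false]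
  exact (congrArg (· * _) (map_one _)).trans (one_mul _)

variable {k}

theorem localOp_far_odd (i : Labels n m) {t u : Fin (n + m - 1)} (h : (t : ℕ) + 1 < u)
    (ht : i.1 (lo t) = false ∧ i.1 (hi t) = false) (hu : i.1 (lo u) = false ∧ i.1 (hi u) = false) :
    localOp k (i.sw t) u * localOp k i t = -(localOp k (i.sw u) t * localOp k i u) := by
  have hcount : labelCount i false (t + 2) ≤ labelCount i false u :=
    labelCount_mono i false (by omega)
  rw [labelCount_add_two, if_pos ht.1, if_pos ht.2] at hcount
  rw [localOp_sw_of_far k i (.inl h), localOp_sw_of_far k i (.inr h), localOp, localOp, ht.1, ht.2,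
    hu.1, hu.2, strandOp_far_odd (by omega)]

theorem localOp_far_even (i : Labels n m) {t u : Fin (n + m - 1)} (h : (t : ℕ) + 1 < u)
    (hb : ¬ ((i.1 (lo t) = false ∧ i.1 (hi t) = false) ∧
      (i.1 (lo u) = false ∧ i.1 (hi u) = false))) :
    localOp k (i.sw t) u * localOp k i t = localOp k (i.sw u) t * localOp k i u := by
  have hcount : labelCount i true (t + 2) ≤ labelCount i true u := labelCount_mono i true (by omega)
  rw [labelCount_add_two] at hcount
  rw [localOp_sw_of_far k i (.inl h), localOp_sw_of_far k i (.inr h), localOp, localOp,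
    strandOp_far_even hcount hb]

theorem localOp_double_same (i : Labels n m) {t : Fin (n + m - 1)} (h : i.1 (lo t) = i.1 (hi t)) :
    localOp k (i.sw t) t * localOp k i t = 0 := by
  rw [localOp_sw_self, localOp, h, strandOp_mul_self]

theorem localOp_double_mixed (i : Labels n m) {t : Fin (n + m - 1)}
    (h : i.1 (lo t) ≠ i.1 (hi t)) :
    localOp k (i.sw t) t * localOp k i t = coeffOp _ (xOp k m (labelCount i true t)) := by
  rw [localOp_sw_self, localOp, strandOp_mixed h]

theorem localOp_triple (i : Labels n m) {t u : Fin (n + m - 1)} (h : (t : ℕ) + 1 = u)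
    (hb : ¬ (i.1 (lo t) = true ∧ i.1 (hi t) = false ∧ i.1 (hi u) = true)) :
    localOp k ((i.sw t).sw u) t * localOp k (i.sw t) u * localOp k i t =
      localOp k ((i.sw u).sw t) u * localOp k (i.sw u) t * localOp k i u := by
  rw [localOp_sw_sw_left k i h, localOp_sw_left k i h, localOp_sw_sw_right k i h,
    localOp_sw_right k i h, localOp_right k i h, localOp, strandOp_braid hb]

theorem localOp_triple_even_odd_even (i : Labels n m) {t u : Fin (n + m - 1)}
    (h : (t : ℕ) + 1 = u)
    (hb : i.1 (lo t) = true ∧ i.1 (hi t) = false ∧ i.1 (hi u) = true) :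
    localOp k ((i.sw t).sw u) t * localOp k (i.sw t) u * localOp k i t =
      localOp k ((i.sw u).sw t) u * localOp k (i.sw u) t * localOp k i u + 1 := by
  obtain ⟨b, hb'⟩ := exists_bos hb.2.2
  have hcount : labelCount i true (hi u) = labelCount i true t + 1 := by
    change labelCount i true (u + 1) = _
    rw [← h, labelCount_add_two, if_pos hb.1, if_neg (by simp [hb.2.1]), add_zero]
  have hlt : labelCount i true t + 1 < m := hcount ▸ (bos_eq_iff.1 hb').2 ▸ b.2
  rw [localOp_sw_sw_left k i h, localOp_sw_left k i h, localOp_sw_sw_right k i h,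
    localOp_sw_right k i h, localOp_right k i h, localOp]
  simp only [hb, reduceCtorEq, reduceIte, add_zero]
  rw [strandOp_braid_even_odd_even hlt]

theorem coeffOp_xOp_mul_localOp {i : Labels n m} {t : Fin (n + m - 1)} {a : Fin m}
    (h : i.1 (lo t) = true → i.1 (hi t) = true → bos i a ≠ lo t ∧ bos i a ≠ hi t) :
    coeffOp _ (xOp k m a) * localOp k i t = localOp k i t * coeffOp _ (xOp k m a) := by
  have hcomm : xOp k m a * polyOp k m (i.1 (lo t)) (i.1 (hi t)) (labelCount i true t) =
      polyOp k m (i.1 (lo t)) (i.1 (hi t)) (labelCount i true t) * xOp k m a := by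
    refine xOp_mul_polyOp fun hlo hhi => ⟨fun ha => ?_, fun ha => ?_⟩
    · exact (h hlo hhi).1 (bos_eq_iff.2 ⟨hlo, ha.symm⟩)
    · refine (h hlo hhi).2 (bos_eq_iff.2 ⟨hhi, ?_⟩)
      exact (labelCount_lo_add_one i true t).trans (by rw [if_pos hlo, ha])
  rw [localOp, strandOp, ← mul_assoc, ← map_mul, hcomm, map_mul, mul_assoc,
    commute_coeffOp_fermOp, mul_assoc]

theorem labelCount_eq_of_mixed {i : Labels n m} {t : Fin (n + m - 1)} {a : Fin m}
    (hm : i.1 (lo t) ≠ i.1 (hi t)) (ha : bos i a = lo t ∨ bos i a = hi t) :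
    labelCount i true t = a := by
  obtain ha | ha := ha
  · exact (bos_eq_iff.1 ha).2
  · obtain ⟨hlabel, hcount⟩ := bos_eq_iff.1 ha
    have hlo : i.1 (lo t) ≠ true := fun hlo => hm (hlo.trans hlabel.symm)
    rw [← hcount]
    exact ((labelCount_lo_add_one i true t).trans (by rw [if_neg hlo, add_zero])).symm

theorem val_add_one_eq_of_bos {i : Labels n m} {t : Fin (n + m - 1)} {a b : Fin m}
    (ha : bos i a = lo t) (hb : bos i b = hi t) : (a : ℕ) + 1 = b := by
  obtain ⟨hlo, hcount⟩ := bos_eq_iff.1 ha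
  rw [← (bos_eq_iff.1 hb).2, ← hcount]
  exact ((labelCount_lo_add_one i true t).trans (by rw [if_pos hlo]; rfl)).symm

theorem localOp_nil_top {i : Labels n m} {t : Fin (n + m - 1)} {a b : Fin m}
    (ha : bos i a = lo t) (hb : bos i b = hi t) :
    coeffOp _ (xOp k m a) * localOp k i t = localOp k i t * coeffOp _ (xOp k m b) + 1 := by
  have hab := val_add_one_eq_of_bos ha hb
  rw [localOp_bos_bos k ha hb, ← hab, ← map_mul, xOp_mul_ddOp (by omega), map_add, map_mul,
    map_one]

theorem localOp_nil_bot {i : Labels n m} {t : Fin (n + m - 1)} {a b : Fin m}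
    (ha : bos i a = lo t) (hb : bos i b = hi t) :
    localOp k i t * coeffOp _ (xOp k m a) = coeffOp _ (xOp k m b) * localOp k i t + 1 := by
  have hab := val_add_one_eq_of_bos ha hb
  rw [localOp_bos_bos k ha hb, ← hab, ← map_mul, ddOp_mul_xOp (by omega), map_add, map_mul,
    map_one]

end LocalOp

section BlockOp

variable {k : Type*} [Field k] {M : Type*} [AddCommMonoid M] [Module k M] {ι κ : Type*}

/-- The operator that acts from the `i`-th to the `j`-th summand of `⨁_ι (κ →₀ M)` as the given one,
and as zero on the other summands. -/
def blockOp (j i : ι) : Module.End k (κ →₀ M) →ₗ[k] Module.End k (ι × κ →₀ M) :=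
  (LinearMap.llcomp k _ _ _ (Finsupp.lmapDomain M k (Prod.mk j))) ∘ₗ
    LinearMap.lcomp k _ (Finsupp.lcomapDomain (Prod.mk i) (Prod.mk_right_injective i))

theorem blockOp_apply (j i : ι) (A : Module.End k (κ →₀ M)) (v : ι × κ →₀ M) :
    blockOp j i A v = (A (v.comapDomain (Prod.mk i) (Prod.mk_right_injective i).injOn)).mapDomain
      (Prod.mk j) := rfl

theorem blockOp_single (j i : ι) {A : Module.End k (κ →₀ M)} {w w' : κ} {x y : M}
    (h : A (Finsupp.single w x) = Finsupp.single w' y) :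
    blockOp j i A (Finsupp.single (i, w) x) = Finsupp.single (j, w') y := by
  rw [blockOp_apply, Finsupp.comapDomain_single, h, Finsupp.mapDomain_single]

theorem blockOp_single_of_ne {i i' : ι} (h : i' ≠ i) (j : ι) (A : Module.End k (κ →₀ M)) (w : κ)
    (x : M) : blockOp j i A (Finsupp.single (i', w) x) = 0 := by
  rw [blockOp_apply, Finsupp.comapDomain_single_of_not_mem_range (by simp [h.symm]), map_zero,
    Finsupp.mapDomain_zero]

theorem blockOp_mul_blockOp (l j i : ι) (B A : Module.End k (κ →₀ M)) :
    blockOp l j B * blockOp j i A = blockOp l i (B * A) := by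
  refine LinearMap.ext fun v => ?_
  simp only [Module.End.mul_apply, blockOp_apply,
    Finsupp.comapDomain_mapDomain _ (Prod.mk_right_injective j)]

theorem blockOp_mul_blockOp_of_ne {j j' : ι} (h : j ≠ j') (l i : ι) (B A : Module.End k (κ →₀ M)) :
    blockOp l j' B * blockOp j i A = 0 := by
  refine LinearMap.ext fun v => ?_
  have hzero (u : κ →₀ M) : (u.mapDomain (Prod.mk j)).comapDomain (Prod.mk j')
      (Prod.mk_right_injective j').injOn = 0 := by
    ext w
    exact Finsupp.mapDomain_of_notMem_range _ _ (by simp [h])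
  rw [Module.End.mul_apply, blockOp_apply, blockOp_apply, hzero, map_zero, Finsupp.mapDomain_zero,
    LinearMap.zero_apply]

theorem sum_blockOp_one [Fintype ι] :
    ∑ i : ι, blockOp i i (1 : Module.End k (κ →₀ M)) = 1 := by
  refine Finsupp.lhom_ext fun ⟨i, w⟩ x => ?_
  rw [LinearMap.sum_apply, Finset.sum_eq_single_of_mem i (Finset.mem_univ i)
    fun j _ hj => blockOp_single_of_ne hj.symm j 1 w x]
  exact blockOp_single i i rfl

theorem blockOp_neg {M : Type*} [AddCommGroup M] [Module k M] (j i : ι)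
    (A : Module.End k (κ →₀ M)) : blockOp j i (-A) = -blockOp j i A :=
  map_neg (blockOp j i) A

end BlockOp

section Representation

variable (k : Type*) [Field k] {n m : ℕ}

/-- The action of the generating diagrams on `Pol`. -/
def genOp : Gen n m → Module.End k (Pol k n m)
  | .idem i => blockOp i i 1
  | .dot i a => blockOp i i (coeffOp _ (xOp k m a))
  | .cross i t => blockOp (i.sw t) i (localOp k i t)

variable {k}

theorem genOp_rel {x y : FreeAlgebra k (Gen n m)} (h : Rel k n m x y) :
    FreeAlgebra.lift k (genOp k) x = FreeAlgebra.lift k (genOp k) y := by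
  cases h <;> simp only [map_mul, map_add, map_sub, map_neg, map_zero, map_one, map_sum,
    FreeAlgebra.lift_ι_apply, genOp, blockOp_mul_blockOp, mul_one, one_mul]
  case idem_mul_ne i j h => exact blockOp_mul_blockOp_of_ne h.symm i j 1 1
  case sum_idem => exact sum_blockOp_one
  case far_odd i t u h ht hu =>
    rw [localOp_far_odd i h ht hu, Labels.sw_comm i h, blockOp_neg]
  case far_even i t u h hb => rw [localOp_far_even i h hb, Labels.sw_comm i h]
  case dot_far i t a h₁ h₂ => rw [coeffOp_xOp_mul_localOp fun _ _ => ⟨h₁, h₂⟩]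
  case dot_dot i a b => rw [← map_mul, xOp_comm, map_mul]
  case dot_mixed i t a hm ha =>
    rw [coeffOp_xOp_mul_localOp fun hlo hhi => absurd (hlo.trans hhi.symm) hm]
  case nil_top i t a b ha hb =>
    have hsw := Labels.sw_eq_self ((bos_eq_iff.1 ha).1.trans (bos_eq_iff.1 hb).1.symm)
    rw [hsw, blockOp_mul_blockOp, localOp_nil_top ha hb, map_add]
    exact add_sub_cancel_left (G := Module.End k (Pol k n m)) _ _
  case nil_bot i t a b ha hb =>
    have hsw := Labels.sw_eq_self ((bos_eq_iff.1 ha).1.trans (bos_eq_iff.1 hb).1.symm)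
    rw [hsw, blockOp_mul_blockOp, localOp_nil_bot ha hb, map_add]
    exact add_sub_cancel_left (G := Module.End k (Pol k n m)) _ _
  case double_same i t h => rw [localOp_double_same i h, map_zero]
  case double_mixed i t a hm ha =>
    rw [localOp_double_mixed i hm, labelCount_eq_of_mixed hm ha, Labels.sw_sw]
  case triple i t u h hb => rw [localOp_triple i h hb, Labels.sw_braid i h]
  case triple_even_odd_even i t u h hb =>
    rw [localOp_triple_even_odd_even i h hb, map_add, Labels.sw_braid i h,
      Labels.sw_sw_sw_eq_self i h (hb.1.trans hb.2.2.symm)]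

/-- The representation of `R(n,m)` on `Pol`. -/
def polRep (k : Type*) [Field k] (n m : ℕ) : RAlg k n m →ₐ[k] Module.End k (Pol k n m) :=
  RingQuot.liftAlgHom k ⟨FreeAlgebra.lift k (genOp k), fun _ _ => genOp_rel⟩

theorem polRep_mkAlgHom_ι (g : Gen n m) :
    polRep k n m (RingQuot.mkAlgHom k (Rel k n m) (FreeAlgebra.ι k g)) = genOp k g := by
  rw [polRep, RingQuot.liftAlgHom_mkAlgHom_apply, FreeAlgebra.lift_ι_apply]

theorem isPolAction_polRep : IsPolAction (polRep k n m) where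
  idem_self i w f := by
    rw [idem, polRep_mkAlgHom_ι, genOp, blockOp_single i i rfl]
  idem_ne i j w f h := by
    rw [idem, polRep_mkAlgHom_ι, genOp, blockOp_single_of_ne h]
  dot_self i a w f := by
    rw [dot, polRep_mkAlgHom_ι, genOp, blockOp_single i i (coeffOp_single _ w f), xOp_apply]
  dot_ne i j a w f h := by
    rw [dot, polRep_mkAlgHom_ι, genOp, blockOp_single_of_ne h]
  cross_ne i j t w f h := by
    rw [cross, polRep_mkAlgHom_ι, genOp, blockOp_single_of_ne h]
  cross_bos_bos i t a b w f ha hb := by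
    rw [cross, polRep_mkAlgHom_ι, genOp, localOp_bos_bos k ha hb,
      blockOp_single _ i (coeffOp_single _ w f), ddOp_apply (val_add_one_eq_of_bos ha hb),
      Labels.sw_eq_self ((bos_eq_iff.1 ha).1.trans (bos_eq_iff.1 hb).1.symm)]
  cross_ferm_bos i t w f hlo hhi := by
    rw [cross, polRep_mkAlgHom_ι, genOp, localOp_ferm_bos k hlo hhi, blockOp_single _ i rfl]
  cross_bos_ferm i t a w f ha h := by
    rw [cross, polRep_mkAlgHom_ι, genOp, localOp_bos_ferm k ha h,
      blockOp_single _ i (coeffOp_single _ w f), xOp_apply]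
  cross_ferm_ferm_up i t a w f hlo hhi hlen := by
    have hsigma : sigmaOp k (MvPolynomial (Fin m) k) a (Finsupp.single w f) =
        Finsupp.single (simple a * w) (eps k w a • f) := by
      rw [sigmaOp_single, eps_eq_fermCoef k (isAscent_iff_len.2 hlen), Int.cast_smul_eq_zsmul,
        Finsupp.smul_single]
    rw [cross, polRep_mkAlgHom_ι, genOp, localOp_ferm_ferm k hlo hhi, blockOp_single _ i hsigma,
      Labels.sw_eq_self ((ferm_eq_iff.1 hlo).1.trans (ferm_eq_iff.1 hhi).1.symm)]
  cross_ferm_ferm_down i t a w f hlo hhi hlen := by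
    have hdescent : ¬ IsAscent a w := fun h => by
      have := isAscent_iff_len.1 h
      omega
    rw [cross, polRep_mkAlgHom_ι, genOp, localOp_ferm_ferm k hlo hhi, blockOp_apply,
      Finsupp.comapDomain_single, sigmaOp_single, fermCoef_of_not_isAscent hdescent, zero_smul,
      Finsupp.mapDomain_zero]

end Representation

section Relations

variable {k : Type*} [Field k] {n m : ℕ}

theorem idem_mul_self (i : Labels n m) : idem k i * idem k i = idem k i := by
  simpa only [idem, map_mul] using RingQuot.mkAlgHom_rel k (Rel.idem_mul_self (k := k) i)

theorem idem_mul_idem_of_ne {i j : Labels n m} (h : i ≠ j) : idem k i * idem k j = 0 := by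
  simpa only [idem, map_mul, map_zero] using
    RingQuot.mkAlgHom_rel k (Rel.idem_mul_ne (k := k) i j h)

theorem sum_idem : ∑ i : Labels n m, idem k i = 1 := by
  simpa only [idem, map_sum, map_one] using RingQuot.mkAlgHom_rel k (Rel.sum_idem (k := k))

theorem idem_mul_dot (i : Labels n m) (a : Fin m) : idem k i * dot k i a = dot k i a := by
  simpa only [idem, dot, map_mul] using RingQuot.mkAlgHom_rel k (Rel.idem_dot (k := k) i a)

theorem dot_mul_idem (i : Labels n m) (a : Fin m) : dot k i a * idem k i = dot k i a := by
  simpa only [idem, dot, map_mul] using RingQuot.mkAlgHom_rel k (Rel.dot_idem (k := k) i a)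

theorem idem_mul_cross (i : Labels n m) (t : Fin (n + m - 1)) :
    idem k (i.sw t) * cross k i t = cross k i t := by
  simpa only [idem, cross, map_mul] using RingQuot.mkAlgHom_rel k (Rel.idem_cross (k := k) i t)

theorem cross_mul_idem (i : Labels n m) (t : Fin (n + m - 1)) :
    cross k i t * idem k i = cross k i t := by
  simpa only [idem, cross, map_mul] using RingQuot.mkAlgHom_rel k (Rel.cross_idem (k := k) i t)

theorem idem_mul_dot_of_ne {i j : Labels n m} (h : i ≠ j) (a : Fin m) :
    idem k i * dot k j a = 0 := by
  rw [← idem_mul_dot, ← mul_assoc, idem_mul_idem_of_ne h, zero_mul]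

theorem dot_mul_idem_of_ne {i j : Labels n m} (h : i ≠ j) (a : Fin m) :
    dot k i a * idem k j = 0 := by
  rw [← dot_mul_idem, mul_assoc, idem_mul_idem_of_ne h, mul_zero]

theorem idem_mul_dotSum (i : Labels n m) (a : Fin m) : idem k i * dotSum k n a = dot k i a := by
  rw [dotSum, Finset.mul_sum, Finset.sum_eq_single_of_mem i (Finset.mem_univ i)
    fun j _ h => idem_mul_dot_of_ne h.symm a, idem_mul_dot]

theorem dotSum_mul_idem (i : Labels n m) (a : Fin m) : dotSum k n a * idem k i = dot k i a := by
  rw [dotSum, Finset.sum_mul, Finset.sum_eq_single_of_mem i (Finset.mem_univ i)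
    fun j _ h => dot_mul_idem_of_ne h a, dot_mul_idem]

theorem dotSum_mul_cross (i : Labels n m) (t : Fin (n + m - 1)) (a : Fin m) :
    dotSum k n a * cross k i t = dot k (i.sw t) a * cross k i t := by
  rw [← idem_mul_cross, ← mul_assoc, dotSum_mul_idem, ← mul_assoc, dot_mul_idem]

theorem cross_mul_dotSum (i : Labels n m) (t : Fin (n + m - 1)) (a : Fin m) :
    cross k i t * dotSum k n a = cross k i t * dot k i a := by
  rw [← cross_mul_idem, mul_assoc, idem_mul_dotSum, mul_assoc, idem_mul_dot]

theorem commute_polyDots {x : RAlg k n m} (h : ∀ a, Commute (dotSum k n a) x)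
    (p : MvPolynomial (Fin m) k) : Commute (polyDots k n m p) x := by
  induction p using MvPolynomial.induction_on with
  | C c => exact (polyDots k n m).commutes c ▸ Algebra.commutes c x
  | add p q hp hq => exact map_add (polyDots k n m) p q ▸ hp.add_left hq
  | mul_X p a hp =>
    rw [map_mul, polyDots_X]
    exact hp.mul_left (h a)

theorem commute_polyDots_idem (p : MvPolynomial (Fin m) k) (i : Labels n m) :
    Commute (polyDots k n m p) (idem k i) :=
  commute_polyDots (fun a => (dotSum_mul_idem i a).trans (idem_mul_dotSum i a).symm) p

theorem commute_dotSum_cross_of_ne {i : Labels n m} {t : Fin (n + m - 1)} {a : Fin m}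
    (hlo : bos i a ≠ lo t) (hhi : bos i a ≠ hi t) : Commute (dotSum k n a) (cross k i t) := by
  rw [Commute, SemiconjBy, dotSum_mul_cross, cross_mul_dotSum]
  simpa only [dot, cross, map_mul] using
    RingQuot.mkAlgHom_rel k (Rel.dot_far (k := k) i t a hlo hhi)

theorem commute_dotSum_cross_of_mixed {i : Labels n m} {t : Fin (n + m - 1)} {a : Fin m}
    (hm : i.1 (lo t) ≠ i.1 (hi t)) (ha : bos i a = lo t ∨ bos i a = hi t) :
    Commute (dotSum k n a) (cross k i t) := by
  rw [Commute, SemiconjBy, dotSum_mul_cross, cross_mul_dotSum]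
  simpa only [dot, cross, map_mul] using
    RingQuot.mkAlgHom_rel k (Rel.dot_mixed (k := k) i t a hm ha)

theorem commute_polyDots_cross {i : Labels n m} {t : Fin (n + m - 1)}
    (h : ¬ (i.1 (lo t) = true ∧ i.1 (hi t) = true)) (p : MvPolynomial (Fin m) k) :
    Commute (polyDots k n m p) (cross k i t) := by
  refine commute_polyDots (fun a => ?_) p
  by_cases ha : bos i a = lo t ∨ bos i a = hi t
  · refine commute_dotSum_cross_of_mixed (fun hlabel => h ?_) ha
    obtain ha | ha := ha
    · exact ⟨(bos_eq_iff.1 ha).1, hlabel ▸ (bos_eq_iff.1 ha).1⟩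
    · exact ⟨hlabel.trans (bos_eq_iff.1 ha).1, (bos_eq_iff.1 ha).1⟩
  · rw [not_or] at ha
    exact commute_dotSum_cross_of_ne ha.1 ha.2

section BosonicCrossing

variable {i : Labels n m} {t : Fin (n + m - 1)} {a b : Fin m}

theorem ne_of_bos (ha : bos i a = lo t) (hb : bos i b = hi t) : a ≠ b :=
  fun hab => lo_ne_hi t (by rw [← ha, ← hb, hab])

theorem dotSum_mul_cross_bos (ha : bos i a = lo t) (hb : bos i b = hi t) :
    dotSum k n a * cross k i t = idem k i + cross k i t * dotSum k n b := by
  rw [dotSum_mul_cross, cross_mul_dotSum, sw_eq_self_of_bos ha hb]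
  have hrel := RingQuot.mkAlgHom_rel k (Rel.nil_top (k := k) i t a b ha hb)
  simp only [map_sub, map_mul] at hrel
  exact sub_eq_iff_eq_add.1 hrel

theorem cross_mul_dotSum_bos_left (ha : bos i a = lo t) (hb : bos i b = hi t) :
    cross k i t * dotSum k n a = idem k i + dotSum k n b * cross k i t := by
  rw [dotSum_mul_cross, cross_mul_dotSum, sw_eq_self_of_bos ha hb]
  have hrel := RingQuot.mkAlgHom_rel k (Rel.nil_bot (k := k) i t a b ha hb)
  simp only [map_sub, map_mul] at hrel
  exact sub_eq_iff_eq_add.1 hrel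

theorem cross_mul_dotSum_bos (ha : bos i a = lo t) (hb : bos i b = hi t) (c : Fin m) :
    cross k i t * dotSum k n c = dotSum k n (Equiv.swap a b c) * cross k i t +
      polyDots k n m (divDiff k a b (X c)) * idem k i := by
  have hab := ne_of_bos ha hb
  obtain rfl | hca := eq_or_ne c a
  · rw [Equiv.swap_apply_left, divDiff_X_left hab, map_one, one_mul, add_comm,
      cross_mul_dotSum_bos_left ha hb]
  obtain rfl | hcb := eq_or_ne c b
  · have hcancel : polyDots k n m (-1) * idem k i + idem k i = 0 := by
      rw [← add_one_mul, ← map_one (polyDots k n m), ← map_add, neg_add_cancel, map_zero, zero_mul]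
    rw [Equiv.swap_apply_right, divDiff_X_right hab, dotSum_mul_cross_bos ha hb, add_right_comm,
      add_comm (idem k i), hcancel, zero_add]
  have hfix : Equiv.swap a b c = c := Equiv.swap_apply_of_ne_of_ne hca hcb
  have hbos {d : Fin m} (hcd : c ≠ d) : bos i c ≠ bos i d := (bos_strictMono i).injective.ne hcd
  rw [hfix, divDiff_of_symm hab (by rw [rename_X, hfix]), map_zero, zero_mul, add_zero]
  exact (commute_dotSum_cross_of_ne (ha ▸ hbos hca) (hb ▸ hbos hcb)).eq.symm

theorem cross_mul_polyDots_bos (ha : bos i a = lo t) (hb : bos i b = hi t)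
    (p : MvPolynomial (Fin m) k) :
    cross k i t * polyDots k n m p =
      polyDots k n m (rename (Equiv.swap a b) p) * cross k i t +
        polyDots k n m (divDiff k a b p) * idem k i := by
  have hab := ne_of_bos ha hb
  induction p using MvPolynomial.induction_on with
  | C c =>
    rw [rename_C, divDiff_of_symm hab (rename_C _ _), map_zero, zero_mul, add_zero,
      ← algebraMap_eq, AlgHom.commutes, Algebra.commutes]
  | add p q hp hq =>
    have hadd : divDiff k a b (p + q) = divDiff k a b p + divDiff k a b q :=
      map_add (divDiffₗ k a b hab) p q
    simp only [hadd, map_add, mul_add, add_mul, hp, hq]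
    abel
  | mul_X p c hp =>
    rw [divDiff_mul hab]
    simp only [map_mul, map_add]
    rw [← mul_assoc, hp, add_mul, mul_assoc, mul_assoc, polyDots_X, cross_mul_dotSum_bos ha hb,
      idem_mul_dotSum, mul_add, rename_X, polyDots_X, ← dotSum_mul_idem]
    simp only [mul_assoc, add_mul]
    abel

end BosonicCrossing

theorem exists_cross_mul_polyDots (i : Labels n m) (t : Fin (n + m - 1))
    (p : MvPolynomial (Fin m) k) : ∃ p' p'' : MvPolynomial (Fin m) k,
      cross k i t * polyDots k n m p = polyDots k n m p' * cross k i t +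
        polyDots k n m p'' * idem k i := by
  by_cases h : i.1 (lo t) = true ∧ i.1 (hi t) = true
  · obtain ⟨a, ha⟩ := exists_bos h.1
    obtain ⟨b, hb⟩ := exists_bos h.2
    exact ⟨_, _, cross_mul_polyDots_bos ha hb p⟩
  · exact ⟨p, 0, by rw [(commute_polyDots_cross h p).eq, map_zero, zero_mul, add_zero]⟩

theorem exists_cross_mul_cross_far (i : Labels n m) {t u : Fin (n + m - 1)}
    (h : (t : ℕ) + 1 < u) : ∃ ε : ℤˣ,
      cross k (i.sw u) t * cross k i u = (ε : ℤ) • (cross k (i.sw t) u * cross k i t) := by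
  by_cases hb : (i.1 (lo t) = false ∧ i.1 (hi t) = false) ∧
      (i.1 (lo u) = false ∧ i.1 (hi u) = false)
  · have hrel := RingQuot.mkAlgHom_rel k (Rel.far_odd (k := k) i t u h hb.1 hb.2)
    simp only [map_mul, map_neg] at hrel
    refine ⟨-1, ?_⟩
    rw [Units.val_neg, Units.val_one, neg_one_smul]
    exact (neg_eq_iff_eq_neg.2 hrel).symm
  · have hrel := RingQuot.mkAlgHom_rel k (Rel.far_even (k := k) i t u h hb)
    simp only [map_mul] at hrel
    exact ⟨1, hrel.symm.trans (one_smul ℤ _).symm⟩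

theorem exists_bos_of_mixed {i : Labels n m} {t : Fin (n + m - 1)}
    (h : i.1 (lo t) ≠ i.1 (hi t)) : ∃ a, bos i a = lo t ∨ bos i a = hi t := by
  obtain hlo | hlo := Bool.eq_false_or_eq_true (i.1 (lo t))
  · exact (exists_bos hlo).imp fun _ => Or.inl
  · exact (exists_bos (Bool.eq_true_of_not_eq_false fun hhi => h (hlo.trans hhi.symm))).imp
      fun _ => Or.inr

theorem exists_cross_mul_cross_self (i : Labels n m) (t : Fin (n + m - 1)) :
    ∃ p : MvPolynomial (Fin m) k,
      cross k (i.sw t) t * cross k i t = polyDots k n m p * idem k i := by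
  by_cases h : i.1 (lo t) = i.1 (hi t)
  · have hrel := RingQuot.mkAlgHom_rel k (Rel.double_same (k := k) i t h)
    simp only [map_mul, map_zero] at hrel
    exact ⟨0, by rw [map_zero, zero_mul]; exact hrel⟩
  · obtain ⟨a, ha⟩ := exists_bos_of_mixed h
    have hrel := RingQuot.mkAlgHom_rel k (Rel.double_mixed (k := k) i t a h ha)
    simp only [map_mul] at hrel
    exact ⟨X a, by rw [polyDots_X, dotSum_mul_idem]; exact hrel⟩

theorem exists_cross_braid (i : Labels n m) {t u : Fin (n + m - 1)} (h : (t : ℕ) + 1 = u) :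
    ∃ c : k, cross k ((i.sw t).sw u) t * cross k (i.sw t) u * cross k i t =
      cross k ((i.sw u).sw t) u * cross k (i.sw u) t * cross k i u + c • idem k i := by
  by_cases hb : i.1 (lo t) = true ∧ i.1 (hi t) = false ∧ i.1 (hi u) = true
  · have hrel := RingQuot.mkAlgHom_rel k (Rel.triple_even_odd_even (k := k) i t u h hb)
    simp only [map_mul, map_add] at hrel
    exact ⟨1, by rw [one_smul]; exact hrel⟩
  · have hrel := RingQuot.mkAlgHom_rel k (Rel.triple (k := k) i t u h hb)
    simp only [map_mul] at hrel
    exact ⟨0, by rw [zero_smul, add_zero]; exact hrel⟩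

end Relations

section Spanning

variable {k : Type*} [Field k] {n m : ℕ}

/-- `R(n,m)` as a left module over the polynomials in dots. It is only a local instance, because
`R(n,m)` is not an algebra over them. -/
abbrev polyModule (k : Type*) [Field k] (n m : ℕ) :
    Module (MvPolynomial (Fin m) k) (RAlg k n m) :=
  Module.compHom _ (polyDots k n m).toRingHom

attribute [local instance] polyModule

theorem poly_smul_def (p : MvPolynomial (Fin m) k) (x : RAlg k n m) :
    p • x = polyDots k n m p * x := rfl

theorem C_smul (c : k) (x : RAlg k n m) : (C c : MvPolynomial (Fin m) k) • x = c • x := by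
  rw [poly_smul_def, ← algebraMap_eq, AlgHom.commutes, Algebra.smul_def]

theorem idem_mul_wordDiagram (i : Labels n m) (l : List (Fin (n + m - 1))) :
    idem k (topLabels i l) * wordDiagram k i l = wordDiagram k i l := by
  cases l with
  | nil => exact idem_mul_self i
  | cons t l => rw [wordDiagram, topLabels, ← mul_assoc, idem_mul_cross]

theorem idem_mul_wordDiagram_of_ne {i j : Labels n m} {l : List (Fin (n + m - 1))}
    (h : j ≠ topLabels i l) : idem k j * wordDiagram k i l = 0 := by
  rw [← idem_mul_wordDiagram, ← mul_assoc, idem_mul_idem_of_ne h, zero_mul]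

theorem cross_mul_wordDiagram_of_ne {i j : Labels n m} {l : List (Fin (n + m - 1))}
    (t : Fin (n + m - 1)) (h : j ≠ topLabels i l) : cross k j t * wordDiagram k i l = 0 := by
  rw [← cross_mul_idem, mul_assoc, idem_mul_wordDiagram_of_ne h, mul_zero]

variable (k) in
/-- The span, over the polynomials in dots, of the diagrams with fewer than `d` crossings. -/
def lowSpan (n m d : ℕ) : Submodule (MvPolynomial (Fin m) k) (RAlg k n m) :=
  Submodule.span _ {x | ∃ i l, l.length < d ∧ x = wordDiagram k i l}

theorem wordDiagram_mem_lowSpan (i : Labels n m) {l : List (Fin (n + m - 1))} {d : ℕ}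
    (h : l.length < d) : wordDiagram k i l ∈ lowSpan k n m d :=
  Submodule.subset_span ⟨i, l, h, rfl⟩

theorem lowSpan_mono {d d' : ℕ} (h : d ≤ d') : lowSpan k n m d ≤ lowSpan k n m d' :=
  Submodule.span_mono fun _ ⟨i, l, hl, hx⟩ => ⟨i, l, hl.trans_le h, hx⟩

theorem smul_mem_lowSpan (c : k) {x : RAlg k n m} {d : ℕ} (h : x ∈ lowSpan k n m d) :
    c • x ∈ lowSpan k n m d :=
  C_smul c x ▸ Submodule.smul_mem _ _ h

theorem idem_mul_mem_lowSpan (i : Labels n m) {x : RAlg k n m} {d : ℕ}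
    (h : x ∈ lowSpan k n m d) : idem k i * x ∈ lowSpan k n m d := by
  induction h using Submodule.span_induction with
  | mem x hx =>
    obtain ⟨j, l, hl, rfl⟩ := hx
    obtain rfl | h := eq_or_ne i (topLabels j l)
    · rw [idem_mul_wordDiagram]
      exact wordDiagram_mem_lowSpan j hl
    · rw [idem_mul_wordDiagram_of_ne h]
      exact zero_mem _
  | zero => rw [mul_zero]; exact zero_mem _
  | add x y _ _ hx hy => rw [mul_add]; exact add_mem hx hy
  | smul p x _ hx =>
    rw [poly_smul_def, ← mul_assoc, ← (commute_polyDots_idem p i).eq, mul_assoc]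
    exact Submodule.smul_mem _ p hx

theorem cross_mul_mem_lowSpan (i : Labels n m) (t : Fin (n + m - 1)) {x : RAlg k n m} {d : ℕ}
    (h : x ∈ lowSpan k n m d) : cross k i t * x ∈ lowSpan k n m (d + 1) := by
  induction h using Submodule.span_induction with
  | mem x hx =>
    obtain ⟨j, l, hl, rfl⟩ := hx
    obtain rfl | h := eq_or_ne i (topLabels j l)
    · exact wordDiagram_mem_lowSpan j (l := t :: l) (Nat.succ_lt_succ hl)
    · rw [cross_mul_wordDiagram_of_ne t h]
      exact zero_mem _
  | zero => rw [mul_zero]; exact zero_mem _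
  | add x y _ _ hx hy => rw [mul_add]; exact add_mem hx hy
  | smul p x hx' hx =>
    obtain ⟨p', p'', hp⟩ := exists_cross_mul_polyDots i t p
    rw [poly_smul_def, ← mul_assoc, hp, add_mul, mul_assoc, mul_assoc]
    exact add_mem (Submodule.smul_mem _ p' hx) (Submodule.smul_mem _ p''
      (idem_mul_mem_lowSpan i (lowSpan_mono (Nat.le_succ d) hx')))

theorem BraidEquiv.exists_wordDiagram_sub_mem {l l' : List (Fin (n + m - 1))}
    (h : BraidEquiv l l') (i : Labels n m) : ∃ ε : ℤˣ,
      wordDiagram k i l - (ε : ℤ) • wordDiagram k i l' ∈ lowSpan k n m l.length := by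
  induction h with
  | refl l => exact ⟨1, by simp only [Units.val_one, one_smul, sub_self, zero_mem]⟩
  | @symm l l' h ih =>
    obtain ⟨ε, hε⟩ := ih
    refine ⟨ε, ?_⟩
    rw [← h.length_eq, ← neg_mem_iff, neg_sub]
    have hunit : (ε : ℤ) * ε = 1 := by rw [← Units.val_mul, Int.units_mul_self, Units.val_one]
    convert zsmul_mem hε (ε : ℤ) using 1
    rw [zsmul_sub, ← mul_zsmul, hunit, one_zsmul]
  | trans h _ ih ih' =>
    obtain ⟨ε, hε⟩ := ih
    obtain ⟨ε', hε'⟩ := ih'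
    refine ⟨ε * ε', ?_⟩
    convert add_mem hε (zsmul_mem (h.length_eq ▸ hε') (ε : ℤ)) using 1
    rw [zsmul_sub, ← mul_zsmul, sub_add_sub_cancel, Units.val_mul]
  | cons a h ih =>
    obtain ⟨ε, hε⟩ := ih
    refine ⟨ε, ?_⟩
    rw [wordDiagram, wordDiagram, ← topLabels_congr i h.wordPerm_eq, ← mul_smul_comm, ← mul_sub]
    exact cross_mul_mem_lowSpan _ a hε
  | @comm a b h l =>
    obtain ⟨ε, hε⟩ := exists_cross_mul_cross_far (k := k) (topLabels i l) h
    refine ⟨ε, ?_⟩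
    simp only [wordDiagram, topLabels, ← mul_assoc]
    rw [hε, smul_mul_assoc, sub_self]
    exact zero_mem _
  | @braid a b h l =>
    obtain ⟨c, hc⟩ := exists_cross_braid (k := k) (topLabels i l) h
    refine ⟨1, ?_⟩
    simp only [wordDiagram, topLabels, ← mul_assoc]
    rw [hc, Units.val_one, one_smul, add_mul, add_sub_cancel_left, smul_mul_assoc,
      idem_mul_wordDiagram]
    exact smul_mem_lowSpan c (wordDiagram_mem_lowSpan i (by simp only [List.length_cons]; omega))

theorem wordDiagram_mem_lowSpan_of_not_isAscent {a : Fin (n + m - 1)}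
    {l : List (Fin (n + m - 1))} (hl : IsReducedWord l (wordPerm l))
    (ha : ¬ IsAscent a (wordPerm l)) (i : Labels n m) :
    wordDiagram k i (a :: l) ∈ lowSpan k n m (a :: l).length := by
  obtain ⟨u, hu⟩ := exists_reducedWord (simple a * wordPerm l)
  have hau : IsReducedWord (a :: u) (wordPerm l) := isReducedWord_cons.2 ⟨ha, hu⟩
  obtain ⟨ε, hε⟩ := (hl.braidEquiv hau).exists_wordDiagram_sub_mem (k := k) i
  have hlow := cross_mul_mem_lowSpan (topLabels i l) a hε
  have htop : cross k (topLabels i l) a * wordDiagram k i (a :: u) ∈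
      lowSpan k n m (a :: l).length := by
    obtain ⟨p, hp⟩ := exists_cross_mul_cross_self (k := k) (topLabels i u) a
    rw [topLabels_congr i hau.1.symm, wordDiagram, topLabels, ← mul_assoc, hp, mul_assoc,
      idem_mul_wordDiagram]
    refine Submodule.smul_mem _ p (wordDiagram_mem_lowSpan i ?_)
    have := (hl.braidEquiv hau).length_eq
    simp only [List.length_cons] at this ⊢
    omega
  rw [mul_sub, mul_smul_comm] at hlow
  exact (Submodule.sub_mem_iff_left _ (zsmul_mem htop _)).1 hlow

theorem wordDiagram_mem_lowSpan_of_not_isReducedWord {l : List (Fin (n + m - 1))}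
    (h : ¬ IsReducedWord l (wordPerm l)) (i : Labels n m) :
    wordDiagram k i l ∈ lowSpan k n m l.length := by
  induction l with
  | nil => exact absurd isReducedWord_nil h
  | cons a l ih =>
    by_cases hl : IsReducedWord l (wordPerm l)
    · exact wordDiagram_mem_lowSpan_of_not_isAscent hl
        (fun ha => h (isReducedWord_cons_wordPerm.2 ⟨ha, hl⟩)) i
    · exact cross_mul_mem_lowSpan _ a (ih hl)

theorem exists_gen_mul_mem_lowSpan (g : Gen n m) {x : RAlg k n m} {d : ℕ}
    (h : x ∈ lowSpan k n m d) :
    ∃ d', RingQuot.mkAlgHom k (Rel k n m) (FreeAlgebra.ι k g) * x ∈ lowSpan k n m d' := by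
  cases g with
  | idem i => exact ⟨d, idem_mul_mem_lowSpan i h⟩
  | dot i a =>
    refine ⟨d, ?_⟩
    change dot k i a * x ∈ _
    rw [← dotSum_mul_idem, mul_assoc, ← polyDots_X]
    exact Submodule.smul_mem _ (X a) (idem_mul_mem_lowSpan i h)
  | cross i t => exact ⟨d + 1, cross_mul_mem_lowSpan i t h⟩

theorem exists_mul_mem_lowSpan (y : RAlg k n m) {x : RAlg k n m} {d : ℕ}
    (h : x ∈ lowSpan k n m d) : ∃ d', y * x ∈ lowSpan k n m d' := by
  obtain ⟨y, rfl⟩ := RingQuot.mkAlgHom_surjective k (Rel k n m) y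
  induction y generalizing x d with
  | grade0 c =>
    rw [AlgHom.commutes, ← Algebra.smul_def]
    exact ⟨d, smul_mem_lowSpan c h⟩
  | grade1 g => exact exists_gen_mul_mem_lowSpan g h
  | mul y z hy hz =>
    obtain ⟨_, hzx⟩ := hz h
    rw [map_mul, mul_assoc]
    exact hy hzx
  | add y z hy hz =>
    obtain ⟨d', hd'⟩ := hy h
    obtain ⟨d'', hd''⟩ := hz h
    rw [map_add, add_mul]
    exact ⟨max d' d'', add_mem (lowSpan_mono (le_max_left _ _) hd')
      (lowSpan_mono (le_max_right _ _) hd'')⟩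

theorem exists_mem_lowSpan (x : RAlg k n m) : ∃ d, x ∈ lowSpan k n m d := by
  have hone : (1 : RAlg k n m) ∈ lowSpan k n m 1 :=
    sum_idem (k := k) ▸ sum_mem fun i _ => wordDiagram_mem_lowSpan i (l := []) Nat.one_pos
  simpa only [mul_one] using exists_mul_mem_lowSpan x hone

theorem lowSpan_le_span_wordDiagram {word : Equiv.Perm (Fin (n + m)) → List (Fin (n + m - 1))}
    (hword : ∀ w, IsReducedWord (word w) w) (d : ℕ) :
    lowSpan k n m d ≤ Submodule.span (MvPolynomial (Fin m) k)
      (Set.range fun x : Labels n m × Equiv.Perm (Fin (n + m)) =>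
        wordDiagram k x.1 (word x.2)) := by
  induction d with
  | zero =>
    refine Submodule.span_le.2 ?_
    rintro _ ⟨i, l, hl, rfl⟩
    exact absurd hl (Nat.not_lt_zero _)
  | succ d ih =>
    refine Submodule.span_le.2 ?_
    rintro _ ⟨i, l, hl, rfl⟩
    replace ih := (lowSpan_mono (Nat.lt_succ_iff.1 hl)).trans ih
    by_cases hr : IsReducedWord l (wordPerm l)
    · obtain ⟨ε, hε⟩ := (hr.braidEquiv (hword _)).exists_wordDiagram_sub_mem (k := k) i
      have hmem := Submodule.subset_span (R := MvPolynomial (Fin m) k) <| Set.mem_range_self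
        (f := fun x : Labels n m × Equiv.Perm (Fin (n + m)) => wordDiagram k x.1 (word x.2))
        (i, wordPerm l)
      exact (Submodule.sub_mem_iff_left _ (zsmul_mem hmem _)).1 (ih hε)
    · exact ih (wordDiagram_mem_lowSpan_of_not_isReducedWord hr i)

theorem span_wordDiagram {word : Equiv.Perm (Fin (n + m)) → List (Fin (n + m - 1))}
    (hword : ∀ w, IsReducedWord (word w) w) :
    Submodule.span (MvPolynomial (Fin m) k)
      (Set.range fun x : Labels n m × Equiv.Perm (Fin (n + m)) =>
        wordDiagram k x.1 (word x.2)) = ⊤ := by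
  refine eq_top_iff.2 fun x _ => ?_
  obtain ⟨d, hx⟩ := exists_mem_lowSpan x
  exact lowSpan_le_span_wordDiagram hword d hx

end Spanning

section Leading

/-- Rational functions in `m` variables: the coefficients with which operators on polynomials are
expanded in permutations of the variables. -/
abbrev RationalFunction (R : Type*) [CommRing R] (m : ℕ) : Type _ :=
  FractionRing (MvPolynomial (Fin m) R)

section Expansion

variable {R : Type*} [CommRing R] {m : ℕ}

/-- `T = ∑ v, c v • v` as operators on polynomials, where `v` permutes the variables. -/
def ExpandsAs (T : MvPolynomial (Fin m) R → MvPolynomial (Fin m) R)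
    (c : Equiv.Perm (Fin m) → RationalFunction R m) : Prop :=
  ∀ f, algebraMap _ (RationalFunction R m) (T f) = ∑ v, c v * algebraMap _ _ (rename v f)

variable {T : MvPolynomial (Fin m) R → MvPolynomial (Fin m) R}
  {c : Equiv.Perm (Fin m) → RationalFunction R m}

theorem ExpandsAs.mul_left (h : ExpandsAs T c) (p : MvPolynomial (Fin m) R) :
    ExpandsAs (fun f => p * T f) fun v => algebraMap _ _ p * c v := fun f => by
  rw [map_mul, h, Finset.mul_sum]
  exact Finset.sum_congr rfl fun v _ => (mul_assoc _ _ _).symm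

variable (R) in
/-- The action of a permutation of the variables on rational functions. -/
def fracRename (e : Equiv.Perm (Fin m)) : RationalFunction R m ≃+* RationalFunction R m :=
  IsFractionRing.ringEquivOfRingEquiv (renameEquiv R e).toRingEquiv

theorem fracRename_algebraMap (e : Equiv.Perm (Fin m)) (f : MvPolynomial (Fin m) R) :
    fracRename R e (algebraMap _ _ f) = algebraMap _ _ (rename e f) :=
  IsFractionRing.ringEquivOfRingEquiv_algebraMap _ f

theorem ExpandsAs.rename (h : ExpandsAs T c) (e : Equiv.Perm (Fin m)) :
    ExpandsAs (fun f => MvPolynomial.rename e (T f)) fun v => fracRename R e (c (e⁻¹ * v)) := by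
  intro f
  rw [← fracRename_algebraMap, h, map_sum, ← Equiv.sum_comp (Equiv.mulLeft e⁻¹)]
  refine Finset.sum_congr rfl fun v _ => ?_
  rw [Equiv.coe_mulLeft, map_mul, fracRename_algebraMap, rename_rename, ← Equiv.Perm.coe_mul,
    mul_inv_cancel_left]

end Expansion

section Domain

variable {R : Type*} [CommRing R] [IsDomain R] {m : ℕ}

theorem linearIndependent_rename :
    LinearIndependent (RationalFunction R m)
      fun (v : Equiv.Perm (Fin m)) (f : MvPolynomial (Fin m) R) =>
        algebraMap _ (RationalFunction R m) (rename v f) := by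
  let φ (v : Equiv.Perm (Fin m)) : MvPolynomial (Fin m) R →* RationalFunction R m :=
    ((algebraMap (MvPolynomial (Fin m) R) (RationalFunction R m)).comp
      (rename v : MvPolynomial (Fin m) R →ₐ[R] _).toRingHom : _ →* _)
  have hφ (v f) : φ v f = algebraMap _ _ (rename v f) := rfl
  have hinj : Function.Injective φ := fun v v' hv => Equiv.ext fun a => by
    have hX := DFunLike.congr_fun hv (X a)
    rw [hφ, hφ, rename_X, rename_X] at hX
    exact X_injective (IsFractionRing.injective _ _ hX)
  exact (linearIndependent_monoidHom (MvPolynomial (Fin m) R) (RationalFunction R m)).comp φ hinj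

/-- The permutation `v` is strictly the longest one in the expansion of the operator `T` in
permutations of the variables. -/
def HasLeading (T : MvPolynomial (Fin m) R → MvPolynomial (Fin m) R)
    (v : Equiv.Perm (Fin m)) : Prop :=
  ∃ c, ExpandsAs T c ∧ c v ≠ 0 ∧ ∀ v', c v' ≠ 0 → v' = v ∨ len v' < len v

theorem hasLeading_id : HasLeading (fun f : MvPolynomial (Fin m) R => f) 1 := by
  classical
  refine ⟨Pi.single 1 1, fun f => ?_, ?_, fun v hv => .inl ?_⟩
  · rw [Finset.sum_eq_single_of_mem 1 (Finset.mem_univ _) fun v _ hv => by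
      rw [Pi.single_eq_of_ne hv, zero_mul], Pi.single_eq_same, one_mul, Equiv.Perm.coe_one,
      rename_id_apply]
  · rw [Pi.single_eq_same]
    exact one_ne_zero
  · by_contra hne
    exact hv (Pi.single_eq_of_ne hne _)

theorem HasLeading.mul_left {T : MvPolynomial (Fin m) R → MvPolynomial (Fin m) R}
    {v : Equiv.Perm (Fin m)} (h : HasLeading T v) {p : MvPolynomial (Fin m) R} (hp : p ≠ 0) :
    HasLeading (fun f => p * T f) v := by
  obtain ⟨c, hT, hc, hlt⟩ := h
  have hp' : algebraMap _ (RationalFunction R m) p ≠ 0 := by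
    rwa [ne_eq, IsFractionRing.to_map_eq_zero_iff]
  exact ⟨_, hT.mul_left p, mul_ne_zero hp' hc, fun v' hv' => hlt v' (right_ne_zero_of_mul hv')⟩

/-- Among the operators whose coefficient does not vanish, one with the longest leading
permutation would contribute that permutation alone. -/
theorem eq_zero_of_sum_hasLeading {ι : Type*} {s : Finset ι}
    {T : ι → MvPolynomial (Fin m) R → MvPolynomial (Fin m) R} {v : ι → Equiv.Perm (Fin m)}
    (hT : ∀ x ∈ s, HasLeading (T x) (v x)) (hv : Set.InjOn v s)
    {g : ι → MvPolynomial (Fin m) R} (h : ∀ f, ∑ x ∈ s, g x * T x f = 0) {x : ι} (hx : x ∈ s) :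
    g x = 0 := by
  classical
  by_contra hgx
  obtain ⟨y, hy, hmax⟩ := Finset.exists_max_image (s.filter fun x => g x ≠ 0)
    (fun x => len (v x)) ⟨x, Finset.mem_filter.2 ⟨hx, hgx⟩⟩
  obtain ⟨hys, hgy⟩ := Finset.mem_filter.1 hy
  choose! c hexp hc hlt using hT
  have hcoeff : ∑ x ∈ s, algebraMap _ _ (g x) * c x (v y) = 0 := by
    refine Fintype.linearIndependent_iff.1 linearIndependent_rename
      (fun v => ∑ x ∈ s, algebraMap _ _ (g x) * c x v) (funext fun f => ?_) (v y)
    simp only [Finset.sum_apply, Pi.smul_apply, smul_eq_mul, Finset.sum_mul, Pi.zero_apply]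
    rw [Finset.sum_comm, ← map_zero (algebraMap (MvPolynomial (Fin m) R) _), ← h f, map_sum]
    exact Finset.sum_congr rfl fun x hx => ((hexp x hx).mul_left (g x) f).symm
  rw [Finset.sum_eq_single_of_mem y hys] at hcoeff
  · exact (mul_ne_zero (by rwa [ne_eq, IsFractionRing.to_map_eq_zero_iff]) (hc y hys)) hcoeff
  · intro x hx hne
    by_contra hx₀
    have hgx : g x ≠ 0 := fun hg => left_ne_zero_of_mul hx₀ (by rw [hg, map_zero])
    obtain hvx | hlen := hlt x hx _ (right_ne_zero_of_mul hx₀)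
    · exact hne (hv hx hys hvx.symm)
    · exact absurd (hmax x (Finset.mem_filter.2 ⟨hx, hgx⟩)) (not_le.2 hlen)

end Domain

section DivDiff

variable {k : Type*} [Field k] {m : ℕ} {T : MvPolynomial (Fin m) k → MvPolynomial (Fin m) k}

theorem ExpandsAs.divDiff {c : Equiv.Perm (Fin m) → RationalFunction k m} (h : ExpandsAs T c)
    {a b : Fin m} (hab : a ≠ b) :
    ExpandsAs (fun f => divDiff k a b (T f)) fun v =>
      (c v - fracRename k (Equiv.swap a b) (c (Equiv.swap a b * v))) /
        algebraMap _ _ (X a - X b : MvPolynomial (Fin m) k) := by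
  intro f
  have hne : algebraMap _ (RationalFunction k m) (X a - X b : MvPolynomial (Fin m) k) ≠ 0 := by
    rw [ne_eq, IsFractionRing.to_map_eq_zero_iff]
    exact X_sub_X_ne_zero hab
  have hspec := congrArg (algebraMap _ (RationalFunction k m)) (divDiff_spec k a b (T f))
  rw [map_sub, map_mul, h, h.rename, Equiv.swap_inv, ← Finset.sum_sub_distrib] at hspec
  rw [← mul_right_inj' hne, ← hspec, Finset.mul_sum]
  refine Finset.sum_congr rfl fun v _ => ?_
  field_simp

theorem HasLeading.divDiff {v : Equiv.Perm (Fin m)} (h : HasLeading T v) {a : Fin (m - 1)}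
    (ha : IsAscent a v) :
    HasLeading (fun f => divDiff k (lo a) (hi a) (T f)) (simple a * v) := by
  obtain ⟨c, hT, hc, hlt⟩ := h
  have hlen := len_simple_mul ha
  refine ⟨_, hT.divDiff (lo_ne_hi a), ?_, fun v' hv' => ?_⟩
  · have hzero : c (simple a * v) = 0 := by
      by_contra hne
      obtain hv | hv := hlt _ hne
      · rw [hv] at hlen
        omega
      · omega
    change (c (simple a * v) - fracRename k (simple a) (c (simple a * (simple a * v)))) / _ ≠ 0
    rw [hzero, simple_mul_simple_mul, zero_sub]
    refine div_ne_zero (neg_ne_zero.2 ((map_ne_zero_iff _ (RingEquiv.injective _)).2 hc)) ?_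
    rw [ne_eq, IsFractionRing.to_map_eq_zero_iff]
    exact X_sub_X_ne_zero (lo_ne_hi a)
  · by_cases hcv : c v' = 0
    · have hcs : c (simple a * v') ≠ 0 := fun hcs => hv' <| by
        change (c v' - fracRename k (simple a) (c (simple a * v'))) / _ = 0
        rw [hcv, hcs, map_zero, sub_zero, zero_div]
      obtain hv | hv := hlt _ hcs
      · exact .inl (by rw [← hv, simple_mul_simple_mul])
      · right
        by_cases hasc : IsAscent a v'
        · have := len_simple_mul hasc
          omega
        · have := len_simple_mul_of_not hasc
          omega
    · right
      obtain rfl | hv := hlt _ hcv <;> omega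

end DivDiff

end Leading

section Independence

variable {k : Type*} [Field k] {n m : ℕ}

/-- The permutation `w` takes the strands labelled by `i` to strands labelled by `j`, permuting
the fermionic ones among themselves by `u` and the bosonic ones by `v`. -/
structure RestrictsTo (w : Equiv.Perm (Fin (n + m))) (i j : Labels n m)
    (u : Equiv.Perm (Fin n)) (v : Equiv.Perm (Fin m)) : Prop where
  ferm (x : Fin n) : w (GL12.ferm i x) = GL12.ferm j (u x)
  bos (x : Fin m) : w (GL12.bos i x) = GL12.bos j (v x)

namespace RestrictsTo

variable {w w' : Equiv.Perm (Fin (n + m))} {i j : Labels n m} {u : Equiv.Perm (Fin n)}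
  {v : Equiv.Perm (Fin m)} {t : Fin (n + m - 1)}

theorem one (i : Labels n m) : RestrictsTo 1 i i 1 1 :=
  ⟨fun _ => rfl, fun _ => rfl⟩

theorem unique (h : RestrictsTo w i j u v) (h' : RestrictsTo w' i j u v) : w = w' := by
  refine Equiv.ext fun p => ?_
  cases hp : i.1 p
  · obtain ⟨x, rfl⟩ := exists_ferm hp
    rw [h.ferm, h'.ferm]
  · obtain ⟨x, rfl⟩ := exists_bos hp
    rw [h.bos, h'.bos]

theorem inv (h : RestrictsTo w i j u v) : RestrictsTo w⁻¹ j i u⁻¹ v⁻¹ where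
  ferm x := by
    rw [Equiv.Perm.inv_eq_iff_eq, h.ferm, ← Equiv.Perm.mul_apply, mul_inv_cancel,
      Equiv.Perm.one_apply]
  bos x := by
    rw [Equiv.Perm.inv_eq_iff_eq, h.bos, ← Equiv.Perm.mul_apply, mul_inv_cancel,
      Equiv.Perm.one_apply]

theorem isAscent_ferm (h : RestrictsTo w i j u v) (ht : IsAscent t w) {a : Fin (n - 1)}
    (hlo : GL12.ferm j (lo a) = lo t) (hhi : GL12.ferm j (hi a) = hi t) : IsAscent a u := by
  change w⁻¹ (lo t) < w⁻¹ (hi t) at ht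
  rw [← hlo, ← hhi, h.inv.ferm, h.inv.ferm] at ht
  exact (ferm_strictMono i).lt_iff_lt.1 ht

theorem isAscent_bos (h : RestrictsTo w i j u v) (ht : IsAscent t w) {a : Fin (m - 1)}
    (hlo : GL12.bos j (lo a) = lo t) (hhi : GL12.bos j (hi a) = hi t) : IsAscent a v := by
  change w⁻¹ (lo t) < w⁻¹ (hi t) at ht
  rw [← hlo, ← hhi, h.inv.bos, h.inv.bos] at ht
  exact (bos_strictMono i).lt_iff_lt.1 ht

theorem simple_mul_ferm (h : RestrictsTo w i j u v) {a : Fin (n - 1)}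
    (hlo : GL12.ferm j (lo a) = lo t) (hhi : GL12.ferm j (hi a) = hi t) :
    RestrictsTo (simple t * w) i (j.sw t) (simple a * u) v where
  ferm x := by
    rw [Equiv.Perm.mul_apply, h.ferm, simple_ferm hlo hhi, sw_eq_self_of_ferm hlo hhi,
      Equiv.Perm.mul_apply]
  bos x := by
    rw [Equiv.Perm.mul_apply, h.bos, simple_bos_of_not]
    simp [(ferm_eq_iff.1 hlo).1]

theorem simple_mul_bos (h : RestrictsTo w i j u v) {a : Fin (m - 1)}
    (hlo : GL12.bos j (lo a) = lo t) (hhi : GL12.bos j (hi a) = hi t) :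
    RestrictsTo (simple t * w) i (j.sw t) u (simple a * v) where
  ferm x := by
    rw [Equiv.Perm.mul_apply, h.ferm, simple_ferm_of_not]
    simp [(bos_eq_iff.1 hlo).1]
  bos x := by
    rw [Equiv.Perm.mul_apply, h.bos, simple_bos hlo hhi, sw_eq_self_of_bos hlo hhi,
      Equiv.Perm.mul_apply]

theorem simple_mul_mixed (h : RestrictsTo w i j u v) (hm : j.1 (lo t) ≠ j.1 (hi t)) :
    RestrictsTo (simple t * w) i (j.sw t) u v where
  ferm x := by
    rw [Equiv.Perm.mul_apply, h.ferm, simple_ferm_of_not fun ht => hm (ht.1.trans ht.2.symm)]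
  bos x := by
    rw [Equiv.Perm.mul_apply, h.bos, simple_bos_of_not fun ht => hm (ht.1.trans ht.2.symm)]

end RestrictsTo

theorem eps_ne_zero (w : Equiv.Perm (Fin n)) (a : Fin (n - 1)) : eps k w a ≠ 0 := by
  rw [eps]
  split_ifs
  · exact one_ne_zero
  · exact neg_ne_zero.2 one_ne_zero

theorem wordDiagram_mul_idem (i : Labels n m) (l : List (Fin (n + m - 1))) :
    wordDiagram k i l * idem k i = wordDiagram k i l := by
  induction l with
  | nil => exact idem_mul_self i
  | cons t l ih => rw [wordDiagram, mul_assoc, ih]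

attribute [local instance] polyModule

namespace IsPolAction

variable {ρ : RAlg k n m →ₐ[k] Module.End k (Pol k n m)} (hρ : IsPolAction ρ)

include hρ

theorem dotSum_single (a : Fin m) (x : Labels n m × Equiv.Perm (Fin n))
    (f : MvPolynomial (Fin m) k) :
    ρ (dotSum k n a) (Finsupp.single x f) = Finsupp.single x (X a * f) := by
  rw [dotSum, map_sum, LinearMap.sum_apply, Finset.sum_eq_single_of_mem x.1 (Finset.mem_univ _)
    fun j _ hj => hρ.dot_ne j x.1 a x.2 f hj.symm]
  exact hρ.dot_self x.1 a x.2 f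

theorem polyDots_single (p : MvPolynomial (Fin m) k) (x : Labels n m × Equiv.Perm (Fin n))
    (f : MvPolynomial (Fin m) k) :
    ρ (polyDots k n m p) (Finsupp.single x f) = Finsupp.single x (p * f) := by
  induction p using MvPolynomial.induction_on generalizing f with
  | C c =>
    rw [← algebraMap_eq, AlgHom.commutes, AlgHom.commutes, Module.algebraMap_end_apply,
      Finsupp.smul_single, Algebra.smul_def]
  | add p q hp hq => rw [map_add, map_add, LinearMap.add_apply, hp, hq, add_mul, Finsupp.single_add]
  | mul_X p a hp =>
    rw [map_mul, map_mul, Module.End.mul_apply, polyDots_X, hρ.dotSum_single, hp, mul_assoc]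

theorem wordDiagram_single_of_ne {i j : Labels n m} (h : j ≠ i) (l : List (Fin (n + m - 1)))
    (w : Equiv.Perm (Fin n)) (f : MvPolynomial (Fin m) k) :
    ρ (wordDiagram k i l) (Finsupp.single (j, w) f) = 0 := by
  rw [← wordDiagram_mul_idem, map_mul, Module.End.mul_apply, hρ.idem_ne i j w f h, map_zero]

theorem exists_cross_single {i j : Labels n m} {w : Equiv.Perm (Fin (n + m))}
    {u : Equiv.Perm (Fin n)} {v : Equiv.Perm (Fin m)} {t : Fin (n + m - 1)}
    {T : MvPolynomial (Fin m) k → MvPolynomial (Fin m) k}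
    (hw : RestrictsTo w i j u v) (ht : IsAscent t w) (hT : HasLeading T v) :
    ∃ u' v' T', RestrictsTo (simple t * w) i (j.sw t) u' v' ∧ HasLeading T' v' ∧
      ∀ f, ρ (cross k j t) (Finsupp.single (j, u) (T f)) = Finsupp.single (j.sw t, u') (T' f) := by
  cases hlo : j.1 (lo t) <;> cases hhi : j.1 (hi t)
  · obtain ⟨a, ha, hb⟩ := exists_ferm_ferm hlo hhi
    have hup := isAscent_iff_len.1 (hw.isAscent_ferm ht ha hb)
    refine ⟨simple a * u, v, _, hw.simple_mul_ferm ha hb,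
      hT.mul_left (C_ne_zero.2 (eps_ne_zero u a)), fun f => ?_⟩
    rw [hρ.cross_ferm_ferm_up j t a u (T f) ha hb hup, sw_eq_self_of_ferm ha hb, C_mul']
  · exact ⟨u, v, T, hw.simple_mul_mixed (by simp [hlo, hhi]), hT,
      fun f => hρ.cross_ferm_bos j t u (T f) hlo hhi⟩
  · obtain ⟨a, ha⟩ := exists_bos hlo
    exact ⟨u, v, _, hw.simple_mul_mixed (by simp [hlo, hhi]), hT.mul_left (X_ne_zero a),
      fun f => hρ.cross_bos_ferm j t a u (T f) ha hhi⟩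
  · obtain ⟨a, ha, hb⟩ := exists_bos_bos hlo hhi
    refine ⟨u, simple a * v, _, hw.simple_mul_bos ha hb, hT.divDiff (hw.isAscent_bos ht ha hb),
      fun f => ?_⟩
    rw [hρ.cross_bos_bos j t _ _ u (T f) ha hb, sw_eq_self_of_bos ha hb]

theorem exists_wordDiagram_single (i : Labels n m) {l : List (Fin (n + m - 1))}
    {w : Equiv.Perm (Fin (n + m))} (hl : IsReducedWord l w) :
    ∃ u v T, RestrictsTo w i (topLabels i l) u v ∧ HasLeading T v ∧
      ∀ f, ρ (wordDiagram k i l) (Finsupp.single (i, 1) f) =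
        Finsupp.single (topLabels i l, u) (T f) := by
  induction l generalizing w with
  | nil => exact ⟨1, 1, fun f => f, hl.1 ▸ .one i, hasLeading_id, hρ.idem_self i 1⟩
  | cons t l ih =>
    obtain ⟨ht, hl⟩ := isReducedWord_cons.1 hl
    obtain ⟨u, v, T, hw, hT, hdiag⟩ := ih hl
    obtain ⟨u', v', T', hw', hT', hcross⟩ :=
      hρ.exists_cross_single hw (isAscent_simple_mul.2 ht) hT
    rw [simple_mul_simple_mul] at hw'
    refine ⟨u', v', T', hw', hT', fun f => ?_⟩
    rw [wordDiagram, map_mul, Module.End.mul_apply, hdiag, hcross, topLabels]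

theorem sum_smul_wordDiagram_single
    {word : Equiv.Perm (Fin (n + m)) → List (Fin (n + m - 1))}
    (g : Labels n m × Equiv.Perm (Fin (n + m)) → MvPolynomial (Fin m) k) (i : Labels n m)
    (f : MvPolynomial (Fin m) k) :
    ρ (∑ x, g x • wordDiagram k x.1 (word x.2)) (Finsupp.single (i, 1) f) =
      ∑ w, ρ (polyDots k n m (g (i, w)))
        (ρ (wordDiagram k i (word w)) (Finsupp.single (i, 1) f)) := by
  simp only [map_sum, LinearMap.sum_apply, Fintype.sum_prod_type, poly_smul_def, map_mul,
    Module.End.mul_apply]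
  refine Finset.sum_eq_single_of_mem i (Finset.mem_univ i) fun j _ hj => ?_
  exact Finset.sum_eq_zero fun w _ => by rw [hρ.wordDiagram_single_of_ne hj.symm, map_zero]

/-- The permutations `w` whose diagrams take `Pol(i,1)` to the same summand of `Pol` agree on the
fermionic strands, hence differ on the bosonic ones and act there with different leading
permutations. -/
theorem eq_zero_of_map_eq_zero {word : Equiv.Perm (Fin (n + m)) → List (Fin (n + m - 1))}
    (hword : ∀ w, IsReducedWord (word w) w)
    {g : Labels n m × Equiv.Perm (Fin (n + m)) → MvPolynomial (Fin m) k}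
    (h : ρ (∑ x, g x • wordDiagram k x.1 (word x.2)) = 0)
    (x : Labels n m × Equiv.Perm (Fin (n + m))) : g x = 0 := by
  classical
  obtain ⟨i, w₀⟩ := x
  choose u v T hw hT hdiag using fun w => hρ.exists_wordDiagram_single i (hword w)
  let target (w : Equiv.Perm (Fin (n + m))) := (topLabels i (word w), u w)
  refine eq_zero_of_sum_hasLeading (g := fun w => g (i, w))
    (s := Finset.univ.filter fun w => target w = target w₀) (fun w _ => hT w) ?_ (fun f => ?_)
    (Finset.mem_filter_univ w₀ |>.2 rfl)
  · intro w hw₁ w' hw₂ hv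
    have htarget : target w = target w' :=
      ((Finset.mem_filter_univ w).1 hw₁).trans ((Finset.mem_filter_univ w').1 hw₂).symm
    obtain ⟨htop, hu⟩ := Prod.mk.inj htarget
    exact (hw w).unique (htop ▸ hu ▸ hv ▸ hw w')
  · have hsum := hρ.sum_smul_wordDiagram_single (word := word) g i f
    simp only [h, LinearMap.zero_apply, hdiag, hρ.polyDots_single] at hsum
    have hcoord := DFunLike.congr_fun hsum (target w₀)
    rw [Finsupp.finsetSum_apply, Finsupp.zero_apply] at hcoord
    rw [hcoord, Finset.sum_filter]
    exact Finset.sum_congr rfl fun w _ => by rw [Finsupp.single_apply]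

end IsPolAction

end Independence

/-! ### Polynomials over symmetric polynomials -/

section MonicRoot

variable {S A : Type*} [CommRing S] [CommRing A] [Algebra S A] {T : Subalgebra S A}

theorem mem_lifts_of_coeff_mem {q : Polynomial A} (hq : ∀ r, q.coeff r ∈ T) :
    q ∈ Polynomial.lifts (algebraMap T A) :=
  (Polynomial.lifts_iff_coeff_lifts _).2 fun r => ⟨⟨_, hq r⟩, rfl⟩

theorem coeff_mem_of_X_sub_C_mul {x : A} (hx : x ∈ T) {p : Polynomial A}
    (h : ∀ r, ((Polynomial.X - Polynomial.C x) * p).coeff r ∈ T) (r : ℕ) : p.coeff r ∈ T := by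
  obtain ⟨q, hq⟩ := (Polynomial.mem_lifts _).1 (mem_lifts_of_coeff_mem h)
  have hdiv : (q.divByMonic (Polynomial.X - Polynomial.C (⟨x, hx⟩ : T))).map
      (algebraMap T A) = p := by
    rw [Polynomial.map_divByMonic _ (Polynomial.monic_X_sub_C _), hq, Polynomial.map_sub,
      Polynomial.map_X, Polynomial.map_C]
    exact Polynomial.mul_divByMonic_cancel_left _ (Polynomial.monic_X_sub_C _)
  rw [← hdiv, Polynomial.coeff_map]
  exact SetLike.coe_mem _

theorem exists_sum_mul_pow_of_mem_adjoin {x : A} {q : Polynomial A} (hm : q.Monic)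
    (hq : ∀ r, q.coeff r ∈ T) (h₀ : q.eval x = 0) {p : A} (hp : p ∈ Algebra.adjoin T {x}) :
    ∃ c : ℕ → T, ∑ r ∈ Finset.range q.natDegree, (c r : A) * x ^ r = p := by
  classical
  obtain ⟨q', hq', hdeg, hmon⟩ :=
    Polynomial.lifts_and_natDegree_eq_and_monic (mem_lifts_of_coeff_mem hq) hm
  have hroot : Polynomial.aeval x q' = 0 := by
    rw [Polynomial.aeval_def, ← Polynomial.eval_map, hq', h₀]
  rw [← Subalgebra.mem_toSubmodule, ← Submodule.span_range_natDegree_eq_adjoin hmon hroot, hdeg,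
    Finset.coe_image, Submodule.mem_span_image_finset_iff_exists_fun'] at hp
  obtain ⟨c, rfl⟩ := hp
  exact ⟨c, rfl⟩

end MonicRoot

/-- By independence of characters the matrix `φ v (g e)` has nonzero determinant: a relation
between its rows is a relation between the homomorphisms `φ v`. -/
theorem linearIndependent_of_span_eq_top {ι S A B : Type*} [Finite ι] [CommRing S] [CommRing A]
    [CommRing B] [IsDomain B] [Algebra S A] [Algebra S B] [FaithfulSMul S B] {φ : ι → A →ₐ[S] B}
    (hφ : Function.Injective φ) {g : ι → A} (hg : Submodule.span S (Set.range g) = ⊤) :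
    LinearIndependent S g := by
  classical
  cases nonempty_fintype ι
  let M : Matrix ι ι B := .of fun v e => φ v (g e)
  have hdet : M.det ≠ 0 := by
    intro h
    obtain ⟨d, hd, hdM⟩ := Matrix.exists_vecMul_eq_zero_iff.2 h
    have hsum : ∑ v, d v • (φ v).toLinearMap = 0 :=
      LinearMap.ext_on_range hg fun e => by
        simpa [Matrix.vecMul, dotProduct, M] using congrFun hdM e
    exact hd (funext (Fintype.linearIndependent_iff.1
      ((linearIndependent_algHom_toLinearMap S A B).comp φ hφ) d hsum))
  rw [Fintype.linearIndependent_iff]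
  intro s hs e
  have hMs : M.mulVec (fun e => algebraMap S B (s e)) = 0 := by
    funext v
    simpa [Matrix.mulVec, dotProduct, M, Algebra.smul_def, mul_comm] using congrArg (φ v) hs
  have hse := congrFun (Matrix.eq_zero_of_mulVec_eq_zero hdet hMs) e
  exact (FaithfulSMul.algebraMap_injective S B) (hse.trans (map_zero _).symm)

section Symmetric

variable (R : Type*) [CommRing R] (m : ℕ)

/-- The algebra generated by the symmetric polynomials and the variables from the `j`-th on. -/
def symAdjoin (j : ℕ) : Subalgebra (symmetricSubalgebra (Fin m) R) (MvPolynomial (Fin m) R) :=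
  Algebra.adjoin _ (X '' {i : Fin m | j ≤ i})

/-- The monic polynomial whose roots are the first `j` variables. -/
def rootPoly (j : ℕ) : Polynomial (MvPolynomial (Fin m) R) :=
  ∏ i ∈ Finset.univ.filter (fun i : Fin m => (i : ℕ) < j), (Polynomial.X - Polynomial.C (X i))

/-- The monomial `∏ X i ^ e i`, with exponents below the staircase `1, 2, …, m`. There are `m!`
of them, as many as permutations of the variables. -/
def stairMonomial (e : (i : Fin m) → Fin (i + 1)) : MvPolynomial (Fin m) R :=
  ∏ i, X i ^ (e i : ℕ)

/-- The span over the symmetric polynomials of the staircase monomials in the variables from the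
`j`-th on. -/
def stairSpan (j : ℕ) : Submodule (symmetricSubalgebra (Fin m) R) (MvPolynomial (Fin m) R) :=
  Submodule.span _ (stairMonomial R m '' {e | ∀ i : Fin m, (i : ℕ) < j → e i = 0})

variable {R m}

theorem mem_adjoin_X_of_mem_symAdjoin {j : ℕ} (hj : j < m) {p : MvPolynomial (Fin m) R}
    (hp : p ∈ symAdjoin R m j) :
    p ∈ Algebra.adjoin (symAdjoin R m (j + 1)) {(X ⟨j, hj⟩ : MvPolynomial (Fin m) R)} := by
  have hset : {i : Fin m | j ≤ i} = {i : Fin m | j + 1 ≤ i} ∪ {⟨j, hj⟩} := by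
    ext i
    simp only [Set.mem_ofPred_eq, Set.mem_union, Set.mem_singleton_iff, Fin.ext_iff]
    omega
  rwa [symAdjoin, hset, Set.image_union, Set.image_singleton,
    Algebra.adjoin_union_eq_adjoin_adjoin, Subalgebra.mem_restrictScalars] at hp

theorem symAdjoin_zero : symAdjoin R m 0 = ⊤ := by
  refine eq_top_iff.2 fun p _ => ?_
  induction p using MvPolynomial.induction_on with
  | C c => exact (symAdjoin R m 0).algebraMap_mem (algebraMap R _ c)
  | add p q hp hq => exact add_mem (hp trivial) (hq trivial)
  | mul_X p i hp => exact mul_mem (hp trivial) (Algebra.subset_adjoin ⟨i, Nat.zero_le _, rfl⟩)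

theorem symAdjoin_self : symAdjoin R m m = ⊥ := by
  have hempty : {i : Fin m | m ≤ i} = ∅ := Set.eq_empty_of_forall_notMem fun i => i.2.not_ge
  rw [symAdjoin, hempty, Set.image_empty, Algebra.adjoin_empty]

theorem rootPoly_monic (j : ℕ) : (rootPoly R m j).Monic :=
  Polynomial.monic_prod_of_monic _ _ fun _ _ => Polynomial.monic_X_sub_C _

theorem rootPoly_succ {j : ℕ} (hj : j < m) :
    rootPoly R m (j + 1) = (Polynomial.X - Polynomial.C (X ⟨j, hj⟩)) * rootPoly R m j := by
  have hset : Finset.univ.filter (fun i : Fin m => (i : ℕ) < j + 1) =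
      insert ⟨j, hj⟩ (Finset.univ.filter fun i : Fin m => (i : ℕ) < j) := by
    ext i
    simp only [Finset.mem_filter, Finset.mem_univ, true_and, Finset.mem_insert, Fin.ext_iff]
    omega
  rw [rootPoly, hset, Finset.prod_insert (by simp), rootPoly]

theorem natDegree_rootPoly_le (j : ℕ) : (rootPoly R m j).natDegree ≤ j := by
  refine (Polynomial.natDegree_prod_le _ _).trans ?_
  refine (Finset.sum_le_card_nsmul _ _ 1 fun i _ => Polynomial.natDegree_X_sub_C_le _).trans ?_
  rw [smul_eq_mul, mul_one, Fin.card_filter_val_lt]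
  exact min_le_right m j

theorem coeff_rootPoly_self_mem (r : ℕ) :
    (rootPoly R m m).coeff r ∈ symmetricSubalgebra (Fin m) R := by
  have hprod : rootPoly R m m = ∏ i : Fin m, (Polynomial.X - Polynomial.C (X i)) := by
    rw [rootPoly, Finset.filter_true_of_mem fun i _ => i.2]
  refine (mem_symmetricSubalgebra _).2 fun σ => ?_
  have hmap : (rootPoly R m m).map (rename (R := R) σ).toRingHom = rootPoly R m m := by
    simp only [hprod, Polynomial.map_prod, AlgHom.toRingHom_eq_coe, Polynomial.map_sub,
      Polynomial.map_X, Polynomial.map_C, RingHom.coe_coe, rename_X]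
    exact Equiv.prod_comp σ fun i => (Polynomial.X - Polynomial.C (X i : MvPolynomial _ R))
  conv_rhs => rw [← hmap]
  exact (Polynomial.coeff_map _ _).symm

theorem coeff_rootPoly_mem {j : ℕ} (hj : j ≤ m) (r : ℕ) :
    (rootPoly R m j).coeff r ∈ symAdjoin R m j := by
  induction hj using Nat.decreasingInduction generalizing r with
  | self => exact (symAdjoin R m m).algebraMap_mem ⟨_, coeff_rootPoly_self_mem r⟩
  | of_succ j hj ih =>
    have hx : (X ⟨j, hj⟩ : MvPolynomial (Fin m) R) ∈ symAdjoin R m j :=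
      Algebra.subset_adjoin ⟨⟨j, hj⟩, le_refl j, rfl⟩
    have hle : symAdjoin R m (j + 1) ≤ symAdjoin R m j :=
      Algebra.adjoin_mono (Set.image_mono fun i hi => (Nat.le_succ j).trans hi)
    refine coeff_mem_of_X_sub_C_mul hx (fun r => ?_) r
    rw [← rootPoly_succ hj]
    exact hle (ih r)

theorem stairMonomial_mul_X_pow {e : (i : Fin m) → Fin (i + 1)} {j : Fin m} (he : e j = 0)
    (r : Fin (j + 1)) :
    stairMonomial R m e * X j ^ (r : ℕ) = stairMonomial R m (Function.update e j r) := by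
  rw [stairMonomial, stairMonomial, ← Finset.prod_erase_mul _ _ (Finset.mem_univ j),
    ← Finset.prod_erase_mul (a := j) _ _ (Finset.mem_univ j), Function.update_self, he,
    Fin.val_zero, pow_zero, mul_one]
  congr 1
  refine Finset.prod_congr rfl fun i hi => ?_
  rw [Function.update_of_ne (Finset.ne_of_mem_erase hi)]

theorem mul_X_pow_mem_stairSpan {j : ℕ} (hj : j < m) {p : MvPolynomial (Fin m) R}
    (hp : p ∈ stairSpan R m (j + 1)) {r : ℕ} (hr : r < j + 1) :
    p * X ⟨j, hj⟩ ^ r ∈ stairSpan R m j := by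
  induction hp using Submodule.span_induction with
  | mem p hp =>
    obtain ⟨e, he, rfl⟩ := hp
    refine Submodule.subset_span ⟨Function.update e ⟨j, hj⟩ ⟨r, hr⟩, fun i hi => ?_,
      (stairMonomial_mul_X_pow (he ⟨j, hj⟩ j.lt_succ_self) ⟨r, hr⟩).symm⟩
    rw [Function.update_of_ne (Fin.ne_of_lt hi), he i (hi.trans j.lt_succ_self)]
  | zero => rw [zero_mul]; exact zero_mem _
  | add p q _ _ hp hq => rw [add_mul]; exact add_mem hp hq
  | smul s p _ hp => rw [smul_mul_assoc]; exact Submodule.smul_mem _ s hp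

theorem symAdjoin_le_stairSpan {j : ℕ} (hj : j ≤ m) :
    (symAdjoin R m j).toSubmodule ≤ stairSpan R m j := by
  induction hj using Nat.decreasingInduction with
  | self =>
    have hone : (1 : MvPolynomial (Fin m) R) ∈ stairSpan R m m :=
      Submodule.subset_span ⟨fun _ => 0, fun _ _ => rfl, by simp [stairMonomial]⟩
    rw [symAdjoin_self, Algebra.toSubmodule_bot]
    exact Submodule.one_le.2 hone
  | of_succ j hj ih =>
    intro p hp
    have hroot : (rootPoly R m (j + 1)).eval (X ⟨j, hj⟩) = 0 := by
      rw [rootPoly_succ hj, Polynomial.eval_mul, Polynomial.eval_sub, Polynomial.eval_X,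
        Polynomial.eval_C, sub_self, zero_mul]
    obtain ⟨c, rfl⟩ := exists_sum_mul_pow_of_mem_adjoin (rootPoly_monic (j + 1))
      (coeff_rootPoly_mem hj) hroot
      (mem_adjoin_X_of_mem_symAdjoin hj hp)
    exact sum_mem fun r hr => mul_X_pow_mem_stairSpan hj (ih (c r).2)
      ((Finset.mem_range.1 hr).trans_le (natDegree_rootPoly_le _))

theorem span_stairMonomial : Submodule.span (symmetricSubalgebra (Fin m) R)
    (Set.range (stairMonomial R m)) = ⊤ := by
  have h : ⊤ ≤ stairSpan R m 0 := by
    simpa only [symAdjoin_zero, Algebra.top_toSubmodule] using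
      symAdjoin_le_stairSpan (R := R) (Nat.zero_le m)
  exact top_le_iff.1 (h.trans (Submodule.span_mono (Set.image_subset_range _ _)))

theorem card_perm_eq_card_stair (m : ℕ) :
    Nat.card (Equiv.Perm (Fin m)) = Nat.card ((i : Fin m) → Fin ((i : ℕ) + 1)) := by
  simp only [Nat.card_eq_fintype_card, Fintype.card_perm, Fintype.card_fin, Fintype.card_pi]
  rw [Fin.prod_univ_eq_prod_range (fun i => i + 1), Finset.prod_range_add_one_eq_factorial]

variable (R) in
/-- A permutation of the variables, as an algebra endomorphism over the symmetric polynomials. -/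
def symRename (v : Equiv.Perm (Fin m)) :
    MvPolynomial (Fin m) R →ₐ[symmetricSubalgebra (Fin m) R] MvPolynomial (Fin m) R where
  __ := (rename v : MvPolynomial (Fin m) R →ₐ[R] _)
  commutes' s := (mem_symmetricSubalgebra _).1 s.2 v

theorem symRename_injective [Nontrivial R] : Function.Injective (symRename R (m := m)) :=
  fun v v' h => Equiv.ext fun a => X_injective (R := R) <| by
    have hX : rename v (X a : MvPolynomial _ R) = rename v' (X a) := DFunLike.congr_fun h (X a)
    rwa [rename_X, rename_X] at hX

variable (R m) in
theorem exists_basis_symmetric [IsDomain R] : Nonempty (Module.Basis (Equiv.Perm (Fin m))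
    (symmetricSubalgebra (Fin m) R) (MvPolynomial (Fin m) R)) := by
  obtain ⟨e⟩ := Finite.card_eq.1 (card_perm_eq_card_stair m)
  have hspan : Submodule.span (symmetricSubalgebra (Fin m) R)
      (Set.range (stairMonomial R m ∘ e)) = ⊤ := by
    rw [e.surjective.range_comp, span_stairMonomial]
  exact ⟨.mk (linearIndependent_of_span_eq_top symRename_injective hspan) hspan.ge⟩

end Symmetric

/-! ### The structure of `R(n,m)` -/

section Structure

variable {k : Type*} [Field k] {n m : ℕ}

attribute [local instance] polyModule

theorem IsPolAction.injective {ρ : RAlg k n m →ₐ[k] Module.End k (Pol k n m)}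
    (hρ : IsPolAction ρ) : Function.Injective ρ := by
  choose word hword using exists_reducedWord (N := n + m)
  rw [injective_iff_map_eq_zero]
  intro x hx
  obtain ⟨g, rfl⟩ := (Submodule.mem_span_range_iff_exists_fun (MvPolynomial (Fin m) k)).1
    ((span_wordDiagram hword).ge (Submodule.mem_top (x := x)))
  exact Finset.sum_eq_zero fun y _ => by rw [hρ.eq_zero_of_map_eq_zero hword hx, zero_smul]

section Basis

variable {word : Equiv.Perm (Fin (n + m)) → List (Fin (n + m - 1))}

/-- The diagrams of fixed reduced words, as a basis of `R(n,m)` over the polynomials in dots. -/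
def polyBasis (hword : ∀ w, IsReducedWord (word w) w) :
    Module.Basis (Labels n m × Equiv.Perm (Fin (n + m))) (MvPolynomial (Fin m) k) (RAlg k n m) :=
  .mk (v := fun x => wordDiagram k x.1 (word x.2))
    (Fintype.linearIndependent_iff.2 fun _ hg =>
      isPolAction_polRep.eq_zero_of_map_eq_zero hword (by rw [hg, map_zero]))
    (span_wordDiagram hword).ge

theorem dotSum_pow_mul_idem (i : Labels n m) (a : Fin m) (r : ℕ) :
    dotSum k n a ^ r * idem k i = dot k i a ^ r * idem k i := by
  induction r with
  | zero => rw [pow_zero, pow_zero]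
  | succ r ih =>
    rw [pow_succ, mul_assoc, dotSum_mul_idem, ← idem_mul_dot, ← mul_assoc, ih, mul_assoc,
      idem_mul_dot, pow_succ, mul_assoc, dot_mul_idem]

theorem polyDots_prod_mul_idem (i : Labels n m) (e : Fin m → ℕ) (L : List (Fin m)) :
    polyDots k n m (L.map fun a => X a ^ e a).prod * idem k i =
      (L.map fun a => dot k i a ^ e a).prod * idem k i := by
  induction L with
  | nil => simp only [List.map_nil, List.prod_nil, map_one]
  | cons a L ih =>
    simp only [List.map_cons, List.prod_cons]
    rw [map_mul, map_pow, polyDots_X, mul_assoc, (commute_polyDots_idem _ i).eq, ← mul_assoc,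
      dotSum_pow_mul_idem, mul_assoc, ← (commute_polyDots_idem _ i).eq, ih, mul_assoc]

theorem monomial_smul_wordDiagram (i : Labels n m) (l : List (Fin (n + m - 1)))
    (e : Fin m →₀ ℕ) :
    (monomial e 1 : MvPolynomial (Fin m) k) • wordDiagram k i l = dottedDiagram k i l e := by
  have hprod : (monomial e 1 : MvPolynomial (Fin m) k) =
      ((List.finRange m).map fun a => X a ^ e a).prod := by
    rw [monomial_eq, C_1, one_mul, Finsupp.prod_fintype _ _ (fun _ => pow_zero _),
      ← List.ofFn_eq_map, List.prod_ofFn]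
  rw [poly_smul_def, hprod, dottedDiagram, List.ofFn_eq_map, ← idem_mul_wordDiagram, ← mul_assoc,
    polyDots_prod_mul_idem, mul_assoc]

theorem exists_basis_dottedDiagram (hword : ∀ w, IsReducedWord (word w) w) :
    ∃ b : Module.Basis (Labels n m × Equiv.Perm (Fin (n + m)) × (Fin m → ℕ)) k (RAlg k n m),
      ∀ i w e, b (i, w, e) = dottedDiagram k i (word w) e := by
  have : IsScalarTower k (MvPolynomial (Fin m) k) (RAlg k n m) :=
    ⟨fun c p x => by rw [poly_smul_def, poly_smul_def, map_smul, smul_mul_assoc]⟩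
  let φ : (Fin m →₀ ℕ) × (Labels n m × Equiv.Perm (Fin (n + m))) ≃
      Labels n m × Equiv.Perm (Fin (n + m)) × (Fin m → ℕ) :=
    (Equiv.prodComm _ _).trans ((Equiv.prodAssoc _ _ _).trans
      (Equiv.prodCongr (Equiv.refl _) (Equiv.prodCongr (Equiv.refl _) Finsupp.equivFunOnFinite)))
  refine ⟨((basisMonomials (Fin m) k).smulTower (polyBasis hword)).reindex φ, fun i w e => ?_⟩
  have hφ : φ.symm (i, w, e) = (Finsupp.equivFunOnFinite.symm e, (i, w)) := rfl
  rw [Module.Basis.reindex_apply, hφ, Module.Basis.smulTower_apply, coe_basisMonomials,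
    polyBasis, Module.Basis.mk_apply, monomial_smul_wordDiagram]
  rfl

end Basis

theorem nonempty_labels (n m : ℕ) : Nonempty (Labels n m) := by
  obtain ⟨s, -, hs⟩ := Finset.exists_subset_card_eq
    (s := (Finset.univ : Finset (Fin (n + m)))) (n := m) (by simp)
  exact ⟨fun p => decide (p ∈ s), by simpa using hs⟩

theorem polyDots_injective : Function.Injective (polyDots k n m) := by
  rw [injective_iff_map_eq_zero]
  intro p hp
  obtain ⟨i⟩ := nonempty_labels n m
  have h := (isPolAction_polRep (k := k) (n := n)).polyDots_single p (i, 1) 1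
  rwa [hp, map_zero, LinearMap.zero_apply, eq_comm, Finsupp.single_eq_zero, mul_one] at h

theorem commute_of_commute_generators {x : RAlg k n m} (hidem : ∀ i, Commute x (idem k i))
    (hdot : ∀ i a, Commute x (dot k i a)) (hcross : ∀ i t, Commute x (cross k i t))
    (y : RAlg k n m) : Commute x y := by
  obtain ⟨y, rfl⟩ := RingQuot.mkAlgHom_surjective k (Rel k n m) y
  induction y with
  | grade0 c =>
    rw [AlgHom.commutes]
    exact Algebra.commute_algebraMap_right c x
  | grade1 g =>
    cases g with
    | idem i => exact hidem i
    | dot i a => exact hdot i a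
    | cross i t => exact hcross i t
  | mul y z hy hz =>
    rw [map_mul]
    exact hy.mul_right hz
  | add y z hy hz =>
    rw [map_add]
    exact hy.add_right hz

theorem commute_polyDots_dot (p : MvPolynomial (Fin m) k) (i : Labels n m) (a : Fin m) :
    Commute (polyDots k n m p) (dot k i a) := by
  rw [← dotSum_mul_idem, ← polyDots_X]
  exact ((Commute.all p (X a)).map (polyDots k n m)).mul_right (commute_polyDots_idem p i)

theorem commute_polyDots_cross_of_isSymmetric {p : MvPolynomial (Fin m) k} (hp : p.IsSymmetric)
    (i : Labels n m) (t : Fin (n + m - 1)) : Commute (polyDots k n m p) (cross k i t) := by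
  by_cases h : i.1 (lo t) = true ∧ i.1 (hi t) = true
  · obtain ⟨a, ha⟩ := exists_bos h.1
    obtain ⟨b, hb⟩ := exists_bos h.2
    have hcross := cross_mul_polyDots_bos (k := k) ha hb p
    rw [hp, divDiff_of_symm (ne_of_bos ha hb) (hp _), map_zero, zero_mul, add_zero] at hcross
    exact hcross.symm
  · exact commute_polyDots_cross h p

theorem symDots_le_center : symDots k n m ≤ Subalgebra.center k (RAlg k n m) := by
  rintro _ ⟨p, hp, rfl⟩
  exact Subalgebra.mem_center_iff.2 fun x =>
    (commute_of_commute_generators (commute_polyDots_idem p) (commute_polyDots_dot p)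
      (commute_polyDots_cross_of_isSymmetric ((mem_symmetricSubalgebra p).1 hp)) x).eq.symm

/-- The copy `Sym(n,m)` of the symmetric polynomials in `R(n,m)`. -/
def symEquiv (k : Type*) [Field k] (n m : ℕ) :
    symmetricSubalgebra (Fin m) k ≃ₐ[k] symDots k n m :=
  (symmetricSubalgebra (Fin m) k).equivMapOfInjective _ polyDots_injective

theorem exists_basis_symDots : ∃ ι : Type, ∃ _ : Finite ι,
    Nonempty (Module.Basis ι (symDots k n m) (RAlg k n m)) := by
  choose word hword using exists_reducedWord (N := n + m)
  obtain ⟨b⟩ := exists_basis_symmetric k m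
  exact ⟨_, inferInstance, ⟨(b.smulTower (polyBasis (k := k) hword)).mapCoeffs
    (symEquiv k n m).toRingEquiv fun _ _ => rfl⟩⟩

theorem free_symDots : Module.Free (symDots k n m) (RAlg k n m) := by
  obtain ⟨ι, _, ⟨b⟩⟩ := exists_basis_symDots (k := k) (n := n) (m := m)
  exact Module.Free.of_basis b

theorem finite_symDots : Module.Finite (symDots k n m) (RAlg k n m) := by
  obtain ⟨ι, _, ⟨b⟩⟩ := exists_basis_symDots (k := k) (n := n) (m := m)
  exact Module.Finite.of_basis b

theorem isNoetherian_symDots : IsNoetherian (symDots k n m) (RAlg k n m) := by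
  have : IsNoetherianRing (symDots k n m) := isNoetherianRing_of_ringEquiv _
    ((esymmAlgEquiv (Fin m) k (Fintype.card_fin m)).trans (symEquiv k n m)).toRingEquiv
  have := finite_symDots (k := k) (n := n) (m := m)
  exact isNoetherian_of_isNoetherianRing_of_finite (symDots k n m) (RAlg k n m)

theorem isNoetherianRing_RAlg : IsNoetherianRing (RAlg k n m) :=
  isNoetherian_of_tower (symDots k n m) isNoetherian_symDots

theorem isNoetherianRing_RAlg_op : IsNoetherianRing (RAlg k n m)ᵐᵒᵖ := by
  have : IsScalarTower (symDots k n m) (RAlg k n m)ᵐᵒᵖ (RAlg k n m)ᵐᵒᵖ := by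
    refine ⟨fun s x y => MulOpposite.unop_injective ?_⟩
    have hs := Subalgebra.mem_center_iff.1 (symDots_le_center s.2) y.unop
    simp only [smul_eq_mul, MulOpposite.unop_smul, MulOpposite.unop_mul, Subalgebra.smul_def]
    rw [← mul_assoc, hs, mul_assoc]
  have := isNoetherian_symDots (k := k) (n := n) (m := m)
  exact isNoetherian_of_tower (symDots k n m)
    (isNoetherian_of_linearEquiv (MulOpposite.opLinearEquiv (symDots k n m)))

end Structure

end GL12

end

theorem mainTheorem3 (k : Type*) [Field k] (n m : ℕ) :
    -- `σ_w` does not depend on the reduced presentation of `w`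
    (∀ (w : Equiv.Perm (Fin n)) (l : List (Fin (n - 1))), IsReducedWord l w →
      sigma k w = wordSign l • (l.map (sigmaGen k)).prod) ∧
    -- the signs in the rules for the action are the ones that the formula for `σ_w` determines
    (∀ (w : Equiv.Perm (Fin n)) (a : Fin (n - 1)), len (simple a * w) = len w + 1 →
      sigma k (simple a * w) = eps k w a • (sigmaGen k a * sigma k w)) ∧
    -- the rules define an action on `Pol`, and it is faithful
    (∃ ρ : RAlg k n m →ₐ[k] Module.End k (Pol k n m), IsPolAction ρ ∧ Function.Injective ρ) ∧
    -- the dotted diagrams of fixed reduced presentations form a basis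
    (∀ word : Equiv.Perm (Fin (n + m)) → List (Fin (n + m - 1)),
      (∀ w, IsReducedWord (word w) w) →
      ∃ b : Module.Basis (Labels n m × Equiv.Perm (Fin (n + m)) × (Fin m → ℕ)) k (RAlg k n m),
        ∀ i w e, b (i, w, e) = dottedDiagram k i (word w) e) ∧
    -- `Sym(n,m)` is a central copy of the symmetric polynomials, `R(n,m)` is free of finite rank
    -- over it
    Function.Injective (polyDots k n m) ∧
    symDots k n m ≤ Subalgebra.center k (RAlg k n m) ∧
    Module.Free (symDots k n m) (RAlg k n m) ∧ Module.Finite (symDots k n m) (RAlg k n m) ∧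
    -- `R(n,m)` is left and right Noetherian
    IsNoetherianRing (RAlg k n m) ∧ IsNoetherianRing (RAlg k n m)ᵐᵒᵖ := by
  exact ⟨fun w l hl => hl.sigma_eq k,
    fun w a h => sigma_simple_mul_eps k (isAscent_iff_len.2 h),
    ⟨polRep k n m, isPolAction_polRep, isPolAction_polRep.injective⟩,
    fun word hword => exists_basis_dottedDiagram hword,
    polyDots_injective, symDots_le_center, free_symDots, finite_symDots,
    isNoetherianRing_RAlg, isNoetherianRing_RAlg_op⟩
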